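/- Let $T>0$, let $(\Omega,\mathscr F,P)$ be a probability space and let $B$ be a standard $m$-dimensional fractional Brownian motion on $[0,T]$ with Hurst parameter $H\in(0,1)$. Write $\|\cdot\|_p$ for the $L^p(\Omega)$-norm and $\delta X_{st}=X_t-X_s$. Let $\mathcal V,\mathcal V'$ be finite-dimensional real vector spaces, and for $n,\nu\ge1$ put $t_k=\frac{T}{n}k$ ($0\le k\le n$) and $u_l=\frac T\nu l$ ($0\le l\le\nu$). Let $\gamma>0$ and $\alpha>0$ with $\alpha+2\gamma>1$. Below, $K$ denotes constants that may depend on $p$ but not on $n$, $\nu$ or the time points $s$, $t$, $r$, $r'$ unless stated otherwise. Let $f$ and $g$ be processes on $[0,T]$ with values in $\mathcal V$ and $\mathcal L(\mathbb R^m,\mathcal V)$, such that each $f_t$ is measurable with respect to the $P$-completion of $\sigma(B_s:s\in[0,T])$ and, for all $0\le s\le t\le T$ and all $p\in[1,\infty)$, $$\|f_t\|_p+\|g_t\|_p\le K,\qquad \|\delta f_{st}-g_s\,\delta B_{st}\|_p\le K(t-s)^{2\gamma},\qquad \|\delta g_{st}\|_p\le K(t-s)^{\gamma}.$$ For each $n$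 let $h=h^n$ be a $\mathcal V'$-valued random increment on the grid, i.e. $h_{t_it_k}=h_{t_it_j}+h_{t_jt_k}$ a.s. for $i\le j\le k$, such that for all $0\le i<j\le n$ and all $p\in[1,\infty)$, with $s=t_i$ and $t=t_j$, $$\|h_{st}\|_p\le K(t-s)^{\alpha},\qquad \Big\|\sum_{k=i}^{j-1}\delta B_{st_k}\otimes h_{t_kt_{k+1}}\Big\|_p\le K(t-s)^{\gamma+\alpha}.$$ Put $\eta(t)=t_{\lfloor nt/T\rfloor}$ and $h_t=h_{0\,\eta(t)}$ for $t\in[0,T]$, and suppose that, as $n\to\infty$, the finite-dimensional distributions on $[0,T]$ of $(h,B)$ converge weakly to those of $(W,B)$, where $W$ is a $\mathcal V'$-valued Brownian motion on $[0,T]$ (with some covariance matrix, so that its components may be correlated), independent of $B$ and defined on a possibly enlarged probability space. Let $k_l$ be the index with $t_{k_l}\le u_l<t_{k_l+1}$ and, for $t\in[0,T]$ and $0\le l<\nu$, set $\tilde D_l=\{t_k:\ t_{k_l}\le t_k<t_{k_{l+1}},\ t_k\le t\}$ and $$\zeta^n_l=\sum_{t_k\in\tilde D_l}\delta B_{t_{k_l}t_k}\otimes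 h_{t_kt_{k+1}}.$$ Suppose that for some $\kappa>0$ and for every $t\in[0,T]$ and $p\in[1,\infty)$ there is a constant $K$ (which may depend on $t$ and $p$) such that for all $n,\nu\ge1$ and all $r<r'$ in $\{u_1,\dots,u_\nu\}$, $$\Big\|\sum_{l=\nu r/T}^{\nu r'/T-1}\zeta^n_l\Big\|_p\le K\nu^{-\kappa}(r'-r)^{\alpha+\gamma-\kappa}.$$ Set $\Theta^n_t=\sum_{0\le k\le\lfloor nt/T\rfloor,\ k\le n-1}f_{t_k}\otimes h_{t_kt_{k+1}}$. Then the Itô integral $\Theta_t=\int_0^tf_s\otimes dW_s$, $t\in[0,T]$, exists (with respect to the filtration $\sigma(B_s:s\in[0,T])\vee\sigma(W_u:u\le t)$, as an $L^2$-limit of integrals of simple processes), and, as $n\to\infty$, the finite-dimensional distributions on $[0,T]$ of $(\Theta^n,B)$ converge weakly to those of $(\Theta,B)$. -/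

import Mathlib

open MeasureTheory ProbabilityTheory Filter Topology Set
open scoped NNReal ENNReal TensorProduct RealInnerProductSpace

noncomputable section

namespace WeightedSums

/-- Borel σ-algebra on the tensor product of two finite-dimensional inner product spaces. -/
instance tensorMeasurableSpace {E F : Type*} [NormedAddCommGroup E] [InnerProductSpace ℝ E]
    [NormedAddCommGroup F] [InnerProductSpace ℝ F] : MeasurableSpace (E ⊗[ℝ] F) :=
  borel (E ⊗[ℝ] F)

instance tensorBorelSpace {E F : Type*} [NormedAddCommGroup E] [InnerProductSpace ℝ E]
    [NormedAddCommGroup F] [InnerProductSpace ℝ F] : BorelSpace (E ⊗[ℝ] F) :=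
  ⟨rfl⟩

/-! ### Uniform grids -/

/-- The point `t_k = T k / n` of the uniform partition of `[0, T]` into `n` intervals. -/
def gridPt (T : ℝ) (n k : ℕ) : ℝ := T * k / n

/-- The index `⌊n t / T⌋` of the last point of the uniform `n`-grid that is `≤ t`. -/
def gridIdx (T : ℝ) (n : ℕ) (t : ℝ) : ℕ := ⌊n * t / T⌋₊

/-- The last point of the uniform `n`-grid that is `≤ t`. -/
def gridFloor (T : ℝ) (n : ℕ) (t : ℝ) : ℝ := gridPt T n (gridIdx T n t)

/-- The index `k_l` with `t_{k_l} ≤ u_l < t_{k_l + 1}`, where the `t_k` are the points of the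
`n`-grid and `u_l = T l / ν` those of the `ν`-grid. -/
def coarseIdx (T : ℝ) (n ν l : ℕ) : ℕ := gridIdx T n (gridPt T ν l)

/-- The indices `k` with `t_{k_l} ≤ t_k < t_{k_{l+1}}` and `t_k ≤ t`. -/
def coarseBlock (T : ℝ) (n ν l : ℕ) (t : ℝ) : Finset ℕ :=
  (Finset.Ico (coarseIdx T n ν l) (coarseIdx T n ν (l + 1))).filter fun k => gridPt T n k ≤ t

/-! ### Processes -/

section Processes

variable {Ω : Type*} {E : Type*}

/-- The increment `X_t - X_s` of a process. -/
def incr [Sub E] (X : ℝ → Ω → E) (s t : ℝ) (ω : Ω) : E := X t ω - X s ω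

/-- The σ-algebra generated by `X_s`, `s ∈ [0, t]`. -/
abbrev pastSigma [mE : MeasurableSpace E] (X : ℝ → Ω → E) (t : ℝ) : MeasurableSpace Ω :=
  ⨆ s ∈ Icc (0 : ℝ) t, mE.comap (X s)

/-- The standard `m`-dimensional fractional Brownian motion on `[0, T]` with Hurst parameter `H`:
a centred Gaussian process with almost surely continuous paths whose components are independent,
each with covariance `(s ^ 2H + t ^ 2H - |t - s| ^ 2H) / 2`. -/
structure IsFBM [MeasurableSpace Ω] {m : ℕ} (T H : ℝ) (B : ℝ → Ω → EuclideanSpace ℝ (Fin m))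
    (P : Measure Ω) : Prop where
  measurable : ∀ t ∈ Icc (0 : ℝ) T, Measurable (B t)
  gaussian : IsGaussianProcess (fun t : Icc (0 : ℝ) T => B t) P
  centered : ∀ t ∈ Icc (0 : ℝ) T, ∀ i, ∫ ω, B t ω i ∂P = 0
  covariance : ∀ s ∈ Icc (0 : ℝ) T, ∀ t ∈ Icc (0 : ℝ) T, ∀ i j,
    cov[fun ω => B s ω i, fun ω => B t ω j; P] =
      if i = j then (s ^ (2 * H) + t ^ (2 * H) - |t - s| ^ (2 * H)) / 2 else 0
  continuous : ∀ᵐ ω ∂P, ContinuousOn (fun t => B t ω) (Icc 0 T)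

/-- A Brownian motion on `[0, T]` with values in a finite-dimensional space and with some
covariance operator `Q` (its components may be correlated): it starts from `0`, has independent
increments, `W_t - W_s` is centred Gaussian with covariance `(t - s) Q`, and its paths are almost
surely continuous. -/
structure IsBM [MeasurableSpace Ω] [NormedAddCommGroup E] [InnerProductSpace ℝ E]
    [MeasurableSpace E] (T : ℝ) (W : ℝ → Ω → E) (P : Measure Ω) : Prop where
  measurable : ∀ t ∈ Icc (0 : ℝ) T, Measurable (W t)
  zero : ∀ᵐ ω ∂P, W 0 ω = 0
  indep_incr : HasIndepIncrements (fun t : Icc (0 : ℝ) T => W t) P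
  gaussian_incr : ∃ Q : E →ₗ[ℝ] E, Q.IsPositive ∧
    ∀ s t : ℝ, 0 ≤ s → s ≤ t → t ≤ T → ∀ v : E,
      P.map (fun ω => ⟪v, W t ω - W s ω⟫) = gaussianReal 0 (Real.toNNReal ((t - s) * ⟪Q v, v⟫))
  continuous : ∀ᵐ ω ∂P, ContinuousOn (fun t => W t ω) (Icc 0 T)

/-- Convergence of the finite-dimensional distributions on `[0, T]` of a sequence of processes. -/
def TendstoFDD [MeasurableSpace Ω] {Ω' : Type*} [MeasurableSpace Ω'] [TopologicalSpace E]
    [SecondCountableTopology E] [MeasurableSpace E] [OpensMeasurableSpace E] (T : ℝ)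
    (X : ℕ → ℝ → Ω → E) (P : Measure Ω) [IsProbabilityMeasure P]
    (Y : ℝ → Ω' → E) (P' : Measure Ω') [IsProbabilityMeasure P'] : Prop :=
  ∀ (N : ℕ) (r : Fin N → Icc (0 : ℝ) T),
    TendstoInDistribution (fun n ω i => X n (r i) ω) atTop (fun ω i => Y (r i) ω) (fun _ => P) P'

end Processes

/-! ### The Itô integral -/

section Ito

variable {Ω : Type*} {V V' : Type*} [NormedAddCommGroup V] [InnerProductSpace ℝ V]
  [NormedAddCommGroup V'] [InnerProductSpace ℝ V']

/-- A bounded simple process on `[0, T]`, adapted to the filtration `𝒢`: it is `val i`, which is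
bounded and `𝒢 (time i)`-measurable, on `(time i, time (i + 1)]` for `i < N`. -/
structure SimpleProcess (𝒢 : ℝ → MeasurableSpace Ω) (T : ℝ) (V : Type*) [NormedAddCommGroup V]
    where
  N : ℕ
  time : ℕ → ℝ
  time_mono : Monotone time
  time_mem : ∀ i, time i ∈ Icc (0 : ℝ) T
  val : ℕ → Ω → V
  adapted : ∀ i, StronglyMeasurable[𝒢 (time i)] (val i)
  bounded : ∀ i, ∃ C : ℝ, ∀ ω, ‖val i ω‖ ≤ C

/-- The value of a simple process at time `s`. -/
def SimpleProcess.eval {𝒢 : ℝ → MeasurableSpace Ω} {T : ℝ} (φ : SimpleProcess 𝒢 T V)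
    (s : ℝ) (ω : Ω) : V :=
  ∑ i ∈ Finset.range φ.N, (Ioc (φ.time i) (φ.time (i + 1))).indicator (fun _ => φ.val i ω) s

/-- The integral `∫_0^t φ ⊗ dW` of a simple process. -/
def SimpleProcess.integral {𝒢 : ℝ → MeasurableSpace Ω} {T : ℝ} (φ : SimpleProcess 𝒢 T V)
    (W : ℝ → Ω → V') (t : ℝ) (ω : Ω) : V ⊗[ℝ] V' :=
  ∑ i ∈ Finset.range φ.N,
    φ.val i ω ⊗ₜ[ℝ] (W (min (φ.time (i + 1)) t) ω - W (min (φ.time i) t) ω)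

/-- `Θ` is the Itô integral process `Θ_t = ∫_0^t f_s ⊗ dW_s` on `[0, T]`, with respect to the
filtration `𝒢`: there are simple processes that converge to `f` in `L²(ds ⊗ dP)` and whose
integrals up to time `t` converge to `Θ_t` in `L²(P)`, for each `t`. -/
def IsItoIntegral [MeasurableSpace Ω] (𝒢 : ℝ → MeasurableSpace Ω) (T : ℝ) (f : ℝ → Ω → V)
    (W : ℝ → Ω → V') (Θ : ℝ → Ω → V ⊗[ℝ] V') (P : Measure Ω) : Prop :=
  (∀ t ∈ Icc (0 : ℝ) T, AEStronglyMeasurable (Θ t) P) ∧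
  ∃ φ : ℕ → SimpleProcess 𝒢 T V,
    Tendsto (fun j => ∫⁻ s in Icc (0 : ℝ) T,
      (eLpNorm (fun ω => (φ j).eval s ω - f s ω) 2 P) ^ 2) atTop (𝓝 0) ∧
    ∀ t ∈ Icc (0 : ℝ) T,
      Tendsto (fun j => eLpNorm (fun ω => (φ j).integral W t ω - Θ t ω) 2 P) atTop (𝓝 0)

end Ito

/-! ### Weighted sums -/

section Sums

variable {Ω : Type*} {V V' : Type*} [NormedAddCommGroup V] [InnerProductSpace ℝ V]
  [NormedAddCommGroup V'] [InnerProductSpace ℝ V']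

/-- `∑_{i ≤ k < j} (B_{t_k} - B_{t_i}) ⊗ h_{t_k t_{k+1}}` on the `n`-grid. -/
def discreteIntegral (T : ℝ) (n : ℕ) (B : ℝ → Ω → V) (h : ℝ → ℝ → Ω → V') (i j : ℕ) (ω : Ω) :
    V ⊗[ℝ] V' :=
  ∑ k ∈ Finset.Ico i j,
    incr B (gridPt T n i) (gridPt T n k) ω ⊗ₜ[ℝ] h (gridPt T n k) (gridPt T n (k + 1)) ω

/-- The block sum `ζ_l`: the sum of `(B_{t_k} - B_{t_{k_l}}) ⊗ h_{t_k t_{k+1}}` over the `k` with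
`t_{k_l} ≤ t_k < t_{k_{l+1}}` and `t_k ≤ t`. -/
def blockSum (T : ℝ) (n ν l : ℕ) (B : ℝ → Ω → V) (h : ℝ → ℝ → Ω → V') (t : ℝ) (ω : Ω) :
    V ⊗[ℝ] V' :=
  ∑ k ∈ coarseBlock T n ν l t,
    incr B (gridPt T n (coarseIdx T n ν l)) (gridPt T n k) ω ⊗ₜ[ℝ]
      h (gridPt T n k) (gridPt T n (k + 1)) ω

/-- The weighted sum of `f_{t_k} ⊗ h_{t_k t_{k+1}}` over `0 ≤ k ≤ ⌊n t / T⌋`, `k ≤ n - 1` (the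
second bound matters only at `t = T`, where `t_{n+1}` would lie outside `[0, T]`). -/
def weightedSum (T : ℝ) (n : ℕ) (f : ℝ → Ω → V) (h : ℝ → ℝ → Ω → V') (t : ℝ) (ω : Ω) :
    V ⊗[ℝ] V' :=
  ∑ k ∈ Finset.range (min (gridIdx T n t + 1) n),
    f (gridPt T n k) ω ⊗ₜ[ℝ] h (gridPt T n k) (gridPt T n (k + 1)) ω

end Sums

end WeightedSums

end

/-!
# Weighted sums of grid increments converge to an Itô integral

On a block `[t_i, t_j)` of the grid, the controlled expansion of `f` suggests
`∑ f_{t_k} ⊗ h_{t_k t_{k+1}} ≈ f_{t_i} ⊗ h_{t_i t_j} + g_{t_i} D_{ij}`, where `D_{ij}` is the sum of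
the `(B_{t_k} - B_{t_i}) ⊗ h_{t_k t_{k+1}}`. The right-hand side is an almost additive function of
`(i, j)`, with a defect of order `(t_j - t_i) ^ (α + 2 γ)` in `L¹`. As `α + 2 γ > 1`, the discrete
sewing lemma `eLpNorm_sum_sub_le_of_almost_additive` bounds the error by the same power of the
length of the block, and the errors of the `ν` blocks of a coarse grid add up to something that
vanishes as `ν → ∞`, uniformly in the fine grid. The terms with `g` are the block sums `ζ_l` with
weights of regularity `γ`; they are small by a second application of the sewing lemma, on the coarse
grid, to the coarse-grained bound on `∑ ζ_l`. What remains is `∑_l f_{u_l} ⊗ h_{u_l u_{l+1}}`, up to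
an error that vanishes as first `n → ∞` and then `ν → ∞` (`exists_eLpNorm_weightedSum_sub_le`,
`WeightBounds.eventually_eLpNorm_weightedSum_sub_le`).

For fixed `ν`, replace `f_{u_l}` by a bounded continuous function of finitely many values of `B`
that is close in `L²` (`exists_process_cylinder_eLpNorm_sub_le`). The sum is now a continuous
function of finitely many values of `(h, B)`, so it converges in distribution, jointly with `B`, to
the same function of `(W, B)` (`TendstoFDD.tendstoInDistribution_sum_tmul`). This limit is the
integral against `W` of a step process, which is uniformly close to `f` in `L²` because `f` is
continuous in `L²` (`IsFBM.exists_eLpNorm_incr_le`). By the Itô isometry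
(`IsBM.eLpNorm_sq_integral_sub_le`) it is close to every version of the Itô integral of `f`, and by
completeness of `L²` such an integral exists (`IsBM.exists_isItoIntegral`). Letting `ν → ∞` is
justified by `tendstoInDistribution_of_approx`.

All estimates need the hypotheses in `L²` only, apart from a bound on `f` in `L³`, by which its `L¹`
continuity becomes `L²` continuity. Integrals of simple processes with overlapping intervals are
handled pairwise: `E⟪X_i ⊗ ΔW_i, X_j ⊗ ΔW_j⟫` is `E⟪X_i, X_j⟫` times the length of the overlap of
the two intervals, up to a constant, which makes common refinements unnecessary.
-/

namespace WeightedSums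

/-! ### Products of random vectors in `L¹` -/

section Holder

variable {Ω : Type*} [MeasurableSpace Ω] {P : Measure Ω}
  {E V V' : Type*} [NormedAddCommGroup E] [InnerProductSpace ℝ E]
  [NormedAddCommGroup V] [InnerProductSpace ℝ V] [NormedAddCommGroup V'] [InnerProductSpace ℝ V']

lemma aestronglyMeasurable_tmul {X : Ω → V} {Y : Ω → V'} (hX : AEStronglyMeasurable X P)
    (hY : AEStronglyMeasurable Y P) : AEStronglyMeasurable (fun ω => X ω ⊗ₜ[ℝ] Y ω) P :=
  TensorProduct.continuous_tmul.comp_aestronglyMeasurable (hX.prodMk hY)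

lemma eLpNorm_one_tmul_le {X : Ω → V} {Y : Ω → V'} (hX : AEStronglyMeasurable X P)
    (hY : AEStronglyMeasurable Y P) :
    eLpNorm (fun ω => X ω ⊗ₜ[ℝ] Y ω) 1 P ≤ eLpNorm X 2 P * eLpNorm Y 2 P := by
  have := eLpNorm_le_eLpNorm_mul_eLpNorm_of_nnnorm (p := 2) (q := 2) (r := 1) hX hY
    (fun x y => x ⊗ₜ[ℝ] y) 1 (ae_of_all _ fun ω => by simp)
  simpa using this

lemma eLpNorm_one_clm_apply_le {L : Ω → E →L[ℝ] V} {X : Ω → E} (hL : AEStronglyMeasurable L P)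
    (hX : AEStronglyMeasurable X P) :
    eLpNorm (fun ω => L ω (X ω)) 1 P ≤ eLpNorm L 2 P * eLpNorm X 2 P := by
  have := eLpNorm_le_eLpNorm_mul_eLpNorm_of_nnnorm (p := 2) (q := 2) (r := 1) hL hX
    (fun x y => x y) 1 (ae_of_all _ fun ω => by simpa using (L ω).le_opNNNorm (X ω))
  simpa using this

lemma exists_nnnorm_bilin_le {E₁ E₂ F : Type*} [NormedAddCommGroup E₁] [NormedSpace ℝ E₁]
    [NormedAddCommGroup E₂] [NormedSpace ℝ E₂] [NormedAddCommGroup F] [NormedSpace ℝ F]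
    [FiniteDimensional ℝ E₁] [FiniteDimensional ℝ E₂] (β : E₁ →ₗ[ℝ] E₂ →ₗ[ℝ] F) :
    ∃ C : ℝ≥0, ∀ x y, ‖β x y‖₊ ≤ C * ‖x‖₊ * ‖y‖₊ :=
  ⟨‖β.toContinuousBilinearMap‖₊, fun x y => β.toContinuousBilinearMap.le_opNorm₂ x y⟩

lemma aestronglyMeasurable_bilin {E₁ E₂ F : Type*} [NormedAddCommGroup E₁] [NormedSpace ℝ E₁]
    [NormedAddCommGroup E₂] [NormedSpace ℝ E₂] [NormedAddCommGroup F] [NormedSpace ℝ F]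
    [FiniteDimensional ℝ E₁] [FiniteDimensional ℝ E₂] (β : E₁ →ₗ[ℝ] E₂ →ₗ[ℝ] F) {X : Ω → E₁}
    {Y : Ω → E₂} (hX : AEStronglyMeasurable X P) (hY : AEStronglyMeasurable Y P) :
    AEStronglyMeasurable (fun ω => β (X ω) (Y ω)) P :=
  β.toContinuousBilinearMap.continuous₂.comp_aestronglyMeasurable (hX.prodMk hY)

variable (E V V') in
/-- The action `(g, z) ↦ (g ⊗ id) z` of operators on the first tensor factor. -/
noncomputable def tensorAct :
    (E →L[ℝ] V) →ₗ[ℝ] (E ⊗[ℝ] V') →ₗ[ℝ] (V ⊗[ℝ] V') :=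
  (LinearMap.rTensorHom V').comp (ContinuousLinearMap.coeLM ℝ)

@[simp] lemma tensorAct_tmul (g : E →L[ℝ] V) (x : E) (y : V') :
    tensorAct E V V' g (x ⊗ₜ[ℝ] y) = g x ⊗ₜ[ℝ] y := rfl

variable [FiniteDimensional ℝ E] [FiniteDimensional ℝ V] [FiniteDimensional ℝ V']

lemma aestronglyMeasurable_tensorAct {g : Ω → E →L[ℝ] V} {Z : Ω → E ⊗[ℝ] V'}
    (hg : AEStronglyMeasurable g P) (hZ : AEStronglyMeasurable Z P) :
    AEStronglyMeasurable (fun ω => tensorAct E V V' (g ω) (Z ω)) P := by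
  exact aestronglyMeasurable_bilin (tensorAct E V V') hg hZ

variable (E V V') in
lemma exists_eLpNorm_one_tensorAct_le : ∃ C : ℝ≥0, ∀ {g : Ω → E →L[ℝ] V} {Z : Ω → E ⊗[ℝ] V'},
    AEStronglyMeasurable g P → AEStronglyMeasurable Z P →
    eLpNorm (fun ω => tensorAct E V V' (g ω) (Z ω)) 1 P ≤ C * (eLpNorm g 2 P * eLpNorm Z 2 P) := by
  obtain ⟨C, hC⟩ := exists_nnnorm_bilin_le (tensorAct E V V')
  refine ⟨C, fun {g Z} hg hZ => ?_⟩
  have := eLpNorm_le_eLpNorm_mul_eLpNorm_of_nnnorm (p := 2) (q := 2) (r := 1) hg hZ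
    (fun x y => tensorAct E V V' x y) C (ae_of_all _ fun ω => hC (g ω) (Z ω))
  simpa [mul_assoc] using this

end Holder

/-! ### Discrete sewing -/

section Sewing

/-- The constant of the discrete sewing lemma with exponent `θ`. -/
noncomputable def sewingConst (θ : ℝ) : ℝ := (1 - (2 / 3 : ℝ) ^ (θ - 1))⁻¹

lemma sewingConst_pos {θ : ℝ} (hθ : 1 < θ) : 0 < sewingConst θ :=
  inv_pos.2 (sub_pos.2 (Real.rpow_lt_one (by norm_num) (by norm_num) (by linarith)))

/-- The inductive step of the discrete sewing lemma: halving an interval of length `a + b` gains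
enough to absorb the error made at the midpoint. -/
lemma sewingConst_mul_add_le {θ : ℝ} (hθ : 1 < θ) {a b : ℝ} (ha : 0 < a) (hab : a ≤ b)
    (hb : b ≤ 2 * a) :
    sewingConst θ * (a ^ θ + b ^ θ) + (a + b) ^ θ ≤ sewingConst θ * (a + b) ^ θ := by
  have hb0 : 0 < b := ha.trans_le hab
  have hs : 0 < a + b := add_pos ha hb0
  set q : ℝ := (2 / 3 : ℝ) ^ (θ - 1) with hq
  have hq1 : 0 < 1 - q := sub_pos.2 (Real.rpow_lt_one (by norm_num) (by norm_num) (by linarith))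
  have key : ∀ x : ℝ, 0 < x → x ≤ 2 / 3 * (a + b) → x ^ θ ≤ x * (q * (a + b) ^ (θ - 1)) := by
    intro x hx hx'
    have h1 : x ^ θ = x * x ^ (θ - 1) := by
      rw [← Real.rpow_one_add' hx.le (by linarith)]; congr 1; ring
    rw [h1, hq, ← Real.mul_rpow (by norm_num) hs.le]
    gcongr
  have hsum : a ^ θ + b ^ θ ≤ q * (a + b) ^ θ := by
    have h1 : (a + b) ^ θ = (a + b) * (a + b) ^ (θ - 1) := by
      rw [← Real.rpow_one_add' hs.le (by linarith)]; congr 1; ring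
    rw [h1]
    linarith [key a ha (by linarith), key b hb0 (by linarith)]
  have hC : sewingConst θ * (1 - q) = 1 := inv_mul_cancel₀ hq1.ne'
  have hCp := sewingConst_pos hθ
  calc sewingConst θ * (a ^ θ + b ^ θ) + (a + b) ^ θ
      ≤ sewingConst θ * (q * (a + b) ^ θ) + (sewingConst θ * (1 - q)) * (a + b) ^ θ := by
        rw [hC, one_mul]; gcongr
    _ = sewingConst θ * (a + b) ^ θ := by ring

/-- **Discrete sewing lemma** in `L¹`: if the two-parameter process `A` is additive up to an error
of order `(k - i) ^ θ` with `θ > 1`, then the sum of `A` over consecutive points differs from `A`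
by an error of the same order, with a constant that does not depend on the number of points. -/
theorem eLpNorm_sum_sub_le_of_almost_additive {Ω E : Type*} [MeasurableSpace Ω] {P : Measure Ω}
    [NormedAddCommGroup E] {θ : ℝ} (hθ : 1 < θ) {L N : ℕ} {A : ℕ → ℕ → Ω → E}
    (hA : ∀ i j, i ≤ j → j ≤ N → AEStronglyMeasurable (A i j) P) {K : ℝ} (hK : 0 ≤ K)
    (h : ∀ i j k, L ≤ i → i < j → j < k → k ≤ N →
      eLpNorm (fun ω => A i k ω - A i j ω - A j k ω) 1 P
        ≤ ENNReal.ofReal (K * ((k : ℝ) - i) ^ θ)) {i j : ℕ} (hi : L ≤ i) (hij : i < j)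
    (hj : j ≤ N) :
    eLpNorm (fun ω => ∑ k ∈ Finset.Ico i j, A k (k + 1) ω - A i j ω) 1 P
      ≤ ENNReal.ofReal (K * (sewingConst θ * ((j : ℝ) - i) ^ θ)) := by
  have hC := sewingConst_pos hθ
  suffices H : ∀ n i, L ≤ i → 1 ≤ n → i + n ≤ N →
      eLpNorm (fun ω => ∑ k ∈ Finset.Ico i (i + n), A k (k + 1) ω - A i (i + n) ω) 1 P
        ≤ ENNReal.ofReal (K * (sewingConst θ * (n : ℝ) ^ θ)) by
    have := H (j - i) i hi (by omega) (by omega)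
    rw [Nat.add_sub_cancel' hij.le, Nat.cast_sub hij.le] at this
    exact this
  intro n
  induction n using Nat.strong_induction_on with
  | _ n ih =>
    intro i hi hn hN
    rcases Nat.lt_or_ge 1 n with hn1 | hn1
    swap
    · obtain rfl : n = 1 := by omega
      simp
    obtain ⟨a, b, rfl, hab, hba, ha⟩ : ∃ a b, n = a + b ∧ a ≤ b ∧ b ≤ 2 * a ∧ 1 ≤ a :=
      ⟨n / 2, n - n / 2, by omega, by omega, by omega, by omega⟩
    have h1 := ih a (by omega) i hi ha (by omega)
    have h2 := ih b (by omega) (i + a) (by omega) (by omega) (by omega)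
    have h3 := h i (i + a) (i + a + b) hi (by omega) (by omega) (by omega)
    have hmS : ∀ i j, j ≤ N →
        AEStronglyMeasurable (fun ω => ∑ k ∈ Finset.Ico i j, A k (k + 1) ω) P := fun i j hj =>
      Finset.aestronglyMeasurable_fun_sum _ fun k hk =>
        hA _ _ (by omega) (by have := Finset.mem_Ico.1 hk; omega)
    have hsplit : (fun ω => ∑ k ∈ Finset.Ico i (i + (a + b)), A k (k + 1) ω - A i (i + (a + b)) ω)
        = (fun ω => ∑ k ∈ Finset.Ico i (i + a), A k (k + 1) ω - A i (i + a) ω)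
          + (fun ω => ∑ k ∈ Finset.Ico (i + a) (i + a + b), A k (k + 1) ω
              - A (i + a) (i + a + b) ω)
          - (fun ω => A i (i + a + b) ω - A i (i + a) ω - A (i + a) (i + a + b) ω) := by
      ext ω
      simp only [Pi.add_apply, Pi.sub_apply, ← add_assoc]
      rw [← Finset.sum_Ico_consecutive _ (show i ≤ i + a by omega) (show i + a ≤ i + a + b by omega)]
      abel
    rw [hsplit]
    have m1 := (hmS i (i + a) (by omega)).sub (hA i (i + a) (by omega) (by omega))
    have m2 := (hmS (i + a) (i + a + b) (by omega)).sub
      (hA (i + a) (i + a + b) (by omega) (by omega))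
    have m3 := ((hA i (i + a + b) (by omega) (by omega)).sub
      (hA i (i + a) (by omega) (by omega))).sub (hA (i + a) (i + a + b) (by omega) (by omega))
    refine (eLpNorm_sub_le (m1.add m2) m3 le_rfl).trans ?_
    refine (add_le_add (eLpNorm_add_le m1 m2 le_rfl) le_rfl).trans ?_
    refine (add_le_add (add_le_add h1 h2) h3).trans ?_
    have ha0 : (0 : ℝ) < a := by exact_mod_cast ha
    have key := sewingConst_mul_add_le hθ ha0 (b := b) (by exact_mod_cast hab)
      (by exact_mod_cast hba)
    have hcast : ((i + a + b : ℕ) : ℝ) - (i : ℝ) = a + b := by push_cast; ring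
    rw [hcast, ← ENNReal.ofReal_add (by positivity) (by positivity),
      ← ENNReal.ofReal_add (by positivity) (by positivity)]
    refine ENNReal.ofReal_le_ofReal ?_
    push_cast
    calc _ = K * (sewingConst θ * ((a : ℝ) ^ θ + (b : ℝ) ^ θ) + ((a : ℝ) + b) ^ θ) := by ring
      _ ≤ _ := by gcongr

end Sewing

/-! ### Independent increments and the past of a process -/

section IndependentIncrements

/-- If a process with independent increments starts from `0`, then its increments after time `a`
are independent of its whole past up to time `a`. -/
lemma indepFun_past_increment {S Ω E : Type*} [LinearOrder S] [MeasurableSpace Ω]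
    {P : Measure Ω} [IsProbabilityMeasure P] [AddCommGroup E] [MeasurableSpace E]
    [MeasurableAdd₂ E] [MeasurableSub₂ E] {X : S → Ω → E} (hX : ∀ s, Measurable (X s))
    (h : HasIndepIncrements X P) {o : S} (ho : ∀ s, o ≤ s) (h0 : ∀ᵐ ω ∂P, X o ω = 0) {a b : S}
    (hab : a ≤ b) :
    IndepFun (fun ω (s : Iic a) => X s ω) (fun ω => X b ω - X a ω) P := by
  refine IndepFun.process_indepFun (fun s => hX s) ((hX b).sub (hX a)) fun I => ?_
  -- the times `o`, then the elements of `I` in increasing order, then `a`, then `b` for ever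
  set k := I.card with hk
  let e := I.orderEmbOfFin hk.symm
  let τ : ℕ → S := fun j =>
    if j = 0 then o else if h : j - 1 < k then (e ⟨j - 1, h⟩ : Iic a) else
      if j = k + 1 then a else b
  have τ0 : τ 0 = o := rfl
  have τ1 : ∀ j (hj : j < k), τ (j + 1) = (e ⟨j, hj⟩ : Iic a) := fun j hj => by simp [τ, hj]
  have τ2 : τ (k + 1) = a := by simp [τ]
  have τ3 : ∀ j, k < j → τ (j + 1) = b := fun j hj => by
    simp [τ, show ¬ j < k by omega, show j ≠ k by omega]
  have hτ : Monotone τ := by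
    refine monotone_nat_of_le_succ fun j => ?_
    rcases j with _ | j
    · rw [τ0]; exact ho _
    · rcases lt_trichotomy (j + 1) k with hj | hj | hj
      · rw [τ1 j (by omega), τ1 (j + 1) hj]
        exact e.monotone (by simp)
      · rw [τ1 j (by omega), hj, τ2]
        exact (e ⟨j, by omega⟩).2
      · rw [τ3 (j + 1) hj]
        obtain rfl | hj' : j = k ∨ k < j := by omega
        · rw [τ2]; exact hab
        · rw [τ3 j hj']
  have hind := h.nat hτ
  have hm : ∀ i, Measurable fun ω => X (τ (i + 1)) ω - X (τ i) ω := fun i => (hX _).sub (hX _)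
  have hsplit := hind.indepFun_finset (Finset.range (k + 1)) {k + 1} (by simp) hm
  let r : Iic a → ℕ := fun s => if h : s ∈ I then ((I.orderIsoOfFin hk.symm).symm ⟨s, h⟩ : ℕ) else 0
  have hr : ∀ s : I, r s < k ∧ τ (r s + 1) = s := by
    intro s
    have hrs : r s = ((I.orderIsoOfFin hk.symm).symm s : ℕ) := by simp [r]
    have hlt : r s < k := hrs ▸ Fin.is_lt _
    refine ⟨hlt, ?_⟩
    rw [τ1 _ hlt]
    have : (⟨r s, hlt⟩ : Fin k) = (I.orderIsoOfFin hk.symm).symm s := Fin.ext hrs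
    rw [this]
    simp [e, Finset.orderEmbOfFin]
  let φ : (Finset.range (k + 1) → E) → I → E := fun x s =>
    ∑ j ∈ (Finset.range (r s + 1)).attach,
      x ⟨j, by have := (hr s).1; have := Finset.mem_range.1 j.2; simp; omega⟩
  let ψ : (({k + 1} : Finset ℕ) → E) → E := fun x => x ⟨k + 1, by simp⟩
  have hφ : Measurable φ := measurable_pi_lambda _ fun s =>
    Finset.measurable_sum _ fun j _ => measurable_pi_apply _
  have hcomp := hsplit.comp hφ (show Measurable ψ from measurable_pi_apply _)
  refine hcomp.congr ?_ ?_
  · filter_upwards [h0] with ω hω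
    ext s
    simp only [Function.comp, φ]
    rw [Finset.sum_attach (Finset.range (r s + 1)) (fun j => X (τ (j + 1)) ω - X (τ j) ω),
      Finset.sum_range_sub (fun j => X (τ j) ω), (hr s).2]
    simp [τ, hω]
  · refine ae_of_all _ fun ω => ?_
    simp [τ, ψ]

/-- If `m₁` is independent of `m₂` and both together live on one side of an independence relation
with `m₃ ≥ m₂`, then splitting off the part `m₄` of `m₃` independent of `m₂` keeps `m₁ ⊔ m₂`
independent of `m₄`. -/
lemma indep_sup_of_indep_of_indep {Ω : Type*} {m₁ m₂ m₃ m₄ : MeasurableSpace Ω}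
    [mΩ : MeasurableSpace Ω] {P : Measure Ω} [IsProbabilityMeasure P] (hm₁ : m₁ ≤ mΩ)
    (hm₃ : m₃ ≤ mΩ) (h₂₃ : m₂ ≤ m₃) (h₄₃ : m₄ ≤ m₃) (h₁₃ : Indep m₁ m₃ P) (h₂₄ : Indep m₂ m₄ P) :
    Indep (m₁ ⊔ m₂) m₄ P := by
  refine IndepSets.indep (p1 := {s | ∃ u v, MeasurableSet[m₁] u ∧ MeasurableSet[m₂] v ∧ u ∩ v = s})
    (p2 := {s | MeasurableSet[m₄] s}) (sup_le hm₁ (h₂₃.trans hm₃)) (h₄₃.trans hm₃) ?_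
    (@MeasurableSpace.isPiSystem_measurableSet _ m₄) ?_
    (@MeasurableSpace.generateFrom_measurableSet _ m₄).symm ?_
  · rintro _ ⟨u, v, hu, hv, rfl⟩ _ ⟨u', v', hu', hv', rfl⟩ -
    exact ⟨u ∩ u', v ∩ v', hu.inter hu', hv.inter hv', by ac_rfl⟩
  · refine le_antisymm (sup_le (fun u hu => ?_) fun v hv => ?_)
      (MeasurableSpace.generateFrom_le ?_)
    · exact MeasurableSpace.measurableSet_generateFrom ⟨u, univ, hu, MeasurableSet.univ, by simp⟩
    · exact MeasurableSpace.measurableSet_generateFrom ⟨univ, v, MeasurableSet.univ, hv, by simp⟩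
    · rintro _ ⟨u, v, hu, hv, rfl⟩
      exact MeasurableSet.inter ((le_sup_left : m₁ ≤ m₁ ⊔ m₂) _ hu)
        ((le_sup_right : m₂ ≤ m₁ ⊔ m₂) _ hv)
  · rw [IndepSets_iff]
    rintro _ w ⟨u, v, hu, hv, rfl⟩ hw
    rw [Indep_iff] at h₁₃ h₂₄
    rw [inter_assoc, h₁₃ u (v ∩ w) hu (MeasurableSet.inter (h₂₃ _ hv) (h₄₃ _ hw)),
      h₁₃ u v hu (h₂₃ _ hv), h₂₄ v w hv hw, mul_assoc]

end IndependentIncrements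

section Past

variable {Ω E : Type*} [mE : MeasurableSpace E] {X : ℝ → Ω → E}

lemma pastSigma_mono {s t : ℝ} (hst : s ≤ t) : pastSigma X s ≤ pastSigma X t :=
  biSup_mono fun _ hu => ⟨hu.1, hu.2.trans hst⟩

lemma comap_le_pastSigma {s t : ℝ} (hs : 0 ≤ s) (hst : s ≤ t) :
    mE.comap (X s) ≤ pastSigma X t :=
  le_biSup (fun s => mE.comap (X s)) (show s ∈ Icc 0 t from ⟨hs, hst⟩)

lemma pastSigma_le [mΩ : MeasurableSpace Ω] {T t : ℝ}
    (hX : ∀ s ∈ Icc (0 : ℝ) T, Measurable (X s)) (ht : t ≤ T) : pastSigma X t ≤ mΩ :=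
  iSup₂_le fun s hs => (hX s ⟨hs.1, hs.2.trans ht⟩).comap_le

lemma pastSigma_eq_comap (t : ℝ) :
    pastSigma X t = MeasurableSpace.pi.comap fun ω (s : Icc (0 : ℝ) t) => X s ω := by
  simp only [MeasurableSpace.pi, MeasurableSpace.comap_iSup, MeasurableSpace.comap_comp, pastSigma,
    iSup_subtype]
  rfl

lemma measurable_pastSigma {s t : ℝ} (hs : 0 ≤ s) (hst : s ≤ t) :
    Measurable[pastSigma X t] (X s) :=
  Measurable.of_comap_le (comap_le_pastSigma hs hst)

end Past

/-! ### Increments of Brownian motion -/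

lemma eLpNorm_two_sq_eq_ofReal {Ω E : Type*} [MeasurableSpace Ω] {P : Measure Ω}
    [NormedAddCommGroup E] {X : Ω → E} (hX : MemLp X 2 P) :
    (eLpNorm X 2 P) ^ 2 = ENNReal.ofReal (∫ ω, ‖X ω‖ ^ 2 ∂P) := by
  rw [hX.eLpNorm_eq_integral_rpow_norm two_ne_zero ENNReal.ofNat_ne_top,
    ← ENNReal.ofReal_pow (by positivity)]
  simp only [ENNReal.toReal_ofNat, Real.rpow_ofNat]
  rw [show (2 : ℝ)⁻¹ = 1 / 2 by norm_num, ← Real.sqrt_eq_rpow, Real.sq_sqrt (by positivity)]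

lemma integrable_inner_of_memLp {Ω E : Type*} [MeasurableSpace Ω] {P : Measure Ω}
    [NormedAddCommGroup E] [InnerProductSpace ℝ E] {X Y : Ω → E} (hX : MemLp X 2 P)
    (hY : MemLp Y 2 P) : Integrable (fun ω => ⟪X ω, Y ω⟫) P :=
  (hX.norm.integrable_mul hY.norm).mono' (hX.1.inner hY.1)
    (ae_of_all _ fun _ => norm_inner_le_norm _ _)

section Brownian

variable {Ω V' : Type*} {𝓑 : MeasurableSpace Ω} [mΩ : MeasurableSpace Ω] {P : Measure Ω}
  [IsProbabilityMeasure P] [NormedAddCommGroup V'] [InnerProductSpace ℝ V'] [FiniteDimensional ℝ V']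
  [MeasurableSpace V'] [BorelSpace V'] {T : ℝ} {W : ℝ → Ω → V'}

omit [IsProbabilityMeasure P] in
lemma IsBM.measurable_increment (hW : IsBM T W P) {a b : ℝ} (ha : a ∈ Icc 0 T)
    (hb : b ∈ Icc 0 T) : Measurable fun ω => W b ω - W a ω :=
  (hW.measurable b hb).sub (hW.measurable a ha)

/-- Enlarging the filtration of a Brownian motion by an independent `σ`-algebra keeps the
future increments independent of the past. -/
lemma IsBM.indep_increment (hW : IsBM T W P) (h𝓑 : 𝓑 ≤ mΩ) (hind : Indep (pastSigma W T) 𝓑 P)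
    {a b : ℝ} (ha : 0 ≤ a) (hab : a ≤ b) (hb : b ≤ T) :
    Indep (𝓑 ⊔ pastSigma W a) (MeasurableSpace.comap (fun ω => W b ω - W a ω) inferInstance) P := by
  have hle : MeasurableSpace.comap (fun ω => W b ω - W a ω) inferInstance ≤ pastSigma W T :=
    Measurable.comap_le ((measurable_pastSigma (ha.trans hab) hb).sub
      (measurable_pastSigma ha (hab.trans hb)))
  refine indep_sup_of_indep_of_indep h𝓑 (pastSigma_le hW.measurable le_rfl)
    (pastSigma_mono (hab.trans hb)) hle hind.symm ?_
  have h0 : ∀ᵐ ω ∂P, W ((⟨0, le_rfl, ha.trans (hab.trans hb)⟩ : Icc (0 : ℝ) T) : ℝ) ω = 0 := hW.zero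
  have key := indepFun_past_increment (P := P) (X := fun t : Icc (0 : ℝ) T => W t)
    (fun s => hW.measurable s s.2) hW.indep_incr (fun s => s.2.1) h0
    (a := ⟨a, ha, hab.trans hb⟩) (b := ⟨b, ha.trans hab, hb⟩) hab
  rw [IndepFun_iff_Indep] at key
  refine indep_of_indep_of_le_left key ?_
  refine iSup₂_le fun s hs => ?_
  have : W s = (fun x : (Iic (⟨a, ha, hab.trans hb⟩ : Icc (0 : ℝ) T)) → V' =>
      x ⟨⟨s, hs.1, hs.2.trans (hab.trans hb)⟩, hs.2⟩) ∘ fun ω s => W s ω := rfl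
  rw [this, ← MeasurableSpace.comap_comp]
  exact MeasurableSpace.comap_mono (measurable_pi_apply _).comap_le

omit [IsProbabilityMeasure P] in
lemma IsBM.memLp_inner_increment (hW : IsBM T W P) {a b : ℝ} (ha : 0 ≤ a) (hab : a ≤ b)
    (hb : b ≤ T) (v : V') : MemLp (fun ω => ⟪v, W b ω - W a ω⟫) 2 P := by
  obtain ⟨Q, hQ, hlaw⟩ := hW.gaussian_incr
  have hm : Measurable fun ω => ⟪v, W b ω - W a ω⟫ :=
    (hW.measurable_increment ⟨ha, hab.trans hb⟩ ⟨ha.trans hab, hb⟩).const_inner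
  have h2 : MemLp id 2 (P.map fun ω => ⟪v, W b ω - W a ω⟫) := by
    rw [hlaw a b ha hab hb v]; exact memLp_id_gaussianReal 2
  exact (memLp_map_measure_iff aestronglyMeasurable_id hm.aemeasurable).1 h2

omit [IsProbabilityMeasure P] in
lemma IsBM.memLp_increment (hW : IsBM T W P) {a b : ℝ} (ha : 0 ≤ a) (hab : a ≤ b) (hb : b ≤ T) :
    MemLp (fun ω => W b ω - W a ω) 2 P := by
  let e := stdOrthonormalBasis ℝ V'
  have : (fun ω => W b ω - W a ω) = fun ω => ∑ i, ⟪e i, W b ω - W a ω⟫ • e i := by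
    ext ω; exact (e.sum_repr' _).symm
  rw [this]
  exact memLp_finsetSum _ fun i _ => 
    (ContinuousLinearMap.toSpanSingleton ℝ (e i)).comp_memLp' (hW.memLp_inner_increment ha hab hb (e i))

lemma IsBM.integral_increment (hW : IsBM T W P) {a b : ℝ} (ha : 0 ≤ a) (hab : a ≤ b)
    (hb : b ≤ T) : ∫ ω, (W b ω - W a ω) ∂P = 0 := by
  obtain ⟨Q, hQ, hlaw⟩ := hW.gaussian_incr
  have hint := (hW.memLp_increment ha hab hb).integrable (by norm_num)
  refine ext_inner_left ℝ fun v => ?_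
  have hm : Measurable fun ω => ⟪v, W b ω - W a ω⟫ :=
    (hW.measurable_increment ⟨ha, hab.trans hb⟩ ⟨ha.trans hab, hb⟩).const_inner
  rw [inner_zero_right, ← integral_inner hint v]
  have : ∫ x, x ∂(P.map fun ω => ⟪v, W b ω - W a ω⟫) = 0 := by
    rw [hlaw a b ha hab hb v]; exact integral_id_gaussianReal
  rwa [integral_map hm.aemeasurable (by fun_prop)] at this

omit [IsProbabilityMeasure P] in
/-- The second moment of the increments of a Brownian motion is proportional to the elapsed time
(the constant is the trace of the covariance operator). -/
lemma IsBM.exists_integral_norm_sq (hW : IsBM T W P) :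
    ∃ c : ℝ, 0 ≤ c ∧ ∀ a b : ℝ, 0 ≤ a → a ≤ b → b ≤ T →
      ∫ ω, ‖W b ω - W a ω‖ ^ 2 ∂P = c * (b - a) := by
  obtain ⟨Q, hQ, hlaw⟩ := hW.gaussian_incr
  let e := stdOrthonormalBasis ℝ V'
  have hQ0 : ∀ v, 0 ≤ ⟪Q v, v⟫ := fun v => by simpa using hQ.re_inner_nonneg_left v
  refine ⟨∑ i, ⟪Q (e i), e i⟫, Finset.sum_nonneg fun i _ => hQ0 _, fun a b ha hab hb => ?_⟩
  have h1 : ∀ i, ∫ ω, ⟪e i, W b ω - W a ω⟫ ^ 2 ∂P = (b - a) * ⟪Q (e i), e i⟫ := by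
    intro i
    have hm : Measurable fun ω => ⟪e i, W b ω - W a ω⟫ :=
      (hW.measurable_increment ⟨ha, hab.trans hb⟩ ⟨ha.trans hab, hb⟩).const_inner
    have h2 : ∫ x, x ^ 2 ∂(P.map fun ω => ⟪e i, W b ω - W a ω⟫) = (b - a) * ⟪Q (e i), e i⟫ := by
      rw [hlaw a b ha hab hb (e i)]
      have := variance_of_integral_eq_zero (X := id)
        (μ := gaussianReal 0 (Real.toNNReal ((b - a) * ⟪Q (e i), e i⟫))) aemeasurable_id
        (by simp)
      rw [variance_id_gaussianReal] at this
      simpa [Real.coe_toNNReal _ (mul_nonneg (sub_nonneg.2 hab) (hQ0 (e i)))] using this.symm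
    rwa [integral_map hm.aemeasurable (by fun_prop)] at h2
  have h3 : ∀ ω, ‖W b ω - W a ω‖ ^ 2 = ∑ i, ⟪e i, W b ω - W a ω⟫ ^ 2 := fun ω => by
    rw [← e.sum_sq_norm_inner_right]; simp
  simp_rw [h3]
  rw [integral_finsetSum _ fun i _ => (hW.memLp_inner_increment ha hab hb (e i)).integrable_sq,
    Finset.sum_congr rfl fun i _ => h1 i, ← Finset.mul_sum, mul_comm]

/-- Orthogonality of the past and the increments of a Brownian motion. -/
lemma IsBM.integral_inner_increment_eq_zero (hW : IsBM T W P) (h𝓑 : 𝓑 ≤ mΩ)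
    (hind : Indep (pastSigma W T) 𝓑 P) {a b : ℝ} (ha : 0 ≤ a) (hab : a ≤ b) (hb : b ≤ T)
    {Y : Ω → V'} (hY : Measurable[𝓑 ⊔ pastSigma W a] Y) (hYi : Integrable Y P) :
    ∫ ω, ⟪Y ω, W b ω - W a ω⟫ ∂P = 0 := by
  have hI : IndepFun Y (fun ω => W b ω - W a ω) P :=
    indep_of_indep_of_le_left (hW.indep_increment h𝓑 hind ha hab hb) hY.comap_le
  have := hI.integral_bilin hYi ((hW.memLp_increment ha hab hb).integrable (by norm_num))
    (innerSL ℝ)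
  rw [hW.integral_increment ha hab hb, map_zero] at this
  exact this

lemma IsBM.integral_mul_norm_sq (hW : IsBM T W P) (h𝓑 : 𝓑 ≤ mΩ)
    (hind : Indep (pastSigma W T) 𝓑 P) {a b : ℝ} (ha : 0 ≤ a) (hab : a ≤ b) (hb : b ≤ T)
    {Z : Ω → ℝ} (hZ : Measurable[𝓑 ⊔ pastSigma W a] Z) :
    ∫ ω, Z ω * ‖W b ω - W a ω‖ ^ 2 ∂P = (∫ ω, Z ω ∂P) * ∫ ω, ‖W b ω - W a ω‖ ^ 2 ∂P := by
  have hm := hW.measurable_increment ⟨ha, hab.trans hb⟩ ⟨ha.trans hab, hb⟩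
  have hI : IndepFun Z (fun ω => W b ω - W a ω) P :=
    indep_of_indep_of_le_left (hW.indep_increment h𝓑 hind ha hab hb) hZ.comap_le
  have hI2 : IndepFun Z (fun ω => ‖W b ω - W a ω‖ ^ 2) P :=
    hI.comp (φ := id) (ψ := fun x => ‖x‖ ^ 2) measurable_id (by fun_prop)
  have hle : 𝓑 ⊔ pastSigma W a ≤ mΩ := sup_le h𝓑 (pastSigma_le hW.measurable (hab.trans hb))
  exact hI2.integral_fun_mul_eq_mul_integral (hZ.mono hle le_rfl).aestronglyMeasurable
    (hm.norm.pow_const 2).aestronglyMeasurable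

/-- Given a random variable known at time `r`, the increments of a Brownian motion after time `r`
have the covariance structure of Brownian motion. -/
lemma IsBM.integral_mul_inner_increment (hW : IsBM T W P) (h𝓑 : 𝓑 ≤ mΩ)
    (hind : Indep (pastSigma W T) 𝓑 P) {c : ℝ}
    (hc : ∀ a b : ℝ, 0 ≤ a → a ≤ b → b ≤ T → ∫ ω, ‖W b ω - W a ω‖ ^ 2 ∂P = c * (b - a))
    {r u v : ℝ} (hr : 0 ≤ r) (hru : r ≤ u) (huT : u ≤ T) (hrv : r ≤ v) (hvT : v ≤ T)
    {Z : Ω → ℝ} (hZ : Measurable[𝓑 ⊔ pastSigma W r] Z) {C : ℝ} (hZC : ∀ ω, ‖Z ω‖ ≤ C) :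
    ∫ ω, Z ω * ⟪W u ω - W r ω, W v ω - W r ω⟫ ∂P = c * (∫ ω, Z ω ∂P) * (min u v - r) := by
  have hle : 𝓑 ⊔ pastSigma W r ≤ mΩ := sup_le h𝓑 (pastSigma_le hW.measurable (hru.trans huT))
  have hZm : AEStronglyMeasurable Z P := (hZ.mono hle le_rfl).aestronglyMeasurable
  have hsq : ∀ {a b : ℝ}, r ≤ a → a ≤ b → b ≤ T →
      Integrable (fun ω => Z ω * ‖W b ω - W a ω‖ ^ 2) P ∧
      ∫ ω, Z ω * ‖W b ω - W a ω‖ ^ 2 ∂P = (∫ ω, Z ω ∂P) * (c * (b - a)) := by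
    intro a b ha hab hb
    refine ⟨((hW.memLp_increment (hr.trans ha) hab hb).integrable_norm_pow
      two_ne_zero).bdd_mul hZm (ae_of_all _ hZC), ?_⟩
    rw [hW.integral_mul_norm_sq h𝓑 hind (hr.trans ha) hab hb
      (hZ.mono (sup_le_sup_left (pastSigma_mono ha) _) le_rfl), hc a b (hr.trans ha) hab hb]
  wlog huv : u ≤ v generalizing u v
  · have := this hrv hvT hru huT (le_of_not_ge huv)
    simp_rw [real_inner_comm (W u _ - W r _)] at this ⊢
    rw [this, min_comm]
  have hpol : ∀ ω, Z ω * ⟪W u ω - W r ω, W v ω - W r ω⟫ =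
      (Z ω * ‖W u ω - W r ω‖ ^ 2 + Z ω * ‖W v ω - W r ω‖ ^ 2 - Z ω * ‖W v ω - W u ω‖ ^ 2) / 2 := by
    intro ω
    have h1 : W v ω - W u ω = (W v ω - W r ω) - (W u ω - W r ω) := by abel
    have h2 := norm_sub_sq_real (W v ω - W r ω) (W u ω - W r ω)
    rw [← h1, real_inner_comm] at h2
    rw [h2]; ring
  obtain ⟨i1, e1⟩ := hsq le_rfl hru huT
  obtain ⟨i2, e2⟩ := hsq le_rfl hrv hvT
  obtain ⟨i3, e3⟩ := hsq hru huv hvT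
  simp_rw [hpol]
  rw [integral_div, integral_sub (by exact i1.add i2) i3, integral_add i1 i2, e1, e2, e3, min_eq_left huv]
  ring

/-- Covariance of two increments of a Brownian motion, weighted by a random variable known at the
later of the two starting times: only the overlap of the two time intervals contributes. -/
lemma IsBM.integral_mul_inner_overlap (hW : IsBM T W P) (h𝓑 : 𝓑 ≤ mΩ)
    (hind : Indep (pastSigma W T) 𝓑 P) {c : ℝ}
    (hc : ∀ a b : ℝ, 0 ≤ a → a ≤ b → b ≤ T → ∫ ω, ‖W b ω - W a ω‖ ^ 2 ∂P = c * (b - a))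
    {a b a' b' : ℝ} (ha : 0 ≤ a) (hab : a ≤ b) (hb : b ≤ T) (ha' : 0 ≤ a') (hab' : a' ≤ b')
    (hb' : b' ≤ T) {Z : Ω → ℝ} (hZ : Measurable[𝓑 ⊔ pastSigma W (max a a')] Z) {C : ℝ}
    (hZC : ∀ ω, ‖Z ω‖ ≤ C) :
    ∫ ω, Z ω * ⟪W b ω - W a ω, W b' ω - W a' ω⟫ ∂P
      = c * (∫ ω, Z ω ∂P) * max 0 (min b b' - max a a') := by
  wlog haa : a ≤ a' generalizing a b a' b'
  · have := this ha' hab' hb' ha hab hb (by rwa [max_comm]) (le_of_not_ge haa)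
    simp_rw [real_inner_comm (W b _ - W a _)] at this
    rw [this, min_comm, max_comm a]
  rw [max_eq_right haa] at hZ ⊢
  have hle : 𝓑 ⊔ pastSigma W a' ≤ mΩ := sup_le h𝓑 (pastSigma_le hW.measurable (hab'.trans hb'))
  have hZm : AEStronglyMeasurable Z P := (hZ.mono hle le_rfl).aestronglyMeasurable
  -- increments over intervals that end before `a'` are orthogonal to those that start at `a'`
  have hpast : ∀ d, a ≤ d → d ≤ a' →
      ∫ ω, Z ω * ⟪W d ω - W a ω, W b' ω - W a' ω⟫ ∂P = 0 := by
    intro d had hda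
    have hY : Measurable[𝓑 ⊔ pastSigma W a'] fun ω => Z ω • (W d ω - W a ω) := by
      refine hZ.smul (Measurable.sub ?_ ?_)
      · exact (measurable_pastSigma (ha.trans had) hda).mono le_sup_right le_rfl
      · exact (measurable_pastSigma ha haa).mono le_sup_right le_rfl
    have hYi : Integrable (fun ω => Z ω • (W d ω - W a ω)) P :=
      ((hW.memLp_increment ha had (hda.trans (hab'.trans hb'))).integrable
        (by norm_num)).bdd_smul _ hZm (ae_of_all _ hZC)
    have := hW.integral_inner_increment_eq_zero h𝓑 hind ha' hab' hb' hY hYi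
    simpa [real_inner_smul_left] using this
  rcases le_total b a' with hba | hba
  · rw [hpast b hab hba, max_eq_left (by linarith [min_le_left b b'])]
    simp
  · have hint : ∀ {d e : ℝ}, 0 ≤ d → d ≤ e → e ≤ T →
        Integrable (fun ω => Z ω * ⟪W e ω - W d ω, W b' ω - W a' ω⟫) P := by
      intro d e hd hde he
      exact (integrable_inner_of_memLp (hW.memLp_increment hd hde he)
        (hW.memLp_increment ha' hab' hb')).bdd_mul hZm (ae_of_all _ hZC)
    have hsplit : ∀ ω, Z ω * ⟪W b ω - W a ω, W b' ω - W a' ω⟫ =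
        Z ω * ⟪W a' ω - W a ω, W b' ω - W a' ω⟫ + Z ω * ⟪W b ω - W a' ω, W b' ω - W a' ω⟫ := by
      intro ω
      rw [← mul_add, ← inner_add_left]
      congr 2; abel
    simp_rw [hsplit]
    rw [integral_add (hint ha haa (hab'.trans hb')) (hint ha' hba hb), hpast a' haa le_rfl,
      hW.integral_mul_inner_increment h𝓑 hind hc ha' hba hb hab' hb' hZ hZC,
      max_eq_right (sub_nonneg.2 (le_min hba hab')), zero_add]

end Brownian

/-! ### The Itô isometry -/

section Isometry

variable {Ω V V' : Type*} {𝓑 : MeasurableSpace Ω} [mΩ : MeasurableSpace Ω] {P : Measure Ω}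
  [IsProbabilityMeasure P] [NormedAddCommGroup V] [InnerProductSpace ℝ V]
  [NormedAddCommGroup V'] [InnerProductSpace ℝ V'] [FiniteDimensional ℝ V']
  [MeasurableSpace V'] [BorelSpace V'] {T : ℝ} {W : ℝ → Ω → V'} {ι : Type*} [Fintype ι]

lemma norm_sum_sq_eq {E : Type*} [NormedAddCommGroup E] [InnerProductSpace ℝ E] (y : ι → E) :
    ‖∑ i, y i‖ ^ 2 = ∑ i, ∑ j, ⟪y i, y j⟫ := by
  rw [← real_inner_self_eq_norm_sq, sum_inner]
  exact Finset.sum_congr rfl fun i _ => inner_sum _ _ _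

/-- Second moment of `∑ i, X i ⊗ (W_{b i} - W_{a i})` when each `X i` is bounded and known at time
`a i`. The intervals `(a i, b i]` may overlap. -/
lemma IsBM.integral_norm_sq_sum_tmul (hW : IsBM T W P) (h𝓑 : 𝓑 ≤ mΩ)
    (hind : Indep (pastSigma W T) 𝓑 P) {c : ℝ}
    (hc : ∀ a b : ℝ, 0 ≤ a → a ≤ b → b ≤ T → ∫ ω, ‖W b ω - W a ω‖ ^ 2 ∂P = c * (b - a))
    {a b : ι → ℝ} (ha : ∀ i, 0 ≤ a i) (hab : ∀ i, a i ≤ b i) (hb : ∀ i, b i ≤ T)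
    {X : ι → Ω → V} (hX : ∀ i, StronglyMeasurable[𝓑 ⊔ pastSigma W (a i)] (X i)) {C : ι → ℝ}
    (hXC : ∀ i ω, ‖X i ω‖ ≤ C i) :
    ∫ ω, ‖∑ i, X i ω ⊗ₜ[ℝ] (W (b i) ω - W (a i) ω)‖ ^ 2 ∂P
      = c * ∑ i, ∑ j, (∫ ω, ⟪X i ω, X j ω⟫ ∂P) * max 0 (min (b i) (b j) - max (a i) (a j)) := by
  have hle : ∀ i, 𝓑 ⊔ pastSigma W (a i) ≤ mΩ := fun i =>
    sup_le h𝓑 (pastSigma_le hW.measurable ((hab i).trans (hb i)))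
  have hZ : ∀ i j, Measurable[𝓑 ⊔ pastSigma W (max (a i) (a j))] fun ω => ⟪X i ω, X j ω⟫ := by
    intro i j
    exact (StronglyMeasurable.inner
      ((hX i).mono (sup_le_sup_left (pastSigma_mono (le_max_left _ _)) _))
      ((hX j).mono (sup_le_sup_left (pastSigma_mono (le_max_right _ _)) _))).measurable
  have hZC : ∀ i j ω, ‖⟪X i ω, X j ω⟫‖ ≤ C i * C j := fun i j ω =>
    (norm_inner_le_norm _ _).trans (mul_le_mul (hXC i ω) (hXC j ω) (norm_nonneg _)
      ((norm_nonneg _).trans (hXC i ω)))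
  have hint : ∀ i j, Integrable (fun ω => ⟪X i ω, X j ω⟫ *
      ⟪W (b i) ω - W (a i) ω, W (b j) ω - W (a j) ω⟫) P := fun i j =>
    (integrable_inner_of_memLp (hW.memLp_increment (ha i) (hab i) (hb i))
      (hW.memLp_increment (ha j) (hab j) (hb j))).bdd_mul
      (((hX i).mono (hle i)).aestronglyMeasurable.inner ((hX j).mono (hle j)).aestronglyMeasurable)
      (ae_of_all _ (hZC i j))
  simp_rw [norm_sum_sq_eq, TensorProduct.inner_tmul]
  rw [integral_finsetSum _ fun i _ => integrable_finsetSum _ fun j _ => hint i j, Finset.mul_sum]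
  refine Finset.sum_congr rfl fun i _ => ?_
  rw [integral_finsetSum _ fun j _ => hint i j, Finset.mul_sum]
  refine Finset.sum_congr rfl fun j _ => ?_
  rw [hW.integral_mul_inner_overlap h𝓑 hind hc (ha i) (hab i) (hb i) (ha j) (hab j) (hb j)
    (hZ i j) (hZC i j), mul_assoc]

omit [FiniteDimensional ℝ V'] [BorelSpace V'] [IsProbabilityMeasure P] [MeasurableSpace V']
  [NormedAddCommGroup V'] [InnerProductSpace ℝ V'] in
/-- The time integral of the second moment of a step process. -/
lemma lintegral_eLpNorm_sq_sum_indicator {a b : ι → ℝ} (ha : ∀ i, 0 ≤ a i) (hb : ∀ i, b i ≤ T)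
    {X : ι → Ω → V} (hX : ∀ i, MemLp (X i) 2 P) :
    ∫⁻ s in Icc 0 T, (eLpNorm (fun ω => ∑ i, (Ioc (a i) (b i)).indicator (fun _ => X i ω) s) 2 P) ^ 2
      = ENNReal.ofReal (∑ i, ∑ j, (∫ ω, ⟪X i ω, X j ω⟫ ∂P) *
          max 0 (min (b i) (b j) - max (a i) (a j))) := by
  have hmem : ∀ s i, MemLp (fun ω => (Ioc (a i) (b i)).indicator (fun _ => X i ω) s) 2 P := by
    intro s i
    by_cases hs : s ∈ Ioc (a i) (b i)
    · simpa [hs] using hX i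
    · simp [hs]
  have hint : ∀ i j, Integrable (fun ω => ⟪X i ω, X j ω⟫) P := fun i j =>
    integrable_inner_of_memLp (hX i) (hX j)
  set F : ℝ → ℝ := fun s => ∑ i, ∑ j,
    (Ioc (a i) (b i) ∩ Ioc (a j) (b j)).indicator (fun _ => ∫ ω, ⟪X i ω, X j ω⟫ ∂P) s with hF
  have hsec : ∀ s, (eLpNorm (fun ω => ∑ i, (Ioc (a i) (b i)).indicator (fun _ => X i ω) s) 2 P) ^ 2
      = ENNReal.ofReal (F s) ∧ 0 ≤ F s := by
    intro s
    have hFs : ∫ ω, ‖∑ i, (Ioc (a i) (b i)).indicator (fun _ => X i ω) s‖ ^ 2 ∂P = F s := by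
      have hpt : ∀ i j ω, ⟪(Ioc (a i) (b i)).indicator (fun _ => X i ω) s,
          (Ioc (a j) (b j)).indicator (fun _ => X j ω) s⟫ =
          (Ioc (a i) (b i) ∩ Ioc (a j) (b j)).indicator (fun _ => (1 : ℝ)) s * ⟪X i ω, X j ω⟫ := by
        intro i j ω
        by_cases h1 : s ∈ Ioc (a i) (b i) <;> by_cases h2 : s ∈ Ioc (a j) (b j) <;>
          simp [indicator, h1, h2, -mem_Ioc]
      simp_rw [norm_sum_sq_eq, hpt]
      rw [integral_finsetSum _ fun i _ => integrable_finsetSum _ fun j _ => (hint i j).const_mul _]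
      refine Finset.sum_congr rfl fun i _ => ?_
      rw [integral_finsetSum _ fun j _ => (hint i j).const_mul _]
      refine Finset.sum_congr rfl fun j _ => ?_
      rw [integral_const_mul]
      simp [indicator]
    refine ⟨?_, hFs ▸ integral_nonneg fun ω => by positivity⟩
    have hm : MemLp (fun ω => ∑ i, (Ioc (a i) (b i)).indicator (fun _ => X i ω) s) 2 P :=
      memLp_finsetSum Finset.univ fun i _ => hmem s i
    rw [eLpNorm_two_sq_eq_ofReal hm, hFs]
  have hFint : ∀ i j, Integrable ((Ioc (a i) (b i) ∩ Ioc (a j) (b j)).indicator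
      fun _ : ℝ => ∫ ω, ⟪X i ω, X j ω⟫ ∂P) (volume.restrict (Icc 0 T)) := fun i j =>
    (integrable_const _).indicator (measurableSet_Ioc.inter measurableSet_Ioc)
  simp_rw [(hsec _).1]
  rw [← ofReal_integral_eq_lintegral_ofReal
    (integrable_finsetSum _ fun i _ => integrable_finsetSum _ fun j _ => hFint i j)
    (ae_of_all _ fun s => (hsec s).2)]
  congr 1
  rw [integral_finsetSum _ fun i _ => integrable_finsetSum _ fun j _ => hFint i j]
  refine Finset.sum_congr rfl fun i _ => ?_
  rw [integral_finsetSum _ fun j _ => hFint i j]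
  refine Finset.sum_congr rfl fun j _ => ?_
  rw [integral_indicator (measurableSet_Ioc.inter measurableSet_Ioc),
    Measure.restrict_restrict (measurableSet_Ioc.inter measurableSet_Ioc), setIntegral_const,
    smul_eq_mul, mul_comm, Ioc_inter_Ioc, inter_eq_left.2, measureReal_def, Real.volume_Ioc,
    ENNReal.toReal_ofReal', max_comm]
  exact fun s hs => ⟨(ha i).trans ((le_max_left _ _).trans hs.1.le),
    hs.2.trans ((min_le_left _ _).trans (hb i))⟩

/-- **Itô isometry** for a finite family of elementary integrands. -/
lemma IsBM.eLpNorm_sq_sum_tmul (hW : IsBM T W P) (h𝓑 : 𝓑 ≤ mΩ)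
    (hind : Indep (pastSigma W T) 𝓑 P) {c : ℝ} (hc0 : 0 ≤ c)
    (hc : ∀ a b : ℝ, 0 ≤ a → a ≤ b → b ≤ T → ∫ ω, ‖W b ω - W a ω‖ ^ 2 ∂P = c * (b - a))
    {a b : ι → ℝ} (ha : ∀ i, 0 ≤ a i) (hab : ∀ i, a i ≤ b i) (hb : ∀ i, b i ≤ T)
    {X : ι → Ω → V} (hX : ∀ i, StronglyMeasurable[𝓑 ⊔ pastSigma W (a i)] (X i)) {C : ι → ℝ}
    (hXC : ∀ i ω, ‖X i ω‖ ≤ C i) :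
    (eLpNorm (fun ω => ∑ i, X i ω ⊗ₜ[ℝ] (W (b i) ω - W (a i) ω)) 2 P) ^ 2
      = ENNReal.ofReal c * ∫⁻ s in Icc 0 T,
          (eLpNorm (fun ω => ∑ i, (Ioc (a i) (b i)).indicator (fun _ => X i ω) s) 2 P) ^ 2 := by
  have hle : ∀ i, 𝓑 ⊔ pastSigma W (a i) ≤ mΩ := fun i =>
    sup_le h𝓑 (pastSigma_le hW.measurable ((hab i).trans (hb i)))
  have hXm : ∀ i, AEStronglyMeasurable (X i) P := fun i =>
    ((hX i).mono (hle i)).aestronglyMeasurable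
  have hmem : ∀ i, MemLp (fun ω => X i ω ⊗ₜ[ℝ] (W (b i) ω - W (a i) ω)) 2 P := by
    intro i
    have h1 := hW.memLp_increment (ha i) (hab i) (hb i)
    refine (h1.norm.const_mul (C i)).mono (aestronglyMeasurable_tmul (hXm i) h1.1)
      (ae_of_all _ fun ω => ?_)
    rw [TensorProduct.norm_tmul, norm_mul, norm_norm]
    exact mul_le_mul_of_nonneg_right ((hXC i ω).trans (le_abs_self _)) (norm_nonneg _)
  have hm : MemLp (fun ω => ∑ i, X i ω ⊗ₜ[ℝ] (W (b i) ω - W (a i) ω)) 2 P :=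
    memLp_finsetSum Finset.univ fun i _ => hmem i
  rw [eLpNorm_two_sq_eq_ofReal hm,
    hW.integral_norm_sq_sum_tmul h𝓑 hind hc ha hab hb hX hXC,
    lintegral_eLpNorm_sq_sum_indicator ha hb
      (fun i => MemLp.of_bound (hXm i) (C i) (ae_of_all _ (hXC i))), ENNReal.ofReal_mul hc0]

/-- Itô isometry for the difference of two simple processes up to time `t`. -/
theorem IsBM.eLpNorm_sq_integral_sub_le (hW : IsBM T W P) (h𝓑 : 𝓑 ≤ mΩ)
    (hind : Indep (pastSigma W T) 𝓑 P) {c : ℝ} (hc0 : 0 ≤ c)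
    (hc : ∀ a b : ℝ, 0 ≤ a → a ≤ b → b ≤ T → ∫ ω, ‖W b ω - W a ω‖ ^ 2 ∂P = c * (b - a))
    (φ ψ : SimpleProcess (fun t => 𝓑 ⊔ pastSigma W t) T V) {t : ℝ} (ht : t ∈ Icc 0 T) :
    (eLpNorm (fun ω => φ.integral W t ω - ψ.integral W t ω) 2 P) ^ 2
      ≤ ENNReal.ofReal c * ∫⁻ s in Icc 0 T,
          (eLpNorm (fun ω => φ.eval s ω - ψ.eval s ω) 2 P) ^ 2 := by
  let a : Fin φ.N ⊕ Fin ψ.N → ℝ := Sum.elim (fun i => φ.time i) (fun i => ψ.time i)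
  let b : Fin φ.N ⊕ Fin ψ.N → ℝ := Sum.elim (fun i => φ.time (i + 1)) (fun i => ψ.time (i + 1))
  let X : Fin φ.N ⊕ Fin ψ.N → Ω → V := Sum.elim (fun i => φ.val i) (fun i => -ψ.val i)
  choose Cφ hCφ using φ.bounded
  choose Cψ hCψ using ψ.bounded
  have ha : ∀ i, a i ∈ Icc 0 T := by
    rintro (i | i)
    exacts [φ.time_mem _, ψ.time_mem _]
  have hab : ∀ i, a i ≤ b i := by
    rintro (i | i)
    exacts [φ.time_mono (Nat.le_succ _), ψ.time_mono (Nat.le_succ _)]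
  have hb : ∀ i, b i ∈ Icc 0 T := by
    rintro (i | i)
    exacts [φ.time_mem _, ψ.time_mem _]
  have hX : ∀ i, StronglyMeasurable[𝓑 ⊔ pastSigma W (a i)] (X i) := by
    rintro (i | i)
    exacts [φ.adapted _, (ψ.adapted _).neg]
  have hXC : ∀ i ω, ‖X i ω‖ ≤ Sum.elim (fun i : Fin φ.N => Cφ i) (fun i : Fin ψ.N => Cψ i) i := by
    rintro (i | i) ω
    · exact hCφ i ω
    · simpa [X] using hCψ i ω
  -- integrating up to time `t` is integrating the process that is stopped at time `t`
  classical
  let X' : Fin φ.N ⊕ Fin ψ.N → Ω → V := fun i => if a i ≤ t then X i else 0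
  have key := hW.eLpNorm_sq_sum_tmul h𝓑 hind hc0 hc (a := fun i => min (a i) t)
    (b := fun i => min (b i) t) (X := X')
    (C := Sum.elim (fun i : Fin φ.N => Cφ i) (fun i : Fin ψ.N => Cψ i))
    (fun i => le_min (ha i).1 ht.1) (fun i => min_le_min_right _ (hab i))
    (fun i => (min_le_right _ _).trans ht.2)
    (fun i => by
      by_cases h : a i ≤ t
      · rw [min_eq_left h]; simp only [X', h, if_true]; exact hX i
      · simp only [X', h, if_false]; exact stronglyMeasurable_zero)
    (fun i ω => by
      by_cases h : a i ≤ t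
      · simp only [X', h, if_true]; exact hXC i ω
      · simp only [X', h, if_false, Pi.zero_apply, norm_zero]
        exact (norm_nonneg _).trans (hXC i ω))
  have hL : (fun ω => φ.integral W t ω - ψ.integral W t ω) =
      fun ω => ∑ i, X' i ω ⊗ₜ[ℝ] (W (min (b i) t) ω - W (min (a i) t) ω) := by
    ext ω
    have h1 : ∀ i, X' i ω ⊗ₜ[ℝ] (W (min (b i) t) ω - W (min (a i) t) ω) =
        X i ω ⊗ₜ[ℝ] (W (min (b i) t) ω - W (min (a i) t) ω) := by
      intro i
      by_cases h : a i ≤ t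
      · simp [X', h]
      · have h' : t ≤ a i := le_of_not_ge h
        simp [h', h'.trans (hab i)]
    simp_rw [h1]
    rw [Fintype.sum_sum_type]
    simp only [X, a, b, Sum.elim_inl, Sum.elim_inr, Pi.neg_apply, TensorProduct.neg_tmul,
      Finset.sum_neg_distrib, SimpleProcess.integral, Finset.sum_range]
    abel
  have hR : ∀ s ω, ‖∑ i, (Ioc (min (a i) t) (min (b i) t)).indicator (fun _ => X' i ω) s‖
      ≤ ‖φ.eval s ω - ψ.eval s ω‖ := by
    intro s ω
    have h2 : φ.eval s ω - ψ.eval s ω = ∑ i, (Ioc (a i) (b i)).indicator (fun _ => X i ω) s := by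
      rw [Fintype.sum_sum_type, sub_eq_add_neg, SimpleProcess.eval, SimpleProcess.eval,
        Finset.sum_range, Finset.sum_range, ← Finset.sum_neg_distrib]
      refine congrArg₂ _ rfl (Finset.sum_congr rfl fun i _ => ?_)
      by_cases hs : s ∈ Ioc (ψ.time i) (ψ.time (i + 1)) <;> simp [X, a, b, hs, -mem_Ioc]
    rw [h2]
    by_cases hs : s ≤ t
    · refine (congrArg norm (Finset.sum_congr rfl fun i _ => ?_)).le
      by_cases h : a i ≤ t
      · simp [X', indicator, h, hs]
      · have h' : s ≤ a i := hs.trans (le_of_not_ge h)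
        simp [X', indicator, h, not_lt.2 h']
    · have : ∀ i, (Ioc (min (a i) t) (min (b i) t)).indicator (fun _ => X' i ω) s = 0 := by
        intro i
        simp [indicator, hs]
      simp [this]
  rw [hL, key]
  gcongr with s
  exact eLpNorm_mono (hR s)

end Isometry

/-! ### Approximation by cylinder functions and convergence in distribution -/

lemma eLpNorm_sub_le_add {Ω E : Type*} [MeasurableSpace Ω] {P : Measure Ω}
    [NormedAddCommGroup E] {X Y Z : Ω → E} (hX : AEStronglyMeasurable X P)
    (hY : AEStronglyMeasurable Y P) (hZ : AEStronglyMeasurable Z P) {p : ℝ≥0∞} (hp : 1 ≤ p) :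
    eLpNorm (fun ω => X ω - Z ω) p P
      ≤ eLpNorm (fun ω => X ω - Y ω) p P + eLpNorm (fun ω => Y ω - Z ω) p P := by
  have : (fun ω => X ω - Z ω) = (fun ω => X ω - Y ω) + fun ω => Y ω - Z ω := by
    ext ω; simp
  rw [this]
  exact eLpNorm_add_le (hX.sub hY) (hY.sub hZ) hp

section Density

open scoped BoundedContinuousFunction symmDiff

/-- Bounded continuous functions of finitely many coordinates are dense in `L²` of a probability
measure on a product space. -/
lemma exists_cylinder_eLpNorm_sub_le {I E V : Type*} [NormedAddCommGroup E] [MeasurableSpace E]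
    [BorelSpace E] [SecondCountableTopology E] [NormedAddCommGroup V] [NormedSpace ℝ V]
    {μ : Measure (I → E)} [IsProbabilityMeasure μ] {φ : (I → E) → V} (hφ : MemLp φ 2 μ)
    {ε : ℝ≥0∞} (hε : ε ≠ 0) :
    ∃ (S : Finset I) (G : (S → E) →ᵇ V), eLpNorm (fun x => φ x - G (S.restrict x)) 2 μ ≤ ε := by
  classical
  have key := hφ.induction_dense (ε := ε) ENNReal.ofNat_ne_top
    (fun g => ∃ (S : Finset I) (G : (S → E) →ᵇ V), g = fun x => G (S.restrict x)) ?_ ?_ ?_ hε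
  · obtain ⟨_, hg, S, G, rfl⟩ := key
    exact ⟨S, G, hg⟩
  · intro c s hs _ ε hε
    have hε2 : ε / 2 ≠ 0 := (ENNReal.half_pos hε).ne'
    obtain ⟨η, hη, hη'⟩ := exists_eLpNorm_indicator_le (μ := μ) (p := 2) ENNReal.ofNat_ne_top c hε2
    obtain ⟨t, ht, hst⟩ := (Measure.MeasureDense.of_generateFrom_isSetAlgebra_finite μ
      (isSetAlgebra_measurableCylinders (α := fun _ : I => E))
      generateFrom_measurableCylinders.symm).approx s hs (measure_ne_top _ _) η (by exact_mod_cast hη)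
    obtain ⟨S, A, hA, rfl⟩ := (mem_measurableCylinders t).1 ht
    have hr : Measurable (S.restrict : (I → E) → S → E) := Finset.measurable_restrict S
    have : IsProbabilityMeasure (μ.map (S.restrict : (I → E) → S → E)) :=
      Measure.isProbabilityMeasure_map hr.aemeasurable
    have hAm : MemLp (A.indicator fun _ => c) 2 (μ.map (S.restrict : (I → E) → S → E)) :=
      memLp_indicator_const 2 hA c (Or.inr (measure_ne_top _ _))
    obtain ⟨G, hG, -⟩ := hAm.exists_boundedContinuous_eLpNorm_sub_le ENNReal.ofNat_ne_top hε2
    refine ⟨_, ?_, S, G, rfl⟩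
    have hGm : AEStronglyMeasurable (fun x : I → E => G (S.restrict x)) μ :=
      (G.continuous.stronglyMeasurable.comp_measurable hr).aestronglyMeasurable
    have htm : AEStronglyMeasurable ((cylinder S A).indicator fun _ => c) μ :=
      (stronglyMeasurable_const.indicator (hA.cylinder S)).aestronglyMeasurable
    have hsm : AEStronglyMeasurable (s.indicator fun _ => c) μ :=
      (stronglyMeasurable_const.indicator hs).aestronglyMeasurable
    have h1 : eLpNorm ((fun x : I → E => G (S.restrict x)) - (cylinder S A).indicator fun _ => c)
        2 μ ≤ ε / 2 := by
      have h0 := eLpNorm_map_measure (p := 2)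
        (hAm.1.sub G.continuous.stronglyMeasurable.aestronglyMeasurable) hr.aemeasurable
      rw [h0] at hG
      rw [eLpNorm_sub_comm]
      exact hG
    have h2 : eLpNorm (((cylinder S A).indicator fun _ => c) - s.indicator fun _ => c) 2 μ
        ≤ ε / 2 := by
      refine (eLpNorm_mono fun x => ?_).trans (hη' (s ∆ cylinder S A) ?_)
      · by_cases h1 : x ∈ s <;> by_cases h2 : x ∈ cylinder S A <;>
          simp [indicator, h1, h2, mem_symmDiff, -mem_cylinder]
      · rw [ENNReal.ofReal_coe_nnreal] at hst
        exact hst.le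
    exact ((eLpNorm_sub_le_add hGm htm hsm (by norm_num)).trans (add_le_add h1 h2)).trans
      (ENNReal.add_halves ε).le
  · rintro _ _ ⟨S₁, G₁, rfl⟩ ⟨S₂, G₂, rfl⟩
    refine ⟨S₁ ∪ S₂,
      G₁.compContinuous ⟨Finset.restrict₂ (π := fun _ => E) Finset.subset_union_left,
        continuous_pi fun _ => continuous_apply _⟩ +
      G₂.compContinuous ⟨Finset.restrict₂ (π := fun _ => E) Finset.subset_union_right,
        continuous_pi fun _ => continuous_apply _⟩,
      rfl⟩
  · rintro _ ⟨S, G, rfl⟩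
    exact (G.continuous.stronglyMeasurable.comp_measurable
      (Finset.measurable_restrict S)).aestronglyMeasurable

/-- A square integrable functional of a process is approximated in `L²` by bounded continuous
functions of the process at finitely many times. -/
lemma exists_process_cylinder_eLpNorm_sub_le {Ω E V : Type*} [mΩ : MeasurableSpace Ω]
    {P : Measure Ω} [IsProbabilityMeasure P] [NormedAddCommGroup E] [MeasurableSpace E]
    [BorelSpace E] [SecondCountableTopology E] [NormedAddCommGroup V] [NormedSpace ℝ V]
    [CompleteSpace V] {T : ℝ} {B : ℝ → Ω → E} (hB : ∀ t ∈ Icc (0 : ℝ) T, Measurable (B t))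
    {f : Ω → V} (hf : AEStronglyMeasurable[pastSigma B T] f P) (hf2 : MemLp f 2 P)
    {ε : ℝ≥0∞} (hε : ε ≠ 0) :
    ∃ (S : Finset (Icc (0 : ℝ) T)) (G : (S → E) →ᵇ V),
      eLpNorm (fun ω => f ω - G fun s => B s ω) 2 P ≤ ε := by
  obtain ⟨f', hf'm, hff'⟩ := hf
  rw [pastSigma_eq_comap] at hf'm
  obtain ⟨φ, hφ, rfl⟩ := hf'm.exists_eq_measurable_comp
  have hp : Measurable fun ω (s : Icc (0 : ℝ) T) => B s ω :=
    measurable_pi_lambda _ fun s => hB s s.2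
  have : IsProbabilityMeasure (P.map fun ω (s : Icc (0 : ℝ) T) => B s ω) :=
    Measure.isProbabilityMeasure_map hp.aemeasurable
  have hφ2 : MemLp φ 2 (P.map fun ω (s : Icc (0 : ℝ) T) => B s ω) :=
    (memLp_map_measure_iff hφ.aestronglyMeasurable hp.aemeasurable).2 (hf2.ae_eq hff')
  obtain ⟨S, G, hG⟩ := exists_cylinder_eLpNorm_sub_le hφ2 hε
  refine ⟨S, G, ?_⟩
  have hm : AEStronglyMeasurable (fun x => φ x - G (S.restrict x))
      (P.map fun ω (s : Icc (0 : ℝ) T) => B s ω) :=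
    (hφ.sub (G.continuous.stronglyMeasurable.comp_measurable
      (Finset.measurable_restrict S))).aestronglyMeasurable
  rw [eLpNorm_map_measure hm hp.aemeasurable] at hG
  refine (eLpNorm_congr_ae ?_).le.trans hG
  filter_upwards [hff'] with ω hω
  simp [hω]
  rfl

end Density

section Convergence

lemma abs_integral_comp_sub_le {Ω E : Type*} [MeasurableSpace Ω] {P : Measure Ω}
    [IsProbabilityMeasure P] [NormedAddCommGroup E] [SecondCountableTopology E]
    [MeasurableSpace E] [BorelSpace E] {X Y : Ω → E} (hX : AEMeasurable X P)
    (hY : AEMeasurable Y P) {F : E → ℝ} {M : ℝ} (hM : ∀ x y, dist (F x) (F y) ≤ M) {L : ℝ≥0}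
    (hL : LipschitzWith L F) {ε : ℝ} (hε : 0 ≤ ε)
    (h : eLpNorm (fun ω => X ω - Y ω) 1 P ≤ ENNReal.ofReal ε) :
    |∫ ω, F (X ω) ∂P - ∫ ω, F (Y ω) ∂P| ≤ L * ε := by
  have hF : Continuous F := hL.continuous
  have hint : ∀ {X : Ω → E}, AEMeasurable X P → Integrable (fun ω => F (X ω)) P := fun {X} hX =>
    Integrable.of_bound (hF.measurable.comp_aemeasurable hX).aestronglyMeasurable (‖F 0‖ + M)
      (ae_of_all _ fun ω => by
        have := hM (X ω) 0
        rw [Real.dist_eq] at this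
        rw [← sub_le_iff_le_add']
        exact (abs_sub_abs_le_abs_sub _ _).trans this)
  rw [← integral_sub (hint hX) (hint hY), ← Real.norm_eq_abs]
  refine (norm_integral_le_lintegral_norm _).trans ?_
  refine ENNReal.toReal_le_of_le_ofReal (by positivity) ?_
  calc ∫⁻ ω, ENNReal.ofReal ‖F (X ω) - F (Y ω)‖ ∂P ≤ ∫⁻ ω, L * ‖X ω - Y ω‖ₑ ∂P := by
        refine lintegral_mono fun ω => ?_
        rw [ofReal_norm, ← edist_eq_enorm_sub, ← edist_eq_enorm_sub]
        exact hL _ _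
    _ = L * eLpNorm (fun ω => X ω - Y ω) 1 P := by
        rw [lintegral_const_mul' _ _ ENNReal.coe_ne_top, eLpNorm_one_eq_lintegral_enorm]
    _ ≤ L * ENNReal.ofReal ε := by gcongr
    _ = ENNReal.ofReal (L * ε) := by
        rw [ENNReal.ofReal_mul (by positivity), ENNReal.ofReal_coe_nnreal]

/-- Convergence in distribution may be checked on `L¹` approximations that are uniformly good for
large `n`. -/
theorem tendstoInDistribution_of_approx {Ω Ω' E : Type*} [MeasurableSpace Ω] [MeasurableSpace Ω']
    {P : Measure Ω} [IsProbabilityMeasure P] {P' : Measure Ω'} [IsProbabilityMeasure P']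
    [NormedAddCommGroup E] [SecondCountableTopology E]
    [MeasurableSpace E] [BorelSpace E] {X : ℕ → Ω → E} {Z : Ω' → E}
    (hX : ∀ n, AEMeasurable (X n) P) (hZ : AEMeasurable Z P')
    (h : ∀ ε : ℝ, 0 < ε → ∃ (Y : ℕ → Ω → E) (Z' : Ω' → E),
      TendstoInDistribution Y atTop Z' (fun _ => P) P' ∧
      (∀ᶠ n in atTop, eLpNorm (fun ω => X n ω - Y n ω) 1 P ≤ ENNReal.ofReal ε) ∧
      eLpNorm (fun ω => Z ω - Z' ω) 1 P' ≤ ENNReal.ofReal ε) :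
    TendstoInDistribution X atTop Z (fun _ => P) P' := by
  refine ⟨hX, hZ, ?_⟩
  refine tendsto_iff_forall_lipschitz_integral_tendsto.2 ?_
  rintro F ⟨M, hM⟩ ⟨L, hL⟩
  have hF : Continuous F := hL.continuous
  simp only [ProbabilityMeasure.coe_mk]
  rw [Metric.tendsto_atTop']
  intro δ hδ
  obtain ⟨Y, Z', hYZ, hXY, hZZ⟩ := h (δ / (3 * (L + 1))) (by positivity)
  have hY := hYZ.forall_aemeasurable
  have hZ' := hYZ.aemeasurable_limit
  have hconv := tendsto_iff_forall_lipschitz_integral_tendsto.1 hYZ.tendsto F ⟨M, hM⟩ ⟨L, hL⟩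
  simp only [ProbabilityMeasure.coe_mk] at hconv
  have hev : ∀ᶠ n in atTop, dist (∫ x, F x ∂(P.map (X n))) (∫ x, F x ∂(P'.map Z)) < δ := by
    filter_upwards [hXY, Metric.tendsto_nhds.1 hconv (δ / 3) (by positivity)] with n h1 h2
    have hε : 0 ≤ δ / (3 * ((L : ℝ) + 1)) := by positivity
    have e1 := abs_integral_comp_sub_le (hX n) (hY n) hM hL hε h1
    have e2 := abs_integral_comp_sub_le hZ hZ' hM hL hε hZZ
    have hLδ : (L : ℝ) * (δ / (3 * (L + 1))) ≤ δ / 3 := by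
      rw [mul_div_assoc', div_le_div_iff₀ (by positivity) (by positivity)]
      nlinarith [L.coe_nonneg]
    rw [integral_map (hY n) hF.aestronglyMeasurable, integral_map hZ' hF.aestronglyMeasurable,
      Real.dist_eq] at h2
    rw [integral_map (hX n) hF.aestronglyMeasurable, integral_map hZ hF.aestronglyMeasurable,
      Real.dist_eq]
    rw [abs_lt] at h2 ⊢
    rw [abs_le] at e1 e2
    constructor <;> linarith [e1.1, e1.2, e2.1, e2.2, h2.1, h2.2]
  obtain ⟨N, hN⟩ := eventually_atTop.1 hev
  exact ⟨N, fun n hn => hN n hn.le⟩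

/-- Convergence of the finite-dimensional distributions, for a family of times indexed by any
finite type. -/
lemma TendstoFDD.tendstoInDistribution {Ω Ω' E : Type*} [MeasurableSpace Ω] [MeasurableSpace Ω']
    {P : Measure Ω} [IsProbabilityMeasure P] {P' : Measure Ω'} [IsProbabilityMeasure P']
    [TopologicalSpace E] [SecondCountableTopology E] [MeasurableSpace E] [BorelSpace E] {T : ℝ}
    {X : ℕ → ℝ → Ω → E} {Y : ℝ → Ω' → E} (h : TendstoFDD T X P Y P') {ι : Type*} [Fintype ι]
    (r : ι → Icc (0 : ℝ) T) :
    TendstoInDistribution (fun n ω i => X n (r i) ω) atTop (fun ω i => Y (r i) ω) (fun _ => P)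
      P' := by
  let e := Fintype.equivFin ι
  have := (h _ (r ∘ e.symm)).continuous_comp (F := ι → E) (g := fun x i => x (e i)) (by fun_prop)
  simpa [Function.comp_def] using this

end Convergence

/-! ### Sewing estimates for weighted sums -/

section WeightedSewing

variable {Ω E V V' : Type*} [MeasurableSpace Ω] {P : Measure Ω}
  [NormedAddCommGroup E] [InnerProductSpace ℝ E] [FiniteDimensional ℝ E]
  [NormedAddCommGroup V] [InnerProductSpace ℝ V] [FiniteDimensional ℝ V]
  [NormedAddCommGroup V'] [InnerProductSpace ℝ V'] [FiniteDimensional ℝ V']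

lemma rpow_mul_rpow_le_add {x y a b : ℝ} (hx : 0 ≤ x) (hy : 0 ≤ y) (hxy : 0 < x + y) (ha : 0 ≤ a)
    (hb : 0 ≤ b) : x ^ a * y ^ b ≤ (x + y) ^ (a + b) := by
  rw [Real.rpow_add hxy]
  gcongr <;> linarith

/-- Local expansion of weighted sums: if the weight `F` is controlled by `β` with derivative `G`,
then `∑ F_k ⊗ η_k` over `[i, j)` equals `F_i ⊗ ∑ η_k + G_i (∑ (β_k - β_i) ⊗ η_k)` up to an error
of order `α + 2 γ > 1` in the length of the interval. -/
theorem eLpNorm_weightedSum_expansion_le {C : ℝ≥0}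
    (hC : ∀ {g : Ω → E →L[ℝ] V} {Z : Ω → E ⊗[ℝ] V'}, AEStronglyMeasurable g P →
      AEStronglyMeasurable Z P →
      eLpNorm (fun ω => tensorAct E V V' (g ω) (Z ω)) 1 P ≤ C * (eLpNorm g 2 P * eLpNorm Z 2 P))
    {γ α : ℝ} (hγ : 0 < γ) (hα : 0 < α) (hαγ : 1 < α + 2 * γ) {K d : ℝ} (hK : 0 ≤ K) (hd : 0 < d)
    {N : ℕ} {F : ℕ → Ω → V} {G : ℕ → Ω → E →L[ℝ] V} {β : ℕ → Ω → E} {η : ℕ → Ω → V'}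
    (hF : ∀ k ≤ N, AEStronglyMeasurable (F k) P) (hG : ∀ k ≤ N, AEStronglyMeasurable (G k) P)
    (hβ : ∀ k ≤ N, AEStronglyMeasurable (β k) P) (hη : ∀ k < N, AEStronglyMeasurable (η k) P)
    (hFG : ∀ i j, i < j → j ≤ N → eLpNorm (fun ω => (F j ω - F i ω) - G i ω (β j ω - β i ω)) 2 P
      ≤ ENNReal.ofReal (K * (((j : ℝ) - i) * d) ^ (2 * γ)))
    (hGG : ∀ i j, i < j → j ≤ N → eLpNorm (fun ω => G j ω - G i ω) 2 P
      ≤ ENNReal.ofReal (K * (((j : ℝ) - i) * d) ^ γ))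
    (hηη : ∀ i j, i < j → j ≤ N → eLpNorm (fun ω => ∑ k ∈ Finset.Ico i j, η k ω) 2 P
      ≤ ENNReal.ofReal (K * (((j : ℝ) - i) * d) ^ α))
    (hD : ∀ i j, i < j → j ≤ N →
      eLpNorm (fun ω => ∑ k ∈ Finset.Ico i j, (β k ω - β i ω) ⊗ₜ[ℝ] η k ω) 2 P
      ≤ ENNReal.ofReal (K * (((j : ℝ) - i) * d) ^ (γ + α)))
    {i j : ℕ} (hij : i < j) (hj : j ≤ N) :
    eLpNorm (fun ω => ∑ k ∈ Finset.Ico i j, F k ω ⊗ₜ[ℝ] η k ω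
        - (F i ω ⊗ₜ[ℝ] (∑ k ∈ Finset.Ico i j, η k ω)
          + tensorAct E V V' (G i ω) (∑ k ∈ Finset.Ico i j, (β k ω - β i ω) ⊗ₜ[ℝ] η k ω))) 1 P
      ≤ ENNReal.ofReal ((1 + C) * K ^ 2 *
          (sewingConst (α + 2 * γ) * (((j : ℝ) - i) * d) ^ (α + 2 * γ))) := by
  have hHm : ∀ i j, j ≤ N → AEStronglyMeasurable (fun ω => ∑ k ∈ Finset.Ico i j, η k ω) P :=
    fun i j hj => Finset.aestronglyMeasurable_fun_sum _ fun k hk =>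
      hη k (by have := Finset.mem_Ico.1 hk; omega)
  have hDm : ∀ i j, j ≤ N →
      AEStronglyMeasurable (fun ω => ∑ k ∈ Finset.Ico i j, (β k ω - β i ω) ⊗ₜ[ℝ] η k ω) P :=
    fun i j hj => Finset.aestronglyMeasurable_fun_sum _ fun k hk => by
      have := Finset.mem_Ico.1 hk
      exact aestronglyMeasurable_tmul ((hβ k (by omega)).sub (hβ i (by omega))) (hη k (by omega))
  set A : ℕ → ℕ → Ω → V ⊗[ℝ] V' := fun i j ω => F i ω ⊗ₜ[ℝ] (∑ k ∈ Finset.Ico i j, η k ω)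
    + tensorAct E V V' (G i ω) (∑ k ∈ Finset.Ico i j, (β k ω - β i ω) ⊗ₜ[ℝ] η k ω) with hA
  have hAm : ∀ i j, i ≤ j → j ≤ N → AEStronglyMeasurable (A i j) P := fun i j hij hj =>
    (aestronglyMeasurable_tmul (hF i (hij.trans hj)) (hHm i j hj)).add
      (aestronglyMeasurable_tensorAct (hG i (hij.trans hj)) (hDm i j hj))
  have hA1 : ∀ k ω, A k (k + 1) ω = F k ω ⊗ₜ[ℝ] η k ω := by
    intro k ω
    simp [hA]
  -- the defect of additivity of `A` at an intermediate point
  have hdefect : ∀ i j k, 0 ≤ i → i < j → j < k → k ≤ N →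
      eLpNorm (fun ω => A i k ω - A i j ω - A j k ω) 1 P
        ≤ ENNReal.ofReal ((1 + C) * K ^ 2 * d ^ (α + 2 * γ) * ((k : ℝ) - i) ^ (α + 2 * γ)) := by
    intro i j k _ hij hjk hk
    have hsplit : (fun ω => A i k ω - A i j ω - A j k ω) =
        -((fun ω => ((F j ω - F i ω) - G i ω (β j ω - β i ω)) ⊗ₜ[ℝ] (∑ l ∈ Finset.Ico j k, η l ω))
        + fun ω => tensorAct E V V' (G j ω - G i ω)
            (∑ l ∈ Finset.Ico j k, (β l ω - β j ω) ⊗ₜ[ℝ] η l ω)) := by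
      ext ω
      have h1 : ∑ l ∈ Finset.Ico i k, η l ω =
          ∑ l ∈ Finset.Ico i j, η l ω + ∑ l ∈ Finset.Ico j k, η l ω :=
        (Finset.sum_Ico_consecutive _ hij.le hjk.le).symm
      have h2 : ∑ l ∈ Finset.Ico i k, (β l ω - β i ω) ⊗ₜ[ℝ] η l ω =
          ∑ l ∈ Finset.Ico i j, (β l ω - β i ω) ⊗ₜ[ℝ] η l ω
          + ((β j ω - β i ω) ⊗ₜ[ℝ] (∑ l ∈ Finset.Ico j k, η l ω)
            + ∑ l ∈ Finset.Ico j k, (β l ω - β j ω) ⊗ₜ[ℝ] η l ω) := by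
        rw [← Finset.sum_Ico_consecutive _ hij.le hjk.le, TensorProduct.tmul_sum,
          ← Finset.sum_add_distrib]
        congr 1
        refine Finset.sum_congr rfl fun l _ => ?_
        rw [← TensorProduct.add_tmul]
        congr 1; abel
      simp only [hA, Pi.neg_apply, Pi.add_apply]
      rw [h1, h2]
      simp only [TensorProduct.tmul_add, TensorProduct.sub_tmul, map_add, map_sub,
        LinearMap.sub_apply, tensorAct_tmul]
      abel
    have m1 : AEStronglyMeasurable (fun ω => (F j ω - F i ω) - G i ω (β j ω - β i ω)) P :=
      ((hF j (by omega)).sub (hF i (by omega))).sub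
        (isBoundedBilinearMap_apply.continuous.comp_aestronglyMeasurable
          ((hG i (by omega)).prodMk ((hβ j (by omega)).sub (hβ i (by omega)))))
    have m2 : AEStronglyMeasurable (fun ω => G j ω - G i ω) P :=
      (hG j (by omega)).sub (hG i (by omega))
    have hx : (0 : ℝ) < (j : ℝ) - i := sub_pos.2 (by exact_mod_cast hij)
    have hy : (0 : ℝ) < (k : ℝ) - j := sub_pos.2 (by exact_mod_cast hjk)
    have hxd := mul_pos hx hd
    have hyd := mul_pos hy hd
    have e1 : eLpNorm (fun ω => ((F j ω - F i ω) - G i ω (β j ω - β i ω))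
        ⊗ₜ[ℝ] (∑ l ∈ Finset.Ico j k, η l ω)) 1 P
        ≤ ENNReal.ofReal (K ^ 2 * ((((k : ℝ) - i) * d) ^ (α + 2 * γ))) := by
      refine (eLpNorm_one_tmul_le m1 (hHm j k hk)).trans ?_
      refine (mul_le_mul' (hFG i j hij (by omega)) (hηη j k hjk hk)).trans ?_
      rw [← ENNReal.ofReal_mul (by positivity)]
      refine ENNReal.ofReal_le_ofReal ?_
      have := rpow_mul_rpow_le_add hxd.le hyd.le (by linarith) (a := 2 * γ) (b := α)
        (by positivity) hα.le
      rw [show ((j : ℝ) - i) * d + ((k : ℝ) - j) * d = ((k : ℝ) - i) * d by ring,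
        add_comm (2 * γ)] at this
      calc _ = K ^ 2 * ((((j : ℝ) - i) * d) ^ (2 * γ) * (((k : ℝ) - j) * d) ^ α) := by ring
        _ ≤ _ := by gcongr
    have e2 : eLpNorm (fun ω => tensorAct E V V' (G j ω - G i ω)
        (∑ l ∈ Finset.Ico j k, (β l ω - β j ω) ⊗ₜ[ℝ] η l ω)) 1 P
        ≤ ENNReal.ofReal (C * K ^ 2 * ((((k : ℝ) - i) * d) ^ (α + 2 * γ))) := by
      refine (hC m2 (hDm j k hk)).trans ?_
      refine (mul_le_mul' le_rfl
        (mul_le_mul' (hGG i j hij (by omega)) (hD j k hjk hk))).trans ?_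
      rw [← ENNReal.ofReal_mul (by positivity), ← ENNReal.ofReal_coe_nnreal,
        ← ENNReal.ofReal_mul (by positivity)]
      refine ENNReal.ofReal_le_ofReal ?_
      have := rpow_mul_rpow_le_add hxd.le hyd.le (by linarith) (a := γ) (b := γ + α)
        (by positivity) (by positivity)
      rw [show ((j : ℝ) - i) * d + ((k : ℝ) - j) * d = ((k : ℝ) - i) * d by ring,
        show γ + (γ + α) = α + 2 * γ by ring] at this
      calc _ = C * K ^ 2 * ((((j : ℝ) - i) * d) ^ γ * (((k : ℝ) - j) * d) ^ (γ + α)) := by ring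
        _ ≤ _ := by gcongr
    rw [hsplit, eLpNorm_neg]
    refine (eLpNorm_add_le (aestronglyMeasurable_tmul m1 (hHm j k hk))
      (aestronglyMeasurable_tensorAct m2 (hDm j k hk)) le_rfl).trans ?_
    refine (add_le_add e1 e2).trans ?_
    have hz : (0 : ℝ) < (k : ℝ) - i := by linarith
    rw [← ENNReal.ofReal_add (by positivity) (by positivity)]
    refine ENNReal.ofReal_le_ofReal (le_of_eq ?_)
    rw [Real.mul_rpow hz.le hd.le]
    ring
  have key := eLpNorm_sum_sub_le_of_almost_additive (P := P) (show 1 < α + 2 * γ by linarith)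
    hAm (by positivity) hdefect (Nat.zero_le i) hij hj
  simp_rw [hA1] at key
  refine key.trans (ENNReal.ofReal_le_ofReal (le_of_eq ?_))
  rw [Real.mul_rpow (sub_nonneg.2 (by exact_mod_cast hij.le)) hd.le]
  ring

/-- Weighted sums of block sums: a weight with Hölder exponent `γ` against increments `∑ ζ_l` with
exponent `δ`, where `γ + δ > 1`, inherit the small factor `ρ` of the increments. -/
theorem eLpNorm_sum_tensorAct_le {C : ℝ≥0}
    (hC : ∀ {g : Ω → E →L[ℝ] V} {Z : Ω → E ⊗[ℝ] V'}, AEStronglyMeasurable g P →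
      AEStronglyMeasurable Z P →
      eLpNorm (fun ω => tensorAct E V V' (g ω) (Z ω)) 1 P ≤ C * (eLpNorm g 2 P * eLpNorm Z 2 P))
    {γ δ : ℝ} (hγ : 0 < γ) (hδ : 0 < δ) (hγδ : 1 < γ + δ) {K ρ d : ℝ} (hK : 0 ≤ K) (hρ : 0 ≤ ρ)
    (hd : 0 < d) {N : ℕ} {G : ℕ → Ω → E →L[ℝ] V} {ζ : ℕ → Ω → E ⊗[ℝ] V'}
    (hG : ∀ k ≤ N, AEStronglyMeasurable (G k) P) (hζ : ∀ k < N, AEStronglyMeasurable (ζ k) P)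
    (hGb : ∀ k ≤ N, eLpNorm (G k) 2 P ≤ ENNReal.ofReal K)
    (hGG : ∀ a b, a < b → b ≤ N → eLpNorm (fun ω => G b ω - G a ω) 2 P
      ≤ ENNReal.ofReal (K * (((b : ℝ) - a) * d) ^ γ))
    (hZ : ∀ a b, 1 ≤ a → a < b → b ≤ N → eLpNorm (fun ω => ∑ l ∈ Finset.Ico a b, ζ l ω) 2 P
      ≤ ENNReal.ofReal (K * ρ * (((b : ℝ) - a) * d) ^ δ)) (hN : 1 < N) :
    eLpNorm (fun ω => ∑ l ∈ Finset.Ico 1 N, tensorAct E V V' (G l ω) (ζ l ω)) 1 P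
      ≤ ENNReal.ofReal (C * K ^ 2 * ρ * (sewingConst (γ + δ) * (N * d) ^ (γ + δ) + (N * d) ^ δ)) := by
  have hZm : ∀ a b, b ≤ N → AEStronglyMeasurable (fun ω => ∑ l ∈ Finset.Ico a b, ζ l ω) P :=
    fun a b hb => Finset.aestronglyMeasurable_fun_sum _ fun k hk =>
      hζ k (by have := Finset.mem_Ico.1 hk; omega)
  set A : ℕ → ℕ → Ω → V ⊗[ℝ] V' := fun a b ω =>
    tensorAct E V V' (G a ω) (∑ l ∈ Finset.Ico a b, ζ l ω) with hA
  have hAm : ∀ i j, i ≤ j → j ≤ N → AEStronglyMeasurable (A i j) P := fun i j hij hj =>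
    aestronglyMeasurable_tensorAct (hG i (hij.trans hj)) (hZm i j hj)
  have hA1 : ∀ k ω, A k (k + 1) ω = tensorAct E V V' (G k ω) (ζ k ω) := by
    intro k ω
    simp [hA]
  -- the block at the origin is left out, as `∑ ζ_l` is only bounded over `l ≥ 1`
  have hdefect : ∀ i j k, 1 ≤ i → i < j → j < k → k ≤ N →
      eLpNorm (fun ω => A i k ω - A i j ω - A j k ω) 1 P
        ≤ ENNReal.ofReal (C * K ^ 2 * ρ * d ^ (γ + δ) * ((k : ℝ) - i) ^ (γ + δ)) := by
    intro i j k hi hij hjk hk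
    have hsplit : (fun ω => A i k ω - A i j ω - A j k ω) =
        -(fun ω => tensorAct E V V' (G j ω - G i ω) (∑ l ∈ Finset.Ico j k, ζ l ω)) := by
      ext ω
      simp only [hA, Pi.neg_apply]
      rw [← Finset.sum_Ico_consecutive _ hij.le hjk.le]
      simp only [map_add, map_sub, LinearMap.sub_apply]
      abel
    have m2 : AEStronglyMeasurable (fun ω => G j ω - G i ω) P :=
      (hG j (by omega)).sub (hG i (by omega))
    have hx : (0 : ℝ) < (j : ℝ) - i := sub_pos.2 (by exact_mod_cast hij)
    have hy : (0 : ℝ) < (k : ℝ) - j := sub_pos.2 (by exact_mod_cast hjk)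
    have hz : (0 : ℝ) < (k : ℝ) - i := by linarith
    have hxd := mul_pos hx hd
    have hyd := mul_pos hy hd
    rw [hsplit, eLpNorm_neg]
    refine (hC m2 (hZm j k hk)).trans ?_
    refine (mul_le_mul' le_rfl
      (mul_le_mul' (hGG i j hij (by omega)) (hZ j k (by omega) hjk hk))).trans ?_
    rw [← ENNReal.ofReal_mul (by positivity), ← ENNReal.ofReal_coe_nnreal,
      ← ENNReal.ofReal_mul (by positivity)]
    refine ENNReal.ofReal_le_ofReal ?_
    have := rpow_mul_rpow_le_add hxd.le hyd.le (by linarith) hγ.le hδ.le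
    rw [show ((j : ℝ) - i) * d + ((k : ℝ) - j) * d = ((k : ℝ) - i) * d by ring,
      Real.mul_rpow hz.le hd.le] at this
    calc _ = C * K ^ 2 * ρ * ((((j : ℝ) - i) * d) ^ γ * (((k : ℝ) - j) * d) ^ δ) := by ring
      _ ≤ C * K ^ 2 * ρ * (((k : ℝ) - i) ^ (γ + δ) * d ^ (γ + δ)) := by gcongr
      _ = _ := by ring
  have key := eLpNorm_sum_sub_le_of_almost_additive (P := P) hγδ hAm (by positivity) hdefect
    le_rfl hN le_rfl
  simp_rw [hA1] at key
  have hN1 : (0 : ℝ) ≤ (N : ℝ) - (1 : ℕ) := sub_nonneg.2 (by exact_mod_cast hN.le)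
  have hN2 : (N : ℝ) - (1 : ℕ) ≤ N := by simp
  have hs := sewingConst_pos hγδ
  have e1 : eLpNorm (A 1 N) 1 P ≤ ENNReal.ofReal (C * K ^ 2 * ρ * (N * d) ^ δ) := by
    refine (hC (hG 1 hN.le) (hZm 1 N le_rfl)).trans ?_
    refine (mul_le_mul' le_rfl (mul_le_mul' (hGb 1 hN.le) (hZ 1 N le_rfl hN le_rfl))).trans ?_
    rw [← ENNReal.ofReal_mul (by positivity), ← ENNReal.ofReal_coe_nnreal,
      ← ENNReal.ofReal_mul (by positivity)]
    refine ENNReal.ofReal_le_ofReal ?_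
    calc _ = C * K ^ 2 * ρ * (((N : ℝ) - (1 : ℕ)) * d) ^ δ := by ring
      _ ≤ _ := by gcongr
  have hsum : (fun ω => ∑ l ∈ Finset.Ico 1 N, tensorAct E V V' (G l ω) (ζ l ω)) =
      (fun ω => ∑ l ∈ Finset.Ico 1 N, tensorAct E V V' (G l ω) (ζ l ω) - A 1 N ω) + A 1 N := by
    ext ω; simp
  have hsm : AEStronglyMeasurable
      (fun ω => ∑ l ∈ Finset.Ico 1 N, tensorAct E V V' (G l ω) (ζ l ω) - A 1 N ω) P := by
    refine AEStronglyMeasurable.sub (Finset.aestronglyMeasurable_fun_sum _ fun k hk => ?_)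
      (hAm 1 N hN.le le_rfl)
    have := Finset.mem_Ico.1 hk
    exact aestronglyMeasurable_tensorAct (hG k (by omega)) (hζ k (by omega))
  rw [hsum]
  refine (eLpNorm_add_le hsm (hAm 1 N hN.le le_rfl) le_rfl).trans ?_
  refine (add_le_add key e1).trans ?_
  rw [← ENNReal.ofReal_add (by positivity) (by positivity)]
  refine ENNReal.ofReal_le_ofReal ?_
  calc _ = C * K ^ 2 * ρ * (sewingConst (γ + δ) * (((N : ℝ) - (1 : ℕ)) ^ (γ + δ) * d ^ (γ + δ))
        + (N * d) ^ δ) := by ring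
    _ = C * K ^ 2 * ρ * (sewingConst (γ + δ) * (((N : ℝ) - (1 : ℕ)) * d) ^ (γ + δ)
        + (N * d) ^ δ) := by rw [Real.mul_rpow hN1 hd.le]
    _ ≤ _ := by gcongr

end WeightedSewing

/-! ### Fine and coarse grids -/

section Grid

variable {T : ℝ} {n ν : ℕ}

lemma gridPt_sub (T : ℝ) (n i j : ℕ) :
    gridPt T n j - gridPt T n i = ((j : ℝ) - i) * (T / n) := by
  simp only [gridPt]; ring

@[simp] lemma gridPt_zero (T : ℝ) (n : ℕ) : gridPt T n 0 = 0 := by simp [gridPt]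

lemma gridPt_self (hn : n ≠ 0) : gridPt T n n = T := by
  have : (n : ℝ) ≠ 0 := by exact_mod_cast hn
  simp only [gridPt]; field_simp

lemma gridPt_mono (hT : 0 < T) (n : ℕ) : Monotone (gridPt T n) := fun i j hij => by
  have : (i : ℝ) ≤ j := by exact_mod_cast hij
  simp only [gridPt]; gcongr

lemma gridPt_mem (hT : 0 < T) {k : ℕ} (hk : k ≤ n) : gridPt T n k ∈ Icc 0 T := by
  refine ⟨by simp only [gridPt]; positivity, ?_⟩
  rcases Nat.eq_zero_or_pos n with rfl | hn
  · simp [gridPt, hT.le]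
  · exact (gridPt_mono hT n hk).trans (gridPt_self hn.ne').le

lemma gridPt_le_iff (hT : 0 < T) (hn : n ≠ 0) {t : ℝ} (ht : 0 ≤ t) {k : ℕ} :
    gridPt T n k ≤ t ↔ k ≤ gridIdx T n t := by
  have : (0 : ℝ) < n := by exact_mod_cast Nat.pos_of_ne_zero hn
  rw [gridIdx, Nat.le_floor_iff (by positivity), gridPt, div_le_iff₀ this, le_div_iff₀ hT]
  constructor <;> intro h <;> linarith

lemma gridIdx_mono (hT : 0 < T) (n : ℕ) : Monotone (gridIdx T n) := fun s t hst =>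
  Nat.floor_mono (by gcongr)

@[simp] lemma gridIdx_zero (T : ℝ) (n : ℕ) : gridIdx T n 0 = 0 := by simp [gridIdx]

lemma gridIdx_self (hT : 0 < T) (n : ℕ) : gridIdx T n T = n := by
  rw [gridIdx, mul_div_cancel_right₀ _ hT.ne', Nat.floor_natCast]

lemma gridIdx_le (hT : 0 < T) {t : ℝ} (ht : t ≤ T) : gridIdx T n t ≤ n :=
  (gridIdx_mono hT n ht).trans (gridIdx_self hT n).le

lemma gridFloor_le (hT : 0 < T) (hn : n ≠ 0) {t : ℝ} (ht : 0 ≤ t) : gridFloor T n t ≤ t :=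
  (gridPt_le_iff hT hn ht).2 le_rfl

lemma lt_gridFloor_add (hT : 0 < T) (hn : n ≠ 0) {t : ℝ} (ht : 0 ≤ t) :
    t < gridFloor T n t + T / n := by
  have h : ¬ gridPt T n (gridIdx T n t + 1) ≤ t := by
    rw [gridPt_le_iff hT hn ht]; omega
  have h2 := gridPt_sub T n (gridIdx T n t) (gridIdx T n t + 1)
  push_cast at h2
  simp only [add_sub_cancel_left, one_mul] at h2
  rw [gridFloor]
  linarith

lemma coarseIdx_mono (hT : 0 < T) (n ν : ℕ) : Monotone (coarseIdx T n ν) := fun _ _ h =>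
  gridIdx_mono hT n (gridPt_mono hT ν h)

@[simp] lemma coarseIdx_zero (T : ℝ) (n ν : ℕ) : coarseIdx T n ν 0 = 0 := by simp [coarseIdx]

lemma coarseIdx_self (hT : 0 < T) (hν : ν ≠ 0) : coarseIdx T n ν ν = n := by
  rw [coarseIdx, gridPt_self hν, gridIdx_self hT]

lemma coarseIdx_le (hT : 0 < T) {l : ℕ} (hl : l ≤ ν) : coarseIdx T n ν l ≤ n :=
  gridIdx_le hT (gridPt_mem hT hl).2

/-- If the fine grid is at least as fine as the coarse one, then points of the fine grid next to
coarse grid points are at most twice as far apart as these. -/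
lemma gridPt_coarseIdx_sub_le (hT : 0 < T) (hν : ν ≠ 0) (hνn : ν ≤ n) {a b : ℕ} (hab : a < b)
    (hb : b ≤ ν) : gridPt T n (coarseIdx T n ν b) - gridPt T n (coarseIdx T n ν a)
      ≤ 2 * (((b : ℝ) - a) * (T / ν)) := by
  have hn : n ≠ 0 := by omega
  have h1 := gridFloor_le hT hn (gridPt_mem hT hb).1
  have h2 := lt_gridFloor_add hT hn (gridPt_mem hT (hab.le.trans hb)).1
  have h3 := gridPt_sub T ν a b
  have hν0 : (0 : ℝ) < ν := by exact_mod_cast Nat.pos_of_ne_zero hν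
  have h4 : T / n ≤ T / ν := by gcongr
  have h5 : (1 : ℝ) ≤ (b : ℝ) - a := by
    have : ((a + 1 : ℕ) : ℝ) ≤ b := by exact_mod_cast hab
    push_cast at this; linarith
  have h6 : T / ν ≤ ((b : ℝ) - a) * (T / ν) := le_mul_of_one_le_left (by positivity) h5
  simp only [gridFloor] at h1 h2
  simp only [coarseIdx]
  linarith

/-- The end of the index interval `[k_l, k_{l+1})` after it is cut off behind the last grid point
`≤ t`. The maximum with `k_l` makes blocks that start after `t` empty intervals from `k_l` to
`k_l`. -/
noncomputable def blockEnd (T : ℝ) (n ν l : ℕ) (t : ℝ) : ℕ :=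
  max (coarseIdx T n ν l) (min (coarseIdx T n ν (l + 1)) (gridIdx T n t + 1))

lemma coarseIdx_le_blockEnd (T : ℝ) (n ν l : ℕ) (t : ℝ) :
    coarseIdx T n ν l ≤ blockEnd T n ν l t := le_max_left _ _

lemma blockEnd_le (hT : 0 < T) (n ν l : ℕ) (t : ℝ) :
    blockEnd T n ν l t ≤ coarseIdx T n ν (l + 1) :=
  max_le (coarseIdx_mono hT n ν (Nat.le_succ l)) (min_le_left _ _)

lemma coarseBlock_eq_Ico (hT : 0 < T) (hn : n ≠ 0) (ν l : ℕ) {t : ℝ} (ht : 0 ≤ t) :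
    coarseBlock T n ν l t = Finset.Ico (coarseIdx T n ν l) (blockEnd T n ν l t) := by
  ext k
  simp only [coarseBlock, Finset.mem_filter, Finset.mem_Ico, gridPt_le_iff hT hn ht, blockEnd]
  omega

lemma sum_range_Ico_consecutive {M : Type*} [AddCommMonoid M] {k : ℕ → ℕ} (hk : Monotone k)
    (x : ℕ → M) (N : ℕ) :
    ∑ l ∈ Finset.range N, ∑ i ∈ Finset.Ico (k l) (k (l + 1)), x i
      = ∑ i ∈ Finset.Ico (k 0) (k N), x i := by
  induction N with
  | zero => simp
  | succ N ih =>
    rw [Finset.sum_range_succ, ih, Finset.sum_Ico_consecutive _ (hk (Nat.zero_le _))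
      (hk (Nat.le_succ _))]

/-- The blocks partition the range of summation of the weighted sums. -/
lemma sum_range_eq_sum_coarseBlock {M : Type*} [AddCommMonoid M] (hT : 0 < T) (hn : n ≠ 0)
    (hν : ν ≠ 0) {t : ℝ} (ht : 0 ≤ t) (x : ℕ → M) :
    ∑ k ∈ Finset.range (min (gridIdx T n t + 1) n), x k
      = ∑ l ∈ Finset.range ν, ∑ k ∈ coarseBlock T n ν l t, x k := by
  simp_rw [coarseBlock, Finset.sum_filter]
  rw [sum_range_Ico_consecutive (coarseIdx_mono hT n ν), coarseIdx_zero, coarseIdx_self hT hν,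
    ← Finset.sum_filter]
  refine Finset.sum_congr ?_ fun _ _ => rfl
  ext k
  simp only [Finset.mem_range, Finset.mem_filter, Finset.mem_Ico, gridPt_le_iff hT hn ht]
  omega

end Grid

lemma eLpNorm_le_of_forall_eq_zero {Ω E : Type*} [MeasurableSpace Ω] {P : Measure Ω}
    [NormedAddCommGroup E] {p c : ℝ≥0∞} {X : Ω → E} (hX : ∀ ω, X ω = 0) : eLpNorm X p P ≤ c := by
  rw [show X = 0 from funext hX, eLpNorm_zero]
  exact zero_le

/-! ### Freezing the weights on the coarse grid -/

section MainEstimate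

variable {Ω V V' : Type*} [MeasurableSpace Ω] {P : Measure Ω} {m : ℕ}
  [NormedAddCommGroup V] [InnerProductSpace ℝ V] [FiniteDimensional ℝ V]
  [NormedAddCommGroup V'] [InnerProductSpace ℝ V'] [FiniteDimensional ℝ V']

/-- The bounds on a weight `f` controlled by `B` with derivative `g`, and on the grid increments
`h`, in `L²` and with a common constant `K`. The increments over longer grid intervals are expressed
through those over single steps. -/
structure WeightBounds (P : Measure Ω) (T γ α K : ℝ) (B : ℝ → Ω → EuclideanSpace ℝ (Fin m))
    (f : ℝ → Ω → V) (g : ℝ → Ω → (EuclideanSpace ℝ (Fin m) →L[ℝ] V)) (h : ℕ → ℝ → ℝ → Ω → V') :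
    Prop where
  K_nonneg : 0 ≤ K
  B_meas : ∀ t ∈ Icc 0 T, AEStronglyMeasurable (B t) P
  f_meas : ∀ t ∈ Icc 0 T, AEStronglyMeasurable (f t) P
  g_meas : ∀ t ∈ Icc 0 T, AEStronglyMeasurable (g t) P
  h_meas : ∀ n, ∀ k < n, AEStronglyMeasurable (h n (gridPt T n k) (gridPt T n (k + 1))) P
  f_le : ∀ t ∈ Icc 0 T, eLpNorm (f t) 2 P ≤ ENNReal.ofReal K
  g_le : ∀ t ∈ Icc 0 T, eLpNorm (g t) 2 P ≤ ENNReal.ofReal K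
  ctrl : ∀ s t, 0 ≤ s → s ≤ t → t ≤ T →
    eLpNorm (fun ω => incr f s t ω - g s ω (incr B s t ω)) 2 P
      ≤ ENNReal.ofReal (K * (t - s) ^ (2 * γ))
  deriv : ∀ s t, 0 ≤ s → s ≤ t → t ≤ T →
    eLpNorm (incr g s t) 2 P ≤ ENNReal.ofReal (K * (t - s) ^ γ)
  sum_le : ∀ n i j : ℕ, i < j → j ≤ n →
    eLpNorm (fun ω => ∑ k ∈ Finset.Ico i j, h n (gridPt T n k) (gridPt T n (k + 1)) ω) 2 P
      ≤ ENNReal.ofReal (K * (gridPt T n j - gridPt T n i) ^ α)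
  int_le : ∀ n i j : ℕ, i < j → j ≤ n →
    eLpNorm (discreteIntegral T n B (h n) i j) 2 P
      ≤ ENNReal.ofReal (K * (gridPt T n j - gridPt T n i) ^ (γ + α))

variable {T γ α K : ℝ} {B : ℝ → Ω → EuclideanSpace ℝ (Fin m)} {f : ℝ → Ω → V}
  {g : ℝ → Ω → (EuclideanSpace ℝ (Fin m) →L[ℝ] V)} {h : ℕ → ℝ → ℝ → Ω → V'}

omit [FiniteDimensional ℝ V] [FiniteDimensional ℝ V'] in
lemma WeightBounds.discreteIntegral_meas (hw : WeightBounds P T γ α K B f g h) (hT : 0 < T)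
    {n i j : ℕ} (hij : i ≤ j) (hj : j ≤ n) :
    AEStronglyMeasurable (discreteIntegral T n B (h n) i j) P :=
  Finset.aestronglyMeasurable_fun_sum _ fun k hk => by
    have := Finset.mem_Ico.1 hk
    exact aestronglyMeasurable_tmul ((hw.B_meas _ (gridPt_mem hT (by omega))).sub
      (hw.B_meas _ (gridPt_mem hT (by omega)))) (hw.h_meas n k (by omega))

/-- The local expansion of the weighted sums between two points of the `n`-grid, uniformly
in `n`. -/
lemma WeightBounds.eLpNorm_expansion_le (hw : WeightBounds P T γ α K B f g h) (hT : 0 < T)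
    (hγ : 0 < γ) (hα : 0 < α) (hαγ : 1 < α + 2 * γ) {C : ℝ≥0}
    (hC : ∀ {g : Ω → EuclideanSpace ℝ (Fin m) →L[ℝ] V} {Z : Ω → EuclideanSpace ℝ (Fin m) ⊗[ℝ] V'},
      AEStronglyMeasurable g P → AEStronglyMeasurable Z P →
      eLpNorm (fun ω => tensorAct _ V V' (g ω) (Z ω)) 1 P ≤ C * (eLpNorm g 2 P * eLpNorm Z 2 P))
    {n i j : ℕ} (hij : i < j) (hj : j ≤ n) :
    eLpNorm (fun ω => ∑ k ∈ Finset.Ico i j,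
          f (gridPt T n k) ω ⊗ₜ[ℝ] h n (gridPt T n k) (gridPt T n (k + 1)) ω
        - (f (gridPt T n i) ω ⊗ₜ[ℝ] (∑ k ∈ Finset.Ico i j,
              h n (gridPt T n k) (gridPt T n (k + 1)) ω)
          + tensorAct _ V V' (g (gridPt T n i) ω) (discreteIntegral T n B (h n) i j ω))) 1 P
      ≤ ENNReal.ofReal ((1 + C) * K ^ 2 * (sewingConst (α + 2 * γ) *
          (gridPt T n j - gridPt T n i) ^ (α + 2 * γ))) := by
  have hn : 0 < n := by omega
  have hn' : (0 : ℝ) < n := by exact_mod_cast hn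
  have hle : ∀ {i j : ℕ}, i < j → gridPt T n i ≤ gridPt T n j := fun h => gridPt_mono hT n h.le
  simp only [gridPt_sub]
  exact eLpNorm_weightedSum_expansion_le (N := n) (d := T / n) hC hγ hα hαγ hw.K_nonneg
    (by positivity)
    (F := fun k => f (gridPt T n k)) (G := fun k => g (gridPt T n k))
    (β := fun k => B (gridPt T n k)) (η := fun k => h n (gridPt T n k) (gridPt T n (k + 1)))
    (fun k hk => hw.f_meas _ (gridPt_mem hT hk)) (fun k hk => hw.g_meas _ (gridPt_mem hT hk))
    (fun k hk => hw.B_meas _ (gridPt_mem hT hk)) (fun k hk => hw.h_meas n k hk)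
    (fun i j hij hj => by
      rw [← gridPt_sub]
      exact hw.ctrl _ _ (gridPt_mem hT (hij.le.trans hj)).1 (hle hij) (gridPt_mem hT hj).2)
    (fun i j hij hj => by
      rw [← gridPt_sub]
      exact hw.deriv _ _ (gridPt_mem hT (hij.le.trans hj)).1 (hle hij) (gridPt_mem hT hj).2)
    (fun i j hij hj => by
      rw [← gridPt_sub]; exact hw.sum_le n i j hij hj)
    (fun i j hij hj => by
      rw [← gridPt_sub]; exact hw.int_le n i j hij hj) hij hj

/-- Freezing the weights on the blocks of the coarse grid changes the weighted sums by an error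
that vanishes as the coarse grid gets finer, uniformly over all finer grids. -/
theorem WeightBounds.exists_eLpNorm_weightedSum_sub_le (hw : WeightBounds P T γ α K B f g h)
    (hT : 0 < T) (hγ : 0 < γ) (hα : 0 < α) (hαγ : 1 < α + 2 * γ) {κ : ℝ} (hκ : 0 < κ)
    (hκ1 : κ < α + γ) (hκ2 : 1 < α + 2 * γ - κ) {t : ℝ} (ht : t ∈ Icc 0 T)
    (hcoarse : ∀ n ν a b : ℕ, 1 ≤ n → 1 ≤ a → a < b → b ≤ ν →
      eLpNorm (fun ω => ∑ l ∈ Finset.Ico a b, blockSum T n ν l B (h n) t ω) 2 P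
        ≤ ENNReal.ofReal (K * (ν : ℝ) ^ (-κ) * (gridPt T ν b - gridPt T ν a) ^ (α + γ - κ))) :
    ∃ e : ℕ → ℝ, Tendsto e atTop (𝓝 0) ∧ ∀ n ν : ℕ, 2 ≤ ν → ν ≤ n →
      eLpNorm (fun ω => weightedSum T n f (h n) t ω - ∑ l ∈ Finset.range ν,
        f (gridPt T n (coarseIdx T n ν l)) ω ⊗ₜ[ℝ]
          (∑ k ∈ coarseBlock T n ν l t, h n (gridPt T n k) (gridPt T n (k + 1)) ω)) 1 P
        ≤ ENNReal.ofReal (e ν) := by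
  obtain ⟨C, hC⟩ := exists_eLpNorm_one_tensorAct_le (P := P) (EuclideanSpace ℝ (Fin m)) V V'
  have hK := hw.K_nonneg
  set θ := α + 2 * γ with hθ
  set δ := α + γ - κ with hδ
  have hθ0 : 0 < θ := by linarith
  have hδ0 : 0 < δ := by linarith
  have hγδ : 1 < γ + δ := by simp only [hδ]; linarith
  have hs1 := sewingConst_pos (show 1 < θ from hαγ)
  have hs2 := sewingConst_pos hγδ
  set A₁ : ℝ := (1 + C) * K ^ 2 * sewingConst θ with hA₁
  set K₂ : ℝ := K * 2 ^ γ with hK₂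
  have h2γ : (1 : ℝ) ≤ 2 ^ γ := Real.one_le_rpow (by norm_num) hγ.le
  have hKK : K ≤ K₂ := le_mul_of_one_le_right hK h2γ
  have hK₂0 : 0 ≤ K₂ := hK.trans hKK
  -- the three terms are the expansion errors of the `ν` blocks, the `g`-term of the first block
  -- (to which the coarse-grained bound does not apply), and the `g`-terms of the other blocks
  refine ⟨fun ν => ν * (A₁ * (2 * (T / ν)) ^ θ) + (C * (K * (K * (2 * (T / ν)) ^ (γ + α))) +
    C * K₂ ^ 2 * (ν : ℝ) ^ (-κ) * (sewingConst (γ + δ) * T ^ (γ + δ) + T ^ δ)), ?_, ?_⟩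
  · have hpow : ∀ {a : ℝ}, 0 < a → Tendsto (fun ν : ℕ => (ν : ℝ) ^ (-a)) atTop (𝓝 0) := fun ha =>
      (tendsto_rpow_neg_atTop ha).comp tendsto_natCast_atTop_atTop
    have h1 : Tendsto (fun ν : ℕ => (ν : ℝ) * (A₁ * (2 * (T / ν)) ^ θ)) atTop (𝓝 0) := by
      have := (hpow (show 0 < θ - 1 by linarith)).const_mul (A₁ * (2 * T) ^ θ)
      rw [mul_zero] at this
      refine this.congr' ?_
      filter_upwards [eventually_gt_atTop 0] with ν hν
      have hν' : (0 : ℝ) < ν := by exact_mod_cast hν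
      rw [show 2 * (T / (ν : ℝ)) = 2 * T / ν by ring, Real.div_rpow (by positivity) hν'.le,
        show -(θ - 1) = 1 - θ by ring, Real.rpow_sub hν', Real.rpow_one]
      ring
    have h2 : Tendsto (fun ν : ℕ => C * (K * (K * (2 * (T / (ν : ℝ))) ^ (γ + α)))) atTop (𝓝 0) := by
      have := (hpow (show 0 < γ + α by linarith)).const_mul (C * (K * (K * (2 * T) ^ (γ + α))))
      rw [mul_zero] at this
      refine this.congr' ?_
      filter_upwards [eventually_gt_atTop 0] with ν hν
      have hν' : (0 : ℝ) < ν := by exact_mod_cast hν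
      rw [show 2 * (T / (ν : ℝ)) = 2 * T / ν by ring, Real.div_rpow (by positivity) hν'.le,
        Real.rpow_neg hν'.le]
      ring
    have h3 : Tendsto (fun ν : ℕ => C * K₂ ^ 2 * (ν : ℝ) ^ (-κ) *
        (sewingConst (γ + δ) * T ^ (γ + δ) + T ^ δ)) atTop (𝓝 0) := by
      have := ((hpow hκ).const_mul (C * K₂ ^ 2)).mul_const
        (sewingConst (γ + δ) * T ^ (γ + δ) + T ^ δ)
      simpa using this
    simpa using h1.add (h2.add h3)
  · intro n ν hν hνn
    have hn : n ≠ 0 := by omega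
    have hν0 : ν ≠ 0 := by omega
    have hν' : (0 : ℝ) < ν := by exact_mod_cast Nat.pos_of_ne_zero hν0
    have hd : 0 < T / ν := by positivity
    set k : ℕ → ℕ := coarseIdx T n ν with hk
    have hkn : ∀ {l}, l ≤ ν → k l ≤ n := fun hl => coarseIdx_le hT hl
    have hkm : Monotone k := coarseIdx_mono hT n ν
    set M : ℕ → ℕ := fun l => blockEnd T n ν l t with hM
    have hMn : ∀ {l}, l < ν → M l ≤ n := fun {l} hl => (blockEnd_le hT n ν l t).trans (hkn hl)
    have hblock : ∀ l, coarseBlock T n ν l t = Finset.Ico (k l) (M l) := fun l =>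
      coarseBlock_eq_Ico hT hn ν l ht.1
    have hζ : ∀ l, blockSum T n ν l B (h n) t = discreteIntegral T n B (h n) (k l) (M l) := by
      intro l
      ext ω
      simp only [blockSum, discreteIntegral, hblock, hk]
    have hlen : ∀ {l}, l < ν → gridPt T n (M l) - gridPt T n (k l) ≤ 2 * (T / ν) := by
      intro l hl
      have h1 := gridPt_coarseIdx_sub_le hT hν0 hνn (Nat.lt_succ_self l) hl
      have h2 := gridPt_mono hT n (blockEnd_le hT n ν l t)
      push_cast at h1
      simp only [add_sub_cancel_left, one_mul] at h1
      simp only [hM, hk]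
      linarith
    have hlen0 : ∀ {l}, 0 ≤ gridPt T n (M l) - gridPt T n (k l) := fun {l} =>
      sub_nonneg.2 (gridPt_mono hT n (coarseIdx_le_blockEnd T n ν l t))
    -- the error of the expansion on each block
    set R : ℕ → Ω → V ⊗[ℝ] V' := fun l ω => ∑ i ∈ Finset.Ico (k l) (M l),
          f (gridPt T n i) ω ⊗ₜ[ℝ] h n (gridPt T n i) (gridPt T n (i + 1)) ω
        - (f (gridPt T n (k l)) ω ⊗ₜ[ℝ] (∑ i ∈ Finset.Ico (k l) (M l),
              h n (gridPt T n i) (gridPt T n (i + 1)) ω)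
          + tensorAct _ V V' (g (gridPt T n (k l)) ω)
              (discreteIntegral T n B (h n) (k l) (M l) ω)) with hR
    have hRle : ∀ l < ν, eLpNorm (R l) 1 P ≤ ENNReal.ofReal (A₁ * (2 * (T / ν)) ^ θ) := by
      intro l hl
      rcases (coarseIdx_le_blockEnd T n ν l t).eq_or_lt with he | he
      · refine eLpNorm_le_of_forall_eq_zero fun ω => ?_
        simp only [hR, hM, hk, ← he]
        simp [discreteIntegral]
      · refine (hw.eLpNorm_expansion_le hT hγ hα hαγ hC he (hMn hl)).trans ?_
        refine ENNReal.ofReal_le_ofReal ?_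
        rw [hA₁, ← mul_assoc]
        gcongr
        · exact hlen0
        · exact hlen hl
    have hDm : ∀ l < ν, AEStronglyMeasurable (blockSum T n ν l B (h n) t) P := fun l hl => by
      rw [hζ]
      exact hw.discreteIntegral_meas hT (coarseIdx_le_blockEnd T n ν l t) (hMn hl)
    have hgm : ∀ l ≤ ν, AEStronglyMeasurable (g (gridPt T n (k l))) P := fun l hl =>
      hw.g_meas _ (gridPt_mem hT (hkn hl))
    have hRm : ∀ l < ν, AEStronglyMeasurable (R l) P := by
      intro l hl
      have hm : ∀ i ∈ Finset.Ico (k l) (M l), i < n := fun i hi =>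
        (Finset.mem_Ico.1 hi).2.trans_le (hMn hl)
      refine (Finset.aestronglyMeasurable_fun_sum _ fun i hi => ?_).sub
        ((aestronglyMeasurable_tmul (hw.f_meas _ (gridPt_mem hT (hkn hl.le)))
          (Finset.aestronglyMeasurable_fun_sum _ fun i hi => hw.h_meas n i (hm i hi))).add
          (aestronglyMeasurable_tensorAct (hgm l hl.le)
            (hw.discreteIntegral_meas hT (coarseIdx_le_blockEnd T n ν l t) (hMn hl))))
      exact aestronglyMeasurable_tmul (hw.f_meas _ (gridPt_mem hT (hm i hi).le))
        (hw.h_meas n i (hm i hi))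
    have hAm : ∀ l < ν, AEStronglyMeasurable (fun ω =>
        tensorAct _ V V' (g (gridPt T n (k l)) ω) (blockSum T n ν l B (h n) t ω)) P := fun l hl =>
      aestronglyMeasurable_tensorAct (hgm l hl.le) (hDm l hl)
    have hsplit : (fun ω => weightedSum T n f (h n) t ω - ∑ l ∈ Finset.range ν,
        f (gridPt T n (k l)) ω ⊗ₜ[ℝ]
          (∑ i ∈ coarseBlock T n ν l t, h n (gridPt T n i) (gridPt T n (i + 1)) ω)) =
        (fun ω => ∑ l ∈ Finset.range ν, R l ω) +
        ((fun ω => tensorAct _ V V' (g (gridPt T n (k 0)) ω) (blockSum T n ν 0 B (h n) t ω)) +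
          fun ω => ∑ l ∈ Finset.Ico 1 ν,
            tensorAct _ V V' (g (gridPt T n (k l)) ω) (blockSum T n ν l B (h n) t ω)) := by
      ext ω
      simp only [Pi.add_apply]
      rw [show (tensorAct (EuclideanSpace ℝ (Fin m)) V V' (g (gridPt T n (k 0)) ω)
          (blockSum T n ν 0 B (h n) t ω) + ∑ l ∈ Finset.Ico 1 ν,
            tensorAct _ V V' (g (gridPt T n (k l)) ω) (blockSum T n ν l B (h n) t ω)) =
          ∑ l ∈ Finset.range ν,
            tensorAct _ V V' (g (gridPt T n (k l)) ω) (blockSum T n ν l B (h n) t ω) by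
        rw [Finset.range_eq_Ico, Finset.sum_eq_sum_Ico_succ_bot (by omega : 0 < ν)]]
      rw [weightedSum, sum_range_eq_sum_coarseBlock hT hn hν0 ht.1, ← Finset.sum_sub_distrib,
        ← Finset.sum_add_distrib]
      refine Finset.sum_congr rfl fun l _ => ?_
      simp only [hR, hblock, hζ]
      abel
    rw [hsplit]
    refine (eLpNorm_add_le (Finset.aestronglyMeasurable_fun_sum _ fun l hl =>
      hRm l (Finset.mem_range.1 hl)) ((hAm 0 (by omega)).add
        (Finset.aestronglyMeasurable_fun_sum _ fun l hl => hAm l (Finset.mem_Ico.1 hl).2))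
      le_rfl).trans ?_
    rw [ENNReal.ofReal_add (by positivity) (by positivity),
      ENNReal.ofReal_add (by positivity) (by positivity)]
    refine add_le_add ?_ ((eLpNorm_add_le (hAm 0 (by omega))
      (Finset.aestronglyMeasurable_fun_sum _ fun l hl => hAm l (Finset.mem_Ico.1 hl).2)
        le_rfl).trans (add_le_add ?_ ?_))
    · have h1 : eLpNorm (fun ω => ∑ l ∈ Finset.range ν, R l ω) 1 P
          ≤ ∑ l ∈ Finset.range ν, eLpNorm (R l) 1 P := by
        have := eLpNorm_sum_le (f := R) (s := Finset.range ν) (p := 1) (μ := P)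
          (fun l hl => hRm l (Finset.mem_range.1 hl)) le_rfl
        convert this using 2
        ext ω; simp
      refine h1.trans ((Finset.sum_le_sum fun l hl => hRle l (Finset.mem_range.1 hl)).trans ?_)
      rw [Finset.sum_const, Finset.card_range, nsmul_eq_mul,
        ENNReal.ofReal_mul (p := (ν : ℝ)) (by positivity), ENNReal.ofReal_natCast]
    · refine (hC (hgm 0 (by omega)) (hDm 0 (by omega))).trans ?_
      rw [ENNReal.ofReal_mul (by positivity), ENNReal.ofReal_coe_nnreal,
        ENNReal.ofReal_mul hK]
      gcongr
      · exact hw.g_le _ (gridPt_mem hT (hkn (by omega)))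
      · rw [hζ]
        rcases (coarseIdx_le_blockEnd T n ν 0 t).eq_or_lt with he | he
        · refine eLpNorm_le_of_forall_eq_zero fun ω => ?_
          simp [hM, hk, ← he, discreteIntegral]
        · refine (hw.int_le n _ _ he (hMn (by omega))).trans (ENNReal.ofReal_le_ofReal ?_)
          gcongr
          · exact hlen0
          · exact hlen (by omega)
    · have := eLpNorm_sum_tensorAct_le (P := P) hC hγ hδ0 hγδ hK₂0
        (show 0 ≤ (ν : ℝ) ^ (-κ) by positivity) hd (N := ν)
        (G := fun l => g (gridPt T n (k l))) (ζ := fun l => blockSum T n ν l B (h n) t)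
        hgm hDm (fun l hl => (hw.g_le _ (gridPt_mem hT (hkn hl))).trans
          (ENNReal.ofReal_le_ofReal hKK)) ?_ ?_ (by omega)
      · rwa [mul_div_cancel₀ _ hν'.ne'] at this
      · intro a b hab hb
        have hmono := gridPt_mono hT n (hkm hab.le)
        refine (hw.deriv _ _ (gridPt_mem hT (hkn (hab.le.trans hb))).1 hmono
          (gridPt_mem hT (hkn hb)).2).trans (ENNReal.ofReal_le_ofReal ?_)
        have hba : (0 : ℝ) ≤ (b : ℝ) - a := sub_nonneg.2 (by exact_mod_cast hab.le)
        rw [hK₂, mul_assoc, ← Real.mul_rpow (by norm_num) (by positivity)]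
        gcongr
        exact gridPt_coarseIdx_sub_le hT hν0 hνn hab hb
      · intro a b ha hab hb
        refine (hcoarse n ν a b (by omega) ha hab hb).trans (ENNReal.ofReal_le_ofReal ?_)
        have hba : (0 : ℝ) ≤ (b : ℝ) - a := sub_nonneg.2 (by exact_mod_cast hab.le)
        rw [gridPt_sub]
        gcongr

end MainEstimate

/-! ### Continuity of the weight in `L²` -/

section Continuity

variable {Ω : Type*} [MeasurableSpace Ω] {P : Measure Ω}

lemma eLpNorm_two_sq_eq_lintegral {E : Type*} [NormedAddCommGroup E] (X : Ω → E) :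
    (eLpNorm X 2 P) ^ 2 = ∫⁻ ω, ‖X ω‖ₑ ^ 2 ∂P := by
  rw [eLpNorm_eq_lintegral_rpow_enorm_toReal two_ne_zero ENNReal.ofNat_ne_top,
    ← ENNReal.rpow_natCast, ← ENNReal.rpow_mul]
  simp

/-- Interpolation of the `L²`-norm between the `L¹`- and the `L³`-norm. -/
lemma eLpNorm_two_sq_le_mul {E : Type*} [NormedAddCommGroup E] {X : Ω → E}
    (hX : AEStronglyMeasurable X P) :
    (eLpNorm X 2 P) ^ 2 ≤ (eLpNorm X 1 P) ^ (1 / 2 : ℝ) * (eLpNorm X 3 P) ^ (3 / 2 : ℝ) := by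
  have h := ENNReal.lintegral_mul_norm_pow_le (μ := P) (f := fun ω => ‖X ω‖ₑ)
    (g := fun ω => ‖X ω‖ₑ ^ (3 : ℝ)) hX.enorm (hX.enorm.pow_const _) (p := 1 / 2) (q := 1 / 2)
    (by norm_num) (by norm_num) (by norm_num)
  rw [eLpNorm_two_sq_eq_lintegral, eLpNorm_one_eq_lintegral_enorm,
    eLpNorm_eq_lintegral_rpow_enorm_toReal (p := 3) (by norm_num) ENNReal.ofNat_ne_top,
    ← ENNReal.rpow_mul]
  convert h using 3
  · rw [← ENNReal.rpow_mul, ← ENNReal.rpow_add_of_nonneg _ _ (by norm_num) (by norm_num),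
      ← ENNReal.rpow_natCast]
    norm_num
  · simp
  · norm_num

lemma IsFBM.memLp [IsProbabilityMeasure P] {m : ℕ} {T H : ℝ}
    {B : ℝ → Ω → EuclideanSpace ℝ (Fin m)} (hB : IsFBM T H B P) {t : ℝ} (ht : t ∈ Icc 0 T) :
    MemLp (B t) 2 P :=
  (hB.gaussian.hasGaussianLaw_eval ⟨t, ht⟩).memLp_two

lemma IsFBM.eLpNorm_incr_sq [IsProbabilityMeasure P] {m : ℕ} {T H : ℝ} (hH : 0 < H)
    {B : ℝ → Ω → EuclideanSpace ℝ (Fin m)} (hB : IsFBM T H B P) {s t : ℝ} (hs : s ∈ Icc 0 T)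
    (ht : t ∈ Icc 0 T) :
    (eLpNorm (incr B s t) 2 P) ^ 2 = ENNReal.ofReal (m * |t - s| ^ (2 * H)) := by
  have hc : ∀ {r : ℝ}, r ∈ Icc 0 T → ∀ i, MemLp (fun ω => B r ω i) 2 P := fun hr i =>
    (EuclideanSpace.proj (𝕜 := ℝ) i).comp_memLp' (hB.memLp hr)
  have hd : ∀ i, MemLp (fun ω => B t ω i - B s ω i) 2 P := fun i => (hc ht i).sub (hc hs i)
  have hm : MemLp (incr B s t) 2 P := (hB.memLp ht).sub (hB.memLp hs)
  rw [eLpNorm_two_sq_eq_ofReal hm]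
  congr 1
  have h1 : ∀ i, ∫ ω, (B t ω i - B s ω i) ^ 2 ∂P = |t - s| ^ (2 * H) := by
    intro i
    have hv := variance_fun_sub (hc ht i) (hc hs i)
    rw [variance_of_integral_eq_zero (hd i).aemeasurable,
      ← covariance_self (hc ht i).aemeasurable, ← covariance_self (hc hs i).aemeasurable,
      hB.covariance _ ht _ ht, hB.covariance _ hs _ hs, hB.covariance _ ht _ hs] at hv
    · rw [hv, abs_sub_comm s t]
      simp [Real.zero_rpow (show 2 * H ≠ 0 by positivity)]
      ring
    · change ∫ ω, (B t ω i - B s ω i) ∂P = 0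
      rw [integral_sub ((hc ht i).integrable one_le_two) ((hc hs i).integrable one_le_two),
        hB.centered _ ht, hB.centered _ hs, sub_zero]
  simp only [incr, EuclideanSpace.norm_sq_eq, Real.norm_eq_abs, sq_abs, PiLp.sub_apply]
  rw [integral_finsetSum _ fun i _ => (hd i).integrable_sq]
  simp [h1]

lemma eLpNorm_two_sq_sub_le_of_controlled {E V : Type*} [NormedAddCommGroup E] [InnerProductSpace ℝ E]
    [NormedAddCommGroup V] [InnerProductSpace ℝ V] {F F' : Ω → V} {G : Ω → E →L[ℝ] V} {β : Ω → E}
    (hF : AEStronglyMeasurable F P) (hF' : AEStronglyMeasurable F' P)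
    (hG : AEStronglyMeasurable G P) (hβ : AEStronglyMeasurable β P) {a K : ℝ≥0∞}
    (ha : eLpNorm (fun ω => F' ω - F ω - G ω (β ω)) 1 P ≤ a) (hFK : eLpNorm F 3 P ≤ K)
    (hFK' : eLpNorm F' 3 P ≤ K) (hGK : eLpNorm G 2 P ≤ K) :
    (eLpNorm (F' - F) 2 P) ^ 2 ≤
      (a + K * eLpNorm β 2 P) ^ (1 / 2 : ℝ) * (K + K) ^ (3 / 2 : ℝ) := by
  have hGβ : AEStronglyMeasurable (fun ω => G ω (β ω)) P :=
    (ContinuousLinearMap.apply ℝ V).flip.aestronglyMeasurable_comp₂ hG hβ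
  refine (eLpNorm_two_sq_le_mul (hF'.sub hF)).trans ?_
  gcongr
  · have h1 : F' - F = (fun ω => F' ω - F ω - G ω (β ω)) + fun ω => G ω (β ω) := by ext ω; simp
    rw [h1]
    refine (eLpNorm_add_le ((hF'.sub hF).sub hGβ) hGβ le_rfl).trans (add_le_add ha ?_)
    exact (eLpNorm_one_clm_apply_le hG hβ).trans (mul_le_mul_left hGK _)
  · exact (eLpNorm_sub_le hF' hF (by norm_num)).trans (add_le_add hFK' hFK)

/-- A weight controlled by a fractional Brownian motion is uniformly continuous in `L²`. -/
lemma IsFBM.exists_eLpNorm_incr_le [IsProbabilityMeasure P] {m : ℕ} {T H γ K : ℝ} (hH : 0 < H)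
    (hγ : 0 < γ) {B : ℝ → Ω → EuclideanSpace ℝ (Fin m)} (hB : IsFBM T H B P)
    {V : Type*} [NormedAddCommGroup V] [InnerProductSpace ℝ V]
    {f : ℝ → Ω → V} {g : ℝ → Ω → (EuclideanSpace ℝ (Fin m) →L[ℝ] V)}
    (hf : ∀ t ∈ Icc 0 T, AEStronglyMeasurable (f t) P)
    (hg : ∀ t ∈ Icc 0 T, AEStronglyMeasurable (g t) P)
    (hf3 : ∀ t ∈ Icc 0 T, eLpNorm (f t) 3 P ≤ ENNReal.ofReal K)
    (hg2 : ∀ t ∈ Icc 0 T, eLpNorm (g t) 2 P ≤ ENNReal.ofReal K)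
    (hctrl : ∀ s t, 0 ≤ s → s ≤ t → t ≤ T →
      eLpNorm (fun ω => incr f s t ω - g s ω (incr B s t ω)) 1 P
        ≤ ENNReal.ofReal (K * (t - s) ^ (2 * γ))) {ε : ℝ≥0∞} (hε : ε ≠ 0) :
    ∃ δ > 0, ∀ s ∈ Icc 0 T, ∀ t ∈ Icc 0 T, |t - s| ≤ δ → eLpNorm (incr f s t) 2 P ≤ ε := by
  set D : ℝ → ℝ≥0∞ := fun d => (ENNReal.ofReal (K * d ^ (2 * γ)) +
    ENNReal.ofReal K * ENNReal.ofReal (m * d ^ (2 * H)) ^ (1 / 2 : ℝ)) ^ (1 / 2 : ℝ) *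
      (ENNReal.ofReal K + ENNReal.ofReal K) ^ (3 / 2 : ℝ) with hD
  have hbound : ∀ s ∈ Icc 0 T, ∀ t ∈ Icc 0 T, s ≤ t →
      (eLpNorm (incr f s t) 2 P) ^ 2 ≤ D |t - s| := by
    intro s hs t ht hst
    have hsq : ENNReal.ofReal (m * |t - s| ^ (2 * H)) ^ (1 / 2 : ℝ) = eLpNorm (incr B s t) 2 P := by
      rw [← hB.eLpNorm_incr_sq hH hs ht, ← ENNReal.rpow_natCast, ← ENNReal.rpow_mul]
      norm_num
    have habs : |t - s| = t - s := abs_of_nonneg (sub_nonneg.2 hst)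
    simp only [hD, hsq]
    refine eLpNorm_two_sq_sub_le_of_controlled (hf s hs) (hf t ht) (hg s hs)
      ((hB.memLp ht).1.sub (hB.memLp hs).1) ?_ (hf3 s hs) (hf3 t ht) (hg2 s hs)
    rw [habs]
    exact hctrl s t hs.1 hst ht.2
  have hlim : Tendsto D (𝓝 0) (𝓝 0) := by
    have h1 : ∀ {a : ℝ}, 0 < a → Tendsto (fun d : ℝ => d ^ a) (𝓝 0) (𝓝 0) := fun {a} ha => by
      have := (Real.continuousAt_rpow_const 0 a (Or.inr ha.le)).tendsto
      rwa [Real.zero_rpow ha.ne'] at this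
    have h2 : ∀ {u : ℝ → ℝ}, Tendsto u (𝓝 0) (𝓝 0) → ∀ c : ℝ,
        Tendsto (fun d => ENNReal.ofReal (c * u d)) (𝓝 0) (𝓝 0) := fun hu c => by
      simpa using ENNReal.tendsto_ofReal (hu.const_mul c)
    have h3 : ∀ {u : ℝ → ℝ≥0∞}, Tendsto u (𝓝 0) (𝓝 0) →
        Tendsto (fun d => u d ^ (1 / 2 : ℝ)) (𝓝 0) (𝓝 0) := fun hu => by
      have := (ENNReal.continuous_rpow_const (y := 1 / 2)).tendsto 0 |>.comp hu
      simpa [Function.comp_def] using this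
    have h4 := h2 (h1 (show 0 < 2 * γ by positivity)) K
    have h5 := ENNReal.Tendsto.const_mul (a := ENNReal.ofReal K)
      (h3 (h2 (h1 (show 0 < 2 * H by positivity)) m)) (Or.inr ENNReal.ofReal_ne_top)
    have h6 := h3 (by simpa only [mul_zero, add_zero] using h4.add h5)
    have h7 := ENNReal.Tendsto.mul_const (b := (ENNReal.ofReal K + ENNReal.ofReal K) ^ (3 / 2 : ℝ))
      h6 (Or.inr (by finiteness))
    simpa only [zero_mul] using h7
  have hε2 : (0 : ℝ≥0∞) < ε ^ 2 := pos_iff_ne_zero.2 (pow_ne_zero 2 hε)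
  obtain ⟨δ, hδ, hδε⟩ := Metric.eventually_nhds_iff.1 (hlim.eventually_le_const hε2)
  have key : ∀ s ∈ Icc 0 T, ∀ t ∈ Icc 0 T, s ≤ t → |t - s| ≤ δ / 2 →
      eLpNorm (incr f s t) 2 P ≤ ε := by
    intro s hs t ht hst hd
    have := (hbound s hs t ht hst).trans (hδε (y := |t - s|) (by
      rw [Real.dist_eq, sub_zero, abs_abs]; linarith))
    exact (ENNReal.pow_le_pow_left_iff two_ne_zero).1 this
  refine ⟨δ / 2, by positivity, fun s hs t ht hd => ?_⟩
  rcases le_total s t with hst | hst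
  · exact key s hs t ht hst hd
  · have := key t ht s hs hst (by rwa [abs_sub_comm])
    rwa [show incr f t s = f s - f t from rfl, eLpNorm_sub_comm] at this

end Continuity

/-! ### Common constants -/

section Bounds

variable {Ω V V' : Type*} [MeasurableSpace Ω] {P : Measure Ω} {m : ℕ}
  [NormedAddCommGroup V] [InnerProductSpace ℝ V]
  [NormedAddCommGroup V'] [InnerProductSpace ℝ V']

/-- An increment on the grid is the sum of its increments over single steps. -/
lemma ae_eq_sum_of_additive {E : Type*} [AddCommGroup E] {T : ℝ} {n : ℕ} {h : ℝ → ℝ → Ω → E}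
    (hadd : ∀ i j k : ℕ, i ≤ j → j ≤ k → k ≤ n → ∀ᵐ ω ∂P,
      h (gridPt T n i) (gridPt T n k) ω
        = h (gridPt T n i) (gridPt T n j) ω + h (gridPt T n j) (gridPt T n k) ω)
    {i j : ℕ} (hij : i ≤ j) (hj : j ≤ n) :
    ∀ᵐ ω ∂P, h (gridPt T n i) (gridPt T n j) ω
      = ∑ k ∈ Finset.Ico i j, h (gridPt T n k) (gridPt T n (k + 1)) ω := by
  induction j, hij using Nat.le_induction with
  | base =>
    filter_upwards [hadd i i i le_rfl le_rfl hj] with ω hω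
    simpa using hω
  | succ j hij ih =>
    filter_upwards [ih (by omega), hadd i j (j + 1) hij (Nat.le_succ j) hj] with ω h1 h2
    rw [h2, h1, Finset.sum_Ico_succ_top hij]

lemma WeightBounds.mono {T γ α K K' : ℝ} {B : ℝ → Ω → EuclideanSpace ℝ (Fin m)} {f : ℝ → Ω → V}
    {g : ℝ → Ω → (EuclideanSpace ℝ (Fin m) →L[ℝ] V)} {h : ℕ → ℝ → ℝ → Ω → V'} (hT : 0 < T)
    (hw : WeightBounds P T γ α K B f g h) (hK : K ≤ K') : WeightBounds P T γ α K' B f g h where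
  K_nonneg := hw.K_nonneg.trans hK
  B_meas := hw.B_meas
  f_meas := hw.f_meas
  g_meas := hw.g_meas
  h_meas := hw.h_meas
  f_le t ht := (hw.f_le t ht).trans (ENNReal.ofReal_le_ofReal hK)
  g_le t ht := (hw.g_le t ht).trans (ENNReal.ofReal_le_ofReal hK)
  ctrl s t hs hst ht := (hw.ctrl s t hs hst ht).trans (ENNReal.ofReal_le_ofReal
    (mul_le_mul_of_nonneg_right hK (Real.rpow_nonneg (sub_nonneg.2 hst) _)))
  deriv s t hs hst ht := (hw.deriv s t hs hst ht).trans (ENNReal.ofReal_le_ofReal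
    (mul_le_mul_of_nonneg_right hK (Real.rpow_nonneg (sub_nonneg.2 hst) _)))
  sum_le n i j hij hj := (hw.sum_le n i j hij hj).trans (ENNReal.ofReal_le_ofReal
    (mul_le_mul_of_nonneg_right hK
      (Real.rpow_nonneg (sub_nonneg.2 (gridPt_mono hT n hij.le)) _)))
  int_le n i j hij hj := (hw.int_le n i j hij hj).trans (ENNReal.ofReal_le_ofReal
    (mul_le_mul_of_nonneg_right hK
      (Real.rpow_nonneg (sub_nonneg.2 (gridPt_mono hT n hij.le)) _)))

/-- Bounds in `L²` with separate constants, and with `h` additive on the grids, hold with a common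
constant. -/
lemma exists_weightBounds {T γ α : ℝ} {B : ℝ → Ω → EuclideanSpace ℝ (Fin m)} {f : ℝ → Ω → V}
    {g : ℝ → Ω → (EuclideanSpace ℝ (Fin m) →L[ℝ] V)} {h : ℕ → ℝ → ℝ → Ω → V'} (hT : 0 < T)
    (hB : ∀ t ∈ Icc 0 T, AEStronglyMeasurable (B t) P)
    (hf : ∀ t ∈ Icc 0 T, AEStronglyMeasurable (f t) P)
    (hg : ∀ t ∈ Icc 0 T, AEStronglyMeasurable (g t) P)
    (hh : ∀ n i j : ℕ, i ≤ j → j ≤ n → AEStronglyMeasurable (h n (gridPt T n i) (gridPt T n j)) P)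
    (hadd : ∀ n i j k : ℕ, i ≤ j → j ≤ k → k ≤ n → ∀ᵐ ω ∂P,
      h n (gridPt T n i) (gridPt T n k) ω
        = h n (gridPt T n i) (gridPt T n j) ω + h n (gridPt T n j) (gridPt T n k) ω)
    (hbdd : ∃ K : ℝ, ∀ t ∈ Icc 0 T,
      eLpNorm (f t) 2 P + eLpNorm (g t) 2 P ≤ ENNReal.ofReal K)
    (hctrl : ∃ K : ℝ, ∀ s t : ℝ, 0 ≤ s → s ≤ t → t ≤ T →
      eLpNorm (fun ω => incr f s t ω - g s ω (incr B s t ω)) 2 P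
        ≤ ENNReal.ofReal (K * (t - s) ^ (2 * γ)))
    (hderiv : ∃ K : ℝ, ∀ s t : ℝ, 0 ≤ s → s ≤ t → t ≤ T →
      eLpNorm (incr g s t) 2 P ≤ ENNReal.ofReal (K * (t - s) ^ γ))
    (hle : ∃ K : ℝ, ∀ n i j : ℕ, i < j → j ≤ n →
      eLpNorm (h n (gridPt T n i) (gridPt T n j)) 2 P
        ≤ ENNReal.ofReal (K * (gridPt T n j - gridPt T n i) ^ α))
    (hint : ∃ K : ℝ, ∀ n i j : ℕ, i < j → j ≤ n →
      eLpNorm (discreteIntegral T n B (h n) i j) 2 P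
        ≤ ENNReal.ofReal (K * (gridPt T n j - gridPt T n i) ^ (γ + α))) :
    ∃ K, WeightBounds P T γ α K B f g h := by
  obtain ⟨K₁, h1⟩ := hbdd
  obtain ⟨K₂, h2⟩ := hctrl
  obtain ⟨K₃, h3⟩ := hderiv
  obtain ⟨K₄, h4⟩ := hle
  obtain ⟨K₅, h5⟩ := hint
  set K := |K₁| + |K₂| + |K₃| + |K₄| + |K₅| with hK
  have := abs_nonneg K₁
  have := abs_nonneg K₂
  have := abs_nonneg K₃
  have := abs_nonneg K₄
  have := abs_nonneg K₅
  have e1 : K₁ ≤ K := by linarith [le_abs_self K₁]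
  have e2 : K₂ ≤ K := by linarith [le_abs_self K₂]
  have e3 : K₃ ≤ K := by linarith [le_abs_self K₃]
  have e4 : K₄ ≤ K := by linarith [le_abs_self K₄]
  have e5 : K₅ ≤ K := by linarith [le_abs_self K₅]
  have hmul : ∀ {L x a : ℝ}, L ≤ K → 0 ≤ x →
      ENNReal.ofReal (L * x ^ a) ≤ ENNReal.ofReal (K * x ^ a) := fun hL hx =>
    ENNReal.ofReal_le_ofReal (mul_le_mul_of_nonneg_right hL (Real.rpow_nonneg hx _))
  have hgrid : ∀ {n i j : ℕ}, i < j → 0 ≤ gridPt T n j - gridPt T n i := fun {n i j} hij =>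
    sub_nonneg.2 (gridPt_mono hT n hij.le)
  refine ⟨K, by positivity, hB, hf, hg, fun n k hk => hh n k (k + 1) (Nat.le_succ k) hk,
    fun t ht => (le_self_add.trans (h1 t ht)).trans (ENNReal.ofReal_le_ofReal e1),
    fun t ht => (le_add_self.trans (h1 t ht)).trans (ENNReal.ofReal_le_ofReal e1),
    fun s t hs hst ht => (h2 s t hs hst ht).trans (hmul e2 (sub_nonneg.2 hst)),
    fun s t hs hst ht => (h3 s t hs hst ht).trans (hmul e3 (sub_nonneg.2 hst)),
    fun n i j hij hj => ?_, fun n i j hij hj => (h5 n i j hij hj).trans (hmul e5 (hgrid hij))⟩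
  rw [← eLpNorm_congr_ae (ae_eq_sum_of_additive (hadd n) hij.le hj)]
  exact (h4 n i j hij hj).trans (hmul e4 (hgrid hij))

/-- The coarse-grained bound may be used with a smaller exponent `κ`, since the time points of
the coarse grid are at least `T / ν` apart. -/
lemma mul_rpow_neg_mul_rpow_le {T K a κ κ' : ℝ} (hT : 0 < T) (hκ : κ' ≤ κ) {ν : ℕ} {x : ℝ}
    (hν : 0 < ν) (hx : T / ν ≤ x) :
    K * (ν : ℝ) ^ (-κ) * x ^ (a - κ)
      ≤ |K| * T ^ (κ' - κ) * (ν : ℝ) ^ (-κ') * x ^ (a - κ') := by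
  have hν' : (0 : ℝ) < ν := by exact_mod_cast hν
  have hx0 : 0 < x := lt_of_lt_of_le (by positivity) hx
  have h1 : x ^ (a - κ) = x ^ (a - κ') * x ^ (κ' - κ) := by
    rw [← Real.rpow_add hx0]; ring_nf
  have h2 : x ^ (κ' - κ) ≤ T ^ (κ' - κ) * (ν : ℝ) ^ (κ - κ') := by
    have := Real.rpow_le_rpow_of_nonpos (by positivity) hx (show κ' - κ ≤ 0 by linarith)
    rwa [Real.div_rpow hT.le hν'.le, div_eq_mul_inv, ← Real.rpow_neg hν'.le, neg_sub] at this
  have h3 : (ν : ℝ) ^ (-κ') = (ν : ℝ) ^ (-κ) * (ν : ℝ) ^ (κ - κ') := by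
    rw [← Real.rpow_add hν']; ring_nf
  calc K * (ν : ℝ) ^ (-κ) * x ^ (a - κ)
      ≤ |K| * (ν : ℝ) ^ (-κ) * (x ^ (a - κ') * (T ^ (κ' - κ) * (ν : ℝ) ^ (κ - κ'))) := by
        rw [h1]
        gcongr
        exact le_abs_self K
    _ = _ := by rw [h3]; ring

end Bounds

/-- The weighted sums are close to those with weights frozen on the blocks of the coarse grid. -/
theorem exists_eLpNorm_weightedSum_sub_le {Ω V V' : Type*} [MeasurableSpace Ω] {P : Measure Ω}
    {m : ℕ} [NormedAddCommGroup V] [InnerProductSpace ℝ V] [FiniteDimensional ℝ V]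
    [NormedAddCommGroup V'] [InnerProductSpace ℝ V'] [FiniteDimensional ℝ V']
    {T γ α κ K : ℝ} {B : ℝ → Ω → EuclideanSpace ℝ (Fin m)} {f : ℝ → Ω → V}
    {g : ℝ → Ω → (EuclideanSpace ℝ (Fin m) →L[ℝ] V)} {h : ℕ → ℝ → ℝ → Ω → V'}
    (hw : WeightBounds P T γ α K B f g h)
    (hT : 0 < T) (hγ : 0 < γ) (hα : 0 < α) (hαγ : 1 < α + 2 * γ) (hκ : 0 < κ)
    {t : ℝ} (ht : t ∈ Icc 0 T)
    (hcoarse : ∃ K : ℝ, ∀ n ν a b : ℕ, 1 ≤ n → 1 ≤ a → a < b → b ≤ ν →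
      eLpNorm (fun ω => ∑ l ∈ Finset.Ico a b, blockSum T n ν l B (h n) t ω) 2 P
        ≤ ENNReal.ofReal (K * (ν : ℝ) ^ (-κ) * (gridPt T ν b - gridPt T ν a) ^ (α + γ - κ))) :
    ∃ e : ℕ → ℝ, Tendsto e atTop (𝓝 0) ∧ ∀ n ν : ℕ, 2 ≤ ν → ν ≤ n →
      eLpNorm (fun ω => weightedSum T n f (h n) t ω - ∑ l ∈ Finset.range ν,
        f (gridPt T n (coarseIdx T n ν l)) ω ⊗ₜ[ℝ]
          (∑ k ∈ coarseBlock T n ν l t, h n (gridPt T n k) (gridPt T n (k + 1)) ω)) 1 P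
        ≤ ENNReal.ofReal (e ν) := by
  obtain ⟨K', hK'⟩ := hcoarse
  -- a smaller `κ'` makes the exponents `α + γ - κ'` and `(α + γ - κ') + γ - 1` positive
  obtain ⟨κ', h0, h1, h2, h3⟩ : ∃ κ', 0 < κ' ∧ κ' ≤ κ ∧ κ' < α + γ ∧ κ' < α + 2 * γ - 1 :=
    ⟨min κ (min ((α + γ) / 2) ((α + 2 * γ - 1) / 2)),
      lt_min hκ (lt_min (by linarith) (by linarith)), min_le_left _ _,
      (min_le_right _ _).trans_lt ((min_le_left _ _).trans_lt (by linarith)),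
      (min_le_right _ _).trans_lt ((min_le_right _ _).trans_lt (by linarith))⟩
  set K₀ := |K'| * T ^ (κ' - κ) with hK₀
  refine (hw.mono hT (le_max_left K K₀)).exists_eLpNorm_weightedSum_sub_le hT hγ hα hαγ h0 h2
    (by linarith) ht fun n ν a b hn ha hab hb => (hK' n ν a b hn ha hab hb).trans
      (ENNReal.ofReal_le_ofReal ?_)
  have hν : 0 < ν := by omega
  have hν' : (0 : ℝ) < ν := by exact_mod_cast hν
  have hx : T / ν ≤ gridPt T ν b - gridPt T ν a := by
    rw [gridPt_sub]
    refine le_mul_of_one_le_left (by positivity) ?_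
    have : ((a + 1 : ℕ) : ℝ) ≤ b := by exact_mod_cast hab
    push_cast at this; linarith
  have hx0 : 0 ≤ gridPt T ν b - gridPt T ν a := le_trans (by positivity) hx
  refine (mul_rpow_neg_mul_rpow_le hT h1 hν hx).trans ?_
  gcongr
  exact le_max_right _ _

/-! ### Weights that depend on finitely many values of `B` -/

section Frozen

variable {Ω V V' : Type*} [MeasurableSpace Ω] {P : Measure Ω}
  [NormedAddCommGroup V] [InnerProductSpace ℝ V]
  [NormedAddCommGroup V'] [InnerProductSpace ℝ V']

/-- The point `u_l` of the coarse grid, stopped at `t`. -/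
noncomputable def stoppedPt (T : ℝ) (ν : ℕ) (t : ℝ) (l : ℕ) : ℝ := min (gridPt T ν l) t

lemma stoppedPt_mem {T : ℝ} (hT : 0 < T) {ν l : ℕ} (hl : l ≤ ν) {t : ℝ} (ht : t ∈ Icc 0 T) :
    stoppedPt T ν t l ∈ Icc 0 T :=
  ⟨le_min (gridPt_mem hT hl).1 ht.1, (min_le_right _ _).trans ht.2⟩

lemma gridIdx_stoppedPt {T : ℝ} (hT : 0 < T) (n ν l : ℕ) (t : ℝ) :
    gridIdx T n (stoppedPt T ν t l) = min (coarseIdx T n ν l) (gridIdx T n t) :=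
  (gridIdx_mono hT n).map_min

/-- The sums over a block and over the corresponding steps up to `η(t)` differ by at most one
term. -/
lemma sum_coarseBlock_sub_sum_Ico {E : Type*} [AddCommGroup E] {T : ℝ} (hT : 0 < T) {n : ℕ}
    (hn : n ≠ 0) (ν l : ℕ) {t : ℝ} (ht : 0 ≤ t) (x : ℕ → E) :
    ∑ k ∈ coarseBlock T n ν l t, x k - ∑ k ∈ Finset.Ico (gridIdx T n (stoppedPt T ν t l))
        (gridIdx T n (stoppedPt T ν t (l + 1))), x k
      = if gridIdx T n t ∈ Finset.Ico (coarseIdx T n ν l) (coarseIdx T n ν (l + 1))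
        then x (gridIdx T n t) else 0 := by
  have hmono := coarseIdx_mono hT n ν (Nat.le_succ l)
  rw [sub_eq_iff_eq_add, gridIdx_stoppedPt hT, gridIdx_stoppedPt hT, coarseBlock]
  simp only [gridPt_le_iff hT hn ht]
  set a := coarseIdx T n ν l
  set b := coarseIdx T n ν (l + 1)
  set J := gridIdx T n t
  split_ifs with hJ
  · have hJ' := Finset.mem_Ico.1 hJ
    rw [show (Finset.Ico a b).filter (fun k => k ≤ J) = insert J (Finset.Ico (min a J) (min b J)) by
      ext k; simp only [Finset.mem_filter, Finset.mem_Ico, Finset.mem_insert]; omega]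
    rw [Finset.sum_insert (by simp)]
  · rw [zero_add]
    refine Finset.sum_congr ?_ fun _ _ => rfl
    ext k
    simp only [Finset.mem_filter, Finset.mem_Ico] at hJ ⊢
    omega

/-- The increments of `s ↦ h_{0 η(s)}` over the coarse grid stopped at `t`, as sums of single
steps. -/
lemma ae_gridFloor_sub_eq_sum {E : Type*} [AddCommGroup E] {T : ℝ} (hT : 0 < T) {n : ℕ}
    {h : ℝ → ℝ → Ω → E}
    (hadd : ∀ i j k : ℕ, i ≤ j → j ≤ k → k ≤ n → ∀ᵐ ω ∂P,
      h (gridPt T n i) (gridPt T n k) ω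
        = h (gridPt T n i) (gridPt T n j) ω + h (gridPt T n j) (gridPt T n k) ω)
    {s u : ℝ} (hsu : s ≤ u) (hu : u ≤ T) :
    ∀ᵐ ω ∂P, h 0 (gridFloor T n u) ω - h 0 (gridFloor T n s) ω
      = ∑ k ∈ Finset.Ico (gridIdx T n s) (gridIdx T n u),
        h (gridPt T n k) (gridPt T n (k + 1)) ω := by
  have h1 := gridIdx_mono hT n hsu
  have h2 := gridIdx_le (n := n) hT hu
  filter_upwards [hadd 0 _ _ (Nat.zero_le _) h1 h2, ae_eq_sum_of_additive hadd h1 h2]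
    with ω e1 e2
  rw [gridPt_zero] at e1
  rw [gridFloor, gridFloor, e1, add_sub_cancel_left, e2]

lemma eLpNorm_one_sum_tmul_sub_le [FiniteDimensional ℝ V] [FiniteDimensional ℝ V']
    {N : ℕ} {X F : ℕ → Ω → V} {Y Y' : ℕ → Ω → V'}
    (hX : ∀ l < N, AEStronglyMeasurable (X l) P) (hF : ∀ l < N, AEStronglyMeasurable (F l) P)
    (hY : ∀ l < N, AEStronglyMeasurable (Y l) P) (hY' : ∀ l < N, AEStronglyMeasurable (Y' l) P) :
    eLpNorm (fun ω => ∑ l ∈ Finset.range N, (X l ω ⊗ₜ[ℝ] Y l ω - F l ω ⊗ₜ[ℝ] Y' l ω)) 1 P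
      ≤ ∑ l ∈ Finset.range N, (eLpNorm (X l - F l) 2 P * eLpNorm (Y l) 2 P
          + eLpNorm (F l) 2 P * eLpNorm (Y l - Y' l) 2 P) := by
  have h1 : (fun ω => ∑ l ∈ Finset.range N, (X l ω ⊗ₜ[ℝ] Y l ω - F l ω ⊗ₜ[ℝ] Y' l ω)) =
      ∑ l ∈ Finset.range N, ((fun ω => (X l - F l) ω ⊗ₜ[ℝ] Y l ω) +
        fun ω => F l ω ⊗ₜ[ℝ] (Y l - Y' l) ω) := by
    ext ω
    rw [Finset.sum_apply]
    refine Finset.sum_congr rfl fun l _ => ?_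
    simp [TensorProduct.sub_tmul, TensorProduct.tmul_sub]
  have hm1 : ∀ l < N, AEStronglyMeasurable (fun ω => (X l - F l) ω ⊗ₜ[ℝ] Y l ω) P := fun l hl =>
    aestronglyMeasurable_tmul ((hX l hl).sub (hF l hl)) (hY l hl)
  have hm2 : ∀ l < N, AEStronglyMeasurable (fun ω => F l ω ⊗ₜ[ℝ] (Y l - Y' l) ω) P := fun l hl =>
    aestronglyMeasurable_tmul (hF l hl) ((hY l hl).sub (hY' l hl))
  rw [h1]
  refine (eLpNorm_sum_le (fun l hl => (hm1 l (Finset.mem_range.1 hl)).add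
    (hm2 l (Finset.mem_range.1 hl))) le_rfl).trans (Finset.sum_le_sum fun l hl => ?_)
  have hl := Finset.mem_range.1 hl
  exact (eLpNorm_add_le (hm1 l hl) (hm2 l hl) le_rfl).trans (add_le_add
    (eLpNorm_one_tmul_le ((hX l hl).sub (hF l hl)) (hY l hl))
    (eLpNorm_one_tmul_le (hF l hl) ((hY l hl).sub (hY' l hl))))

/-- The sums with weights frozen on the blocks may be replaced by a continuous functional of
finitely many values of `(h, B)`, in which the weights `F l` approximate `f` at the coarse grid
points. -/
lemma WeightBounds.eventually_eLpNorm_weightedSum_sub_le {m : ℕ}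
    [FiniteDimensional ℝ V] [FiniteDimensional ℝ V']
    {T γ α K : ℝ} {B : ℝ → Ω → EuclideanSpace ℝ (Fin m)} {f : ℝ → Ω → V}
    {g : ℝ → Ω → (EuclideanSpace ℝ (Fin m) →L[ℝ] V)} {h : ℕ → ℝ → ℝ → Ω → V'}
    (hw : WeightBounds P T γ α K B f g h) (hT : 0 < T) (hα : 0 < α)
    (hadd : ∀ n i j k : ℕ, i ≤ j → j ≤ k → k ≤ n → ∀ᵐ ω ∂P,
      h n (gridPt T n i) (gridPt T n k) ω
        = h n (gridPt T n i) (gridPt T n j) ω + h n (gridPt T n j) (gridPt T n k) ω)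
    (hfc : ∀ ε : ℝ≥0∞, ε ≠ 0 → ∃ δ > 0, ∀ s ∈ Icc 0 T, ∀ t ∈ Icc 0 T, |t - s| ≤ δ →
      eLpNorm (incr f s t) 2 P ≤ ε)
    {t : ℝ} (ht : t ∈ Icc 0 T) {ν : ℕ} {e : ℝ≥0∞}
    (hν : ∀ n, ν ≤ n → eLpNorm (fun ω => weightedSum T n f (h n) t ω - ∑ l ∈ Finset.range ν,
        f (gridPt T n (coarseIdx T n ν l)) ω ⊗ₜ[ℝ]
          (∑ k ∈ coarseBlock T n ν l t, h n (gridPt T n k) (gridPt T n (k + 1)) ω)) 1 P ≤ e)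
    {δ : ℝ≥0∞} (hδ0 : δ ≠ 0) (hδ : δ ≠ ⊤) {F : ℕ → Ω → V}
    (hF : ∀ l < ν, AEStronglyMeasurable (F l) P)
    (hFδ : ∀ l < ν, eLpNorm (f (gridPt T ν l) - F l) 2 P ≤ δ) :
    ∀ᶠ n in atTop, eLpNorm (fun ω => weightedSum T n f (h n) t ω - ∑ l ∈ Finset.range ν,
        F l ω ⊗ₜ[ℝ] (h n 0 (gridFloor T n (stoppedPt T ν t (l + 1))) ω
          - h n 0 (gridFloor T n (stoppedPt T ν t l)) ω)) 1 P
      ≤ e + ν * (2 * δ * ENNReal.ofReal (K * T ^ α) + δ) := by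
  have hK := hw.K_nonneg
  obtain ⟨d, hd, hfd⟩ := hfc δ hδ0
  have hlim1 : Tendsto (fun n : ℕ => T / (n : ℝ)) atTop (𝓝 0) :=
    tendsto_const_div_atTop_nhds_zero_nat T
  have hlim2 : Tendsto (fun n : ℕ => (ENNReal.ofReal K + δ) *
      ENNReal.ofReal (K * (T / (n : ℝ)) ^ α)) atTop (𝓝 0) := by
    have h1 := (Real.continuousAt_rpow_const 0 α (Or.inr hα.le)).tendsto.comp hlim1
    rw [Real.zero_rpow hα.ne'] at h1
    have h2 := ENNReal.Tendsto.const_mul (a := ENNReal.ofReal K + δ)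
      (ENNReal.tendsto_ofReal (h1.const_mul K)) (Or.inr (by finiteness))
    simpa [Function.comp_def] using h2
  filter_upwards [eventually_ge_atTop ν, eventually_gt_atTop 0, hlim1.eventually_le_const hd,
    hlim2.eventually_le_const (pos_iff_ne_zero.2 hδ0)] with n hνn hn0 hnd hnδ
  have hn : n ≠ 0 := by omega
  have hn' : (0 : ℝ) < n := by exact_mod_cast hn0
  set x : ℕ → Ω → V' := fun k => h n (gridPt T n k) (gridPt T n (k + 1)) with hx
  set Y : ℕ → Ω → V' := fun l ω => ∑ k ∈ coarseBlock T n ν l t, x k ω with hY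
  set Y' : ℕ → Ω → V' := fun l ω => ∑ k ∈ Finset.Ico (gridIdx T n (stoppedPt T ν t l))
    (gridIdx T n (stoppedPt T ν t (l + 1))), x k ω with hY'
  set X : ℕ → Ω → V := fun l => f (gridPt T n (coarseIdx T n ν l)) with hX
  have hkn : ∀ {l}, l ≤ ν → coarseIdx T n ν l ≤ n := fun hl => coarseIdx_le hT hl
  have hXm : ∀ l < ν, AEStronglyMeasurable (X l) P := fun l hl =>
    hw.f_meas _ (gridPt_mem hT (hkn hl.le))
  have hYm : ∀ l < ν, AEStronglyMeasurable (Y l) P := fun l hl =>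
    Finset.aestronglyMeasurable_fun_sum _ fun k hk => hw.h_meas n k
      ((Finset.mem_Ico.1 (Finset.mem_of_mem_filter k hk)).2.trans_le (hkn hl))
  have hYm' : ∀ l < ν, AEStronglyMeasurable (Y' l) P := fun l hl =>
    Finset.aestronglyMeasurable_fun_sum _ fun k hk => hw.h_meas n k
      ((Finset.mem_Ico.1 hk).2.trans_le (gridIdx_le hT (stoppedPt_mem hT hl ht).2))
  have hYle : ∀ l < ν, eLpNorm (Y l) 2 P ≤ ENNReal.ofReal (K * T ^ α) := by
    intro l hl
    rw [hY]
    simp only [coarseBlock_eq_Ico hT hn ν l ht.1]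
    have hb : blockEnd T n ν l t ≤ n := (blockEnd_le hT n ν l t).trans (hkn hl)
    rcases (coarseIdx_le_blockEnd T n ν l t).eq_or_lt with he | he
    · exact eLpNorm_le_of_forall_eq_zero fun ω => by rw [← he]; simp
    · refine (hw.sum_le n _ _ he hb).trans (ENNReal.ofReal_le_ofReal ?_)
      have h1 := (gridPt_mem hT hb).2
      have h2 := (gridPt_mem hT (hkn hl.le)).1
      have h3 := gridPt_mono hT n he.le
      gcongr
      linarith
  have hXle : ∀ l < ν, eLpNorm (X l - F l) 2 P ≤ 2 * δ := by
    intro l hl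
    have hu := gridPt_mem hT hl.le
    have h1 := gridFloor_le hT hn hu.1
    have h2 := lt_gridFloor_add hT hn hu.1
    have h3 : gridFloor T n (gridPt T ν l) = gridPt T n (coarseIdx T n ν l) := rfl
    rw [h3] at h1 h2
    have h4 : X l - F l = incr f (gridPt T ν l) (gridPt T n (coarseIdx T n ν l)) +
        (f (gridPt T ν l) - F l) := by
      ext ω; simp [hX, incr]
    rw [h4, two_mul]
    refine (eLpNorm_add_le ((hXm l hl).sub (hw.f_meas _ hu)) ((hw.f_meas _ hu).sub (hF l hl))
      one_le_two).trans (add_le_add (hfd _ hu _ (gridPt_mem hT (hkn hl.le)) ?_) (hFδ l hl))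
    rw [abs_le]
    constructor <;> linarith
  have hFle : ∀ l < ν, eLpNorm (F l) 2 P ≤ ENNReal.ofReal K + δ := by
    intro l hl
    have hu := gridPt_mem hT hl.le
    have h4 : F l = f (gridPt T ν l) - (f (gridPt T ν l) - F l) := by ext ω; simp
    rw [h4]
    exact (eLpNorm_sub_le (hw.f_meas _ hu) ((hw.f_meas _ hu).sub (hF l hl)) one_le_two).trans
      (add_le_add (hw.f_le _ hu) (hFδ l hl))
  have hYY : ∀ l < ν, eLpNorm (Y l - Y' l) 2 P ≤ ENNReal.ofReal (K * (T / (n : ℝ)) ^ α) := by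
    intro l hl
    have h1 : ∀ ω, (Y l - Y' l) ω =
        if gridIdx T n t ∈ Finset.Ico (coarseIdx T n ν l) (coarseIdx T n ν (l + 1))
        then x (gridIdx T n t) ω else 0 := fun ω =>
      sum_coarseBlock_sub_sum_Ico hT hn ν l ht.1 (fun k => x k ω)
    by_cases hJ : gridIdx T n t ∈ Finset.Ico (coarseIdx T n ν l) (coarseIdx T n ν (l + 1))
    · have hJn : gridIdx T n t < n := (Finset.mem_Ico.1 hJ).2.trans_le (hkn hl)
      have h2 := hw.sum_le n (gridIdx T n t) (gridIdx T n t + 1) (Nat.lt_succ_self _) hJn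
      rw [gridPt_sub] at h2
      push_cast at h2
      simp only [add_sub_cancel_left, one_mul, Nat.Ico_succ_singleton, Finset.sum_singleton] at h2
      rw [show Y l - Y' l = x (gridIdx T n t) by ext ω; rw [h1, if_pos hJ]]
      exact h2
    · exact eLpNorm_le_of_forall_eq_zero fun ω => by rw [h1, if_neg hJ]
  -- the increments of `h` may be written as sums of single steps
  have hae : ∀ᵐ ω ∂P, ∀ l < ν, h n 0 (gridFloor T n (stoppedPt T ν t (l + 1))) ω
      - h n 0 (gridFloor T n (stoppedPt T ν t l)) ω = Y' l ω := by
    refine ae_all_iff.2 fun l => Filter.eventually_imp_distrib_left.2 fun hl => ?_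
    exact ae_gridFloor_sub_eq_sum hT (hadd n)
      (min_le_min_right t (gridPt_mono hT ν (Nat.le_succ l))) (stoppedPt_mem hT hl ht).2
  have hsplit : (fun ω => weightedSum T n f (h n) t ω - ∑ l ∈ Finset.range ν,
        F l ω ⊗ₜ[ℝ] (h n 0 (gridFloor T n (stoppedPt T ν t (l + 1))) ω
          - h n 0 (gridFloor T n (stoppedPt T ν t l)) ω)) =ᵐ[P]
      (fun ω => weightedSum T n f (h n) t ω - ∑ l ∈ Finset.range ν, X l ω ⊗ₜ[ℝ] Y l ω) +
        fun ω => ∑ l ∈ Finset.range ν, (X l ω ⊗ₜ[ℝ] Y l ω - F l ω ⊗ₜ[ℝ] Y' l ω) := by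
    filter_upwards [hae] with ω hω
    rw [Pi.add_apply, Finset.sum_sub_distrib, sub_add_sub_cancel]
    congr 1
    exact Finset.sum_congr rfl fun l hl => by rw [hω l (Finset.mem_range.1 hl)]
  have hm1 : AEStronglyMeasurable (fun ω => weightedSum T n f (h n) t ω -
      ∑ l ∈ Finset.range ν, X l ω ⊗ₜ[ℝ] Y l ω) P := by
    refine (Finset.aestronglyMeasurable_fun_sum _ fun k hk => ?_).sub
      (Finset.aestronglyMeasurable_fun_sum _ fun l hl => aestronglyMeasurable_tmul
        (hXm l (Finset.mem_range.1 hl)) (hYm l (Finset.mem_range.1 hl)))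
    have hk : k < n := (lt_min_iff.1 (Finset.mem_range.1 hk)).2
    exact aestronglyMeasurable_tmul (hw.f_meas _ (gridPt_mem hT hk.le)) (hw.h_meas n k hk)
  have hm2 : AEStronglyMeasurable (fun ω => ∑ l ∈ Finset.range ν,
      (X l ω ⊗ₜ[ℝ] Y l ω - F l ω ⊗ₜ[ℝ] Y' l ω)) P :=
    Finset.aestronglyMeasurable_fun_sum _ fun l hl => by
      have hl := Finset.mem_range.1 hl
      exact (aestronglyMeasurable_tmul (hXm l hl) (hYm l hl)).sub
        (aestronglyMeasurable_tmul (hF l hl) (hYm' l hl))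
  rw [eLpNorm_congr_ae hsplit]
  refine (eLpNorm_add_le hm1 hm2 le_rfl).trans (add_le_add (hν n hνn) ?_)
  refine (eLpNorm_one_sum_tmul_sub_le hXm hF hYm hYm').trans
    ((Finset.sum_le_sum (g := fun _ => 2 * δ * ENNReal.ofReal (K * T ^ α) + δ) fun l hl => ?_).trans
      (by simp [mul_add]))
  have hl := Finset.mem_range.1 hl
  exact add_le_add (mul_le_mul' (hXle l hl) (hYle l hl))
    ((mul_le_mul' (hFle l hl) (hYY l hl)).trans hnδ)

end Frozen

/-! ### The Itô integral as a limit of integrals of simple processes -/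

section ItoIntegral

variable {Ω V V' : Type*} {𝓑 : MeasurableSpace Ω} [mΩ : MeasurableSpace Ω] {P : Measure Ω}
  [IsProbabilityMeasure P] [NormedAddCommGroup V] [InnerProductSpace ℝ V]
  [NormedAddCommGroup V'] [InnerProductSpace ℝ V'] [FiniteDimensional ℝ V']
  [MeasurableSpace V'] [BorelSpace V'] {T : ℝ} {W : ℝ → Ω → V'}

omit [IsProbabilityMeasure P] [InnerProductSpace ℝ V] [FiniteDimensional ℝ V'] [BorelSpace V'] in
lemma IsBM.aestronglyMeasurable_val (hW : IsBM T W P) (h𝓑 : 𝓑 ≤ mΩ)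
    (φ : SimpleProcess (fun t => 𝓑 ⊔ pastSigma W t) T V) (i : ℕ) :
    AEStronglyMeasurable (φ.val i) P :=
  ((φ.adapted i).mono (sup_le h𝓑
    (pastSigma_le hW.measurable (φ.time_mem i).2))).aestronglyMeasurable

omit [IsProbabilityMeasure P] [InnerProductSpace ℝ V] [FiniteDimensional ℝ V'] [BorelSpace V'] in
lemma IsBM.aestronglyMeasurable_eval (hW : IsBM T W P) (h𝓑 : 𝓑 ≤ mΩ)
    (φ : SimpleProcess (fun t => 𝓑 ⊔ pastSigma W t) T V) (s : ℝ) :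
    AEStronglyMeasurable (φ.eval s) P := by
  refine Finset.aestronglyMeasurable_fun_sum _ fun i _ => ?_
  by_cases hs : s ∈ Ioc (φ.time i) (φ.time (i + 1))
  · simpa only [indicator_of_mem hs] using hW.aestronglyMeasurable_val h𝓑 φ i
  · simpa only [indicator_of_notMem hs] using aestronglyMeasurable_const

omit [IsProbabilityMeasure P] in
lemma IsBM.memLp_integral (hW : IsBM T W P) (h𝓑 : 𝓑 ≤ mΩ)
    (φ : SimpleProcess (fun t => 𝓑 ⊔ pastSigma W t) T V) {t : ℝ} (ht : t ∈ Icc 0 T) :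
    MemLp (φ.integral W t) 2 P := by
  refine memLp_finsetSum _ fun i _ => ?_
  obtain ⟨C, hC⟩ := φ.bounded i
  have h1 := hW.memLp_increment (le_min (φ.time_mem i).1 ht.1)
    (min_le_min_right t (φ.time_mono (Nat.le_succ i))) ((min_le_right _ _).trans ht.2)
  refine (h1.norm.const_mul C).mono (aestronglyMeasurable_tmul
    (hW.aestronglyMeasurable_val h𝓑 φ i) h1.1) (ae_of_all _ fun ω => ?_)
  rw [TensorProduct.norm_tmul, norm_mul, norm_norm]
  exact mul_le_mul_of_nonneg_right ((hC ω).trans (le_abs_self _)) (norm_nonneg _)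

/-- The left endpoint is a null set. The functions need not be measurable. -/
lemma setLIntegral_Icc_mono_of_Ioc {a b : ℝ} {u v : ℝ → ℝ≥0∞} (h : ∀ s ∈ Ioc a b, u s ≤ v s) :
    ∫⁻ s in Icc a b, u s ≤ ∫⁻ s in Icc a b, v s := by
  rw [← setLIntegral_congr Ioc_ae_eq_Icc, ← setLIntegral_congr Ioc_ae_eq_Icc]
  exact setLIntegral_mono' measurableSet_Ioc h

/-- The Itô integral of a process that is uniformly approximated by simple processes exists. -/
theorem IsBM.exists_isItoIntegral [FiniteDimensional ℝ V] (hW : IsBM T W P) (h𝓑 : 𝓑 ≤ mΩ)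
    (hind : Indep (pastSigma W T) 𝓑 P) {f : ℝ → Ω → V}
    (hf : ∀ s ∈ Icc 0 T, AEStronglyMeasurable (f s) P)
    (happ : ∀ ε : ℝ≥0∞, ε ≠ 0 → ∃ ψ : SimpleProcess (fun t => 𝓑 ⊔ pastSigma W t) T V,
      ∀ s ∈ Ioc 0 T, eLpNorm (fun ω => ψ.eval s ω - f s ω) 2 P ≤ ε) :
    ∃ Θ : ℝ → Ω → V ⊗[ℝ] V', IsItoIntegral (fun t => 𝓑 ⊔ pastSigma W t) T f W Θ P := by
  obtain ⟨c, hc0, hc⟩ := hW.exists_integral_norm_sq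
  have hε : ∀ j : ℕ, (2⁻¹ : ℝ≥0∞) ^ j ≠ 0 := fun j => pow_ne_zero _ (by simp)
  choose φ hφ using fun j : ℕ => happ _ (hε j)
  have hcau : ∀ t ∈ Icc 0 T, ∀ N n m : ℕ, N ≤ n → N ≤ m →
      eLpNorm ((φ n).integral W t - (φ m).integral W t) 2 P
        ≤ (ENNReal.ofReal c * (4 * ENNReal.ofReal T)) ^ (1 / 2 : ℝ) * (2⁻¹) ^ N := by
    intro t ht N n m hn hm
    have h1 := hW.eLpNorm_sq_integral_sub_le h𝓑 hind hc0 hc (φ n) (φ m) ht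
    have h2 : ∀ s ∈ Ioc 0 T, (eLpNorm (fun ω => (φ n).eval s ω - (φ m).eval s ω) 2 P) ^ 2
        ≤ (2 * 2⁻¹ ^ N) ^ 2 := by
      intro s hs
      have hfs := hf s (Ioc_subset_Icc_self hs)
      have h3 := eLpNorm_sub_le_add (hW.aestronglyMeasurable_eval h𝓑 (φ n) s) hfs
        (hW.aestronglyMeasurable_eval h𝓑 (φ m) s) one_le_two
      have h4 : ∀ {k : ℕ}, N ≤ k → (2⁻¹ : ℝ≥0∞) ^ k ≤ 2⁻¹ ^ N := fun hk =>
        pow_le_pow_right_of_le_one' (by simp) hk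
      have h5 : eLpNorm (fun ω => f s ω - (φ m).eval s ω) 2 P ≤ 2⁻¹ ^ m := by
        have := hφ m s hs
        rwa [show (fun ω => (φ m).eval s ω - f s ω) = (φ m).eval s - f s from rfl,
          eLpNorm_sub_comm] at this
      rw [two_mul]
      gcongr
      exact h3.trans (add_le_add ((hφ n s hs).trans (h4 hn)) (h5.trans (h4 hm)))
    have h6 : (eLpNorm ((φ n).integral W t - (φ m).integral W t) 2 P) ^ 2
        ≤ ENNReal.ofReal c * (4 * ENNReal.ofReal T) * (2⁻¹ ^ N) ^ 2 := by
      refine h1.trans ((mul_le_mul_right (setLIntegral_Icc_mono_of_Ioc h2) _).trans (le_of_eq ?_))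
      rw [setLIntegral_const, Real.volume_Icc, sub_zero]
      ring
    rw [← ENNReal.pow_le_pow_left_iff two_ne_zero, mul_pow]
    refine h6.trans (le_of_eq ?_)
    congr 1
    rw [← ENNReal.rpow_natCast, ← ENNReal.rpow_mul]
    norm_num
  have hlim : ∀ t ∈ Icc 0 T, ∃ Θ : Ω → V ⊗[ℝ] V', MemLp Θ 2 P ∧
      Tendsto (fun j => eLpNorm ((φ j).integral W t - Θ) 2 P) atTop (𝓝 0) := by
    intro t ht
    have : CompleteSpace (V ⊗[ℝ] V') := FiniteDimensional.complete ℝ _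
    refine Lp.cauchy_complete_eLpNorm one_le_two (fun j => hW.memLp_integral h𝓑 (φ j) ht)
      (B := fun N => ((ENNReal.ofReal c * (4 * ENNReal.ofReal T)) ^ (1 / 2 : ℝ) + 1) * (2⁻¹) ^ N)
      ?_ fun N n m hn hm => (hcau t ht N n m hn hm).trans_lt ?_
    · rw [ENNReal.tsum_mul_left, ENNReal.tsum_geometric]
      simp only [ENNReal.one_sub_inv_two, inv_inv]
      finiteness
    · have h1 : (ENNReal.ofReal c * (4 * ENNReal.ofReal T)) ^ (1 / 2 : ℝ) ≠ ⊤ := by finiteness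
      exact ENNReal.mul_lt_mul_left (hε N) (by finiteness) (ENNReal.lt_add_right h1 one_ne_zero)
  choose! Θ hΘ using hlim
  refine ⟨Θ, fun t ht => (hΘ t ht).1.1, φ, ?_, fun t ht => (hΘ t ht).2⟩
  refine tendsto_of_tendsto_of_tendsto_of_le_of_le tendsto_const_nhds
    (h := fun j : ℕ => ((2⁻¹ : ℝ≥0∞) ^ j) ^ 2 * ENNReal.ofReal T) ?_ (fun _ => zero_le) fun j => ?_
  · have h1 := ENNReal.tendsto_pow_atTop_nhds_zero_of_lt_one (r := 2⁻¹) (by simp)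
    have h2 := ENNReal.Tendsto.mul_const (b := ENNReal.ofReal T) (ENNReal.Tendsto.pow (n := 2) h1)
      (Or.inr ENNReal.ofReal_ne_top)
    simpa using h2
  · refine (setLIntegral_Icc_mono_of_Ioc (v := fun _ => ((2⁻¹ : ℝ≥0∞) ^ j) ^ 2) fun s hs => ?_).trans
      (by rw [setLIntegral_const, Real.volume_Icc, sub_zero])
    gcongr
    exact hφ j s hs

/-- The integral of a simple process that is uniformly close to `f` is close to any version of
the Itô integral of `f`. -/
theorem IsItoIntegral.eLpNorm_integral_sub_le [FiniteDimensional ℝ V] (hW : IsBM T W P)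
    (h𝓑 : 𝓑 ≤ mΩ) (hind : Indep (pastSigma W T) 𝓑 P) {c : ℝ} (hc0 : 0 ≤ c)
    (hc : ∀ a b : ℝ, 0 ≤ a → a ≤ b → b ≤ T → ∫ ω, ‖W b ω - W a ω‖ ^ 2 ∂P = c * (b - a))
    {f : ℝ → Ω → V} (hf : ∀ s ∈ Icc 0 T, AEStronglyMeasurable (f s) P)
    {Θ : ℝ → Ω → V ⊗[ℝ] V'} (hΘ : IsItoIntegral (fun t => 𝓑 ⊔ pastSigma W t) T f W Θ P)
    {ψ : SimpleProcess (fun t => 𝓑 ⊔ pastSigma W t) T V} {ε : ℝ≥0∞}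
    (hψ : ∀ s ∈ Ioc 0 T, eLpNorm (fun ω => ψ.eval s ω - f s ω) 2 P ≤ ε)
    {t : ℝ} (ht : t ∈ Icc 0 T) :
    eLpNorm (fun ω => ψ.integral W t ω - Θ t ω) 2 P
      ≤ (ENNReal.ofReal c * (4 * ENNReal.ofReal T)) ^ (1 / 2 : ℝ) * ε := by
  obtain ⟨hΘm, φ, hφf, hφΘ⟩ := hΘ
  have hsq : ∀ a b : ℝ≥0∞, (a + b) ^ 2 ≤ 4 * a ^ 2 + 4 * b ^ 2 := by
    intro a b
    rcases le_total a b with hab | hab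
    · calc (a + b) ^ 2 ≤ (b + b) ^ 2 := by gcongr
        _ = 4 * b ^ 2 := by ring
        _ ≤ _ := le_add_self
    · calc (a + b) ^ 2 ≤ (a + a) ^ 2 := by gcongr
        _ = 4 * a ^ 2 := by ring
        _ ≤ _ := le_self_add
  set u : ℕ → ℝ≥0∞ := fun j => ∫⁻ s in Icc (0 : ℝ) T,
    (eLpNorm (fun ω => (φ j).eval s ω - f s ω) 2 P) ^ 2 with hu
  have hbound : ∀ j, eLpNorm (fun ω => ψ.integral W t ω - Θ t ω) 2 P ≤
      (ENNReal.ofReal c * (4 * ENNReal.ofReal T * ε ^ 2 + 4 * u j)) ^ (1 / 2 : ℝ)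
        + eLpNorm (fun ω => (φ j).integral W t ω - Θ t ω) 2 P := by
    intro j
    refine (eLpNorm_sub_le_add (hW.memLp_integral h𝓑 ψ ht).1 (hW.memLp_integral h𝓑 (φ j) ht).1
      (hΘm t ht) one_le_two).trans (add_le_add ?_ le_rfl)
    have h1 := hW.eLpNorm_sq_integral_sub_le h𝓑 hind hc0 hc ψ (φ j) ht
    have h2 : ∀ s ∈ Ioc 0 T, (eLpNorm (fun ω => ψ.eval s ω - (φ j).eval s ω) 2 P) ^ 2
        ≤ 4 * ε ^ 2 + 4 * (eLpNorm (fun ω => (φ j).eval s ω - f s ω) 2 P) ^ 2 := by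
      intro s hs
      have h3 := eLpNorm_sub_le_add (hW.aestronglyMeasurable_eval h𝓑 ψ s)
        (hf s (Ioc_subset_Icc_self hs)) (hW.aestronglyMeasurable_eval h𝓑 (φ j) s) one_le_two
      rw [show (fun ω => f s ω - (φ j).eval s ω) = f s - (φ j).eval s from rfl,
        eLpNorm_sub_comm] at h3
      refine le_trans ?_ (hsq _ _)
      gcongr
      exact h3.trans (add_le_add (hψ s hs) le_rfl)
    have h4 : ∫⁻ s in Icc (0 : ℝ) T,
        (4 * ε ^ 2 + 4 * (eLpNorm (fun ω => (φ j).eval s ω - f s ω) 2 P) ^ 2)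
          = 4 * ENNReal.ofReal T * ε ^ 2 + 4 * u j := by
      rw [lintegral_add_left measurable_const, setLIntegral_const, Real.volume_Icc, sub_zero,
        lintegral_const_mul' _ _ (by simp)]
      ring
    rw [← ENNReal.pow_le_pow_left_iff two_ne_zero, ← ENNReal.rpow_natCast (_ ^ (1 / 2 : ℝ)),
      ← ENNReal.rpow_mul]
    norm_num only [Nat.cast_ofNat, ENNReal.rpow_one]
    refine h1.trans (mul_le_mul_right ?_ _)
    rw [← h4]
    exact setLIntegral_Icc_mono_of_Ioc h2
  have hlim : Tendsto (fun j =>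
      (ENNReal.ofReal c * (4 * ENNReal.ofReal T * ε ^ 2 + 4 * u j)) ^ (1 / 2 : ℝ)
        + eLpNorm (fun ω => (φ j).integral W t ω - Θ t ω) 2 P) atTop
      (𝓝 ((ENNReal.ofReal c * (4 * ENNReal.ofReal T * ε ^ 2)) ^ (1 / 2 : ℝ))) := by
    have h1 := ENNReal.Tendsto.const_mul (a := 4) hφf (Or.inr (by simp))
    have h2 := ENNReal.Tendsto.const_mul (a := ENNReal.ofReal c)
      (h1.const_add (4 * ENNReal.ofReal T * ε ^ 2)) (Or.inr ENNReal.ofReal_ne_top)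
    have h3 := ((ENNReal.continuous_rpow_const (y := 1 / 2)).tendsto _).comp h2
    have h4 := h3.add (hφΘ t ht)
    simpa only [mul_zero, add_zero, Function.comp_def] using h4
  refine (ge_of_tendsto' hlim hbound).trans (le_of_eq ?_)
  rw [← mul_assoc, ENNReal.mul_rpow_of_nonneg _ _ (by norm_num), ← ENNReal.rpow_natCast,
    ← ENNReal.rpow_mul]
  norm_num

end ItoIntegral

/-! ### Step processes on a uniform grid -/

section StepProcess

variable {Ω V V' : Type*} [NormedAddCommGroup V] [InnerProductSpace ℝ V]
  [NormedAddCommGroup V'] [InnerProductSpace ℝ V'] {T : ℝ}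

/-- The simple process with the bounded value `F l` on the interval `(u_l, u_{l+1}]` of the uniform
grid with `ν` steps; the values are known from the start. -/
noncomputable def stepProcess {𝒢 : ℝ → MeasurableSpace Ω} (hT : 0 < T) (ν : ℕ) (F : ℕ → Ω → V)
    (hF : ∀ l s, StronglyMeasurable[𝒢 s] (F l)) (hb : ∀ l, ∃ C : ℝ, ∀ ω, ‖F l ω‖ ≤ C) :
    SimpleProcess 𝒢 T V where
  N := ν
  time i := gridPt T ν (min i ν)
  time_mono _ _ hij := gridPt_mono hT ν (min_le_min_right ν hij)
  time_mem _ := gridPt_mem hT (min_le_right _ _)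
  val := F
  adapted l := hF l _
  bounded := hb

variable {𝒢 : ℝ → MeasurableSpace Ω} {hT : 0 < T} {ν : ℕ} {F : ℕ → Ω → V}
  {hF : ∀ l s, StronglyMeasurable[𝒢 s] (F l)} {hb : ∀ l, ∃ C : ℝ, ∀ ω, ‖F l ω‖ ≤ C}

lemma stepProcess_integral (W : ℝ → Ω → V') (t : ℝ) (ω : Ω) :
    (stepProcess hT ν F hF hb).integral W t ω = ∑ l ∈ Finset.range ν,
      F l ω ⊗ₜ[ℝ] (W (stoppedPt T ν t (l + 1)) ω - W (stoppedPt T ν t l) ω) := by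
  refine Finset.sum_congr rfl fun l hl => ?_
  have hl : l < ν := Finset.mem_range.1 hl
  simp only [stepProcess, stoppedPt, min_eq_left hl.le, min_eq_left (Nat.succ_le_of_lt hl)]

omit [InnerProductSpace ℝ V] in
lemma stepProcess_eval (hν : ν ≠ 0) {s : ℝ} (hs : s ∈ Ioc 0 T) :
    ∃ l < ν, s ∈ Ioc (gridPt T ν l) (gridPt T ν (l + 1)) ∧
      (stepProcess hT ν F hF hb).eval s = F l := by
  have hex : ∃ l, s ≤ gridPt T ν l := ⟨ν, by rw [gridPt_self hν]; exact hs.2⟩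
  classical
  set k := Nat.find hex with hk
  have hk1 : s ≤ gridPt T ν k := Nat.find_spec hex
  have hk0 : k ≠ 0 := by
    intro h0
    rw [h0, gridPt_zero] at hk1
    exact absurd hs.1 (not_lt.2 hk1)
  have hkν : k ≤ ν := Nat.find_min' hex (by rw [gridPt_self hν]; exact hs.2)
  obtain ⟨l, hl⟩ := Nat.exists_eq_succ_of_ne_zero hk0
  have hlν : l < ν := by omega
  have hsl : s ∈ Ioc (gridPt T ν l) (gridPt T ν (l + 1)) := by
    refine ⟨lt_of_not_ge (Nat.find_min hex (show l < k by omega)), ?_⟩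
    rwa [hl] at hk1
  refine ⟨l, hlν, hsl, ?_⟩
  ext ω
  have hmem : ∀ i < ν, s ∈ Ioc (gridPt T ν (min i ν)) (gridPt T ν (min (i + 1) ν)) ↔ i = l := by
    intro i hi
    rw [min_eq_left hi.le, min_eq_left (Nat.succ_le_of_lt hi)]
    constructor
    · intro h
      by_contra hne
      rcases lt_or_gt_of_ne hne with hil | hil
      · exact absurd (hsl.1.trans_le (h.2.trans (gridPt_mono hT ν hil))) (lt_irrefl _)
      · exact absurd (h.1.trans_le (hsl.2.trans (gridPt_mono hT ν hil))) (lt_irrefl _)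
    · rintro rfl
      exact hsl
  change ∑ i ∈ Finset.range ν, (Ioc (gridPt T ν (min i ν))
    (gridPt T ν (min (i + 1) ν))).indicator (fun _ => F i ω) s = _
  rw [Finset.sum_eq_single_of_mem l (Finset.mem_range.2 hlν) fun i hi hil =>
    indicator_of_notMem (fun h => hil ((hmem i (Finset.mem_range.1 hi)).1 h)) _]
  exact indicator_of_mem ((hmem l hlν).2 rfl) _

omit [InnerProductSpace ℝ V] in
/-- If `f` varies by at most `ε` over grid intervals, and the values `F l` are within `δ` of `f` at
the grid points, then the step process is within `δ + ε` of `f`. -/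
lemma eLpNorm_stepProcess_eval_sub_le [MeasurableSpace Ω] {P : Measure Ω} {f : ℝ → Ω → V}
    (hν : ν ≠ 0) (hf : ∀ s ∈ Icc 0 T, AEStronglyMeasurable (f s) P)
    (hFm : ∀ l < ν, AEStronglyMeasurable (F l) P) {δ ε : ℝ≥0∞}
    (hfF : ∀ l < ν, eLpNorm (f (gridPt T ν l) - F l) 2 P ≤ δ)
    (hfε : ∀ s ∈ Icc 0 T, ∀ t ∈ Icc 0 T, |t - s| ≤ T / ν → eLpNorm (incr f s t) 2 P ≤ ε)
    {s : ℝ} (hs : s ∈ Ioc 0 T) :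
    eLpNorm (fun ω => (stepProcess (𝒢 := 𝒢) hT ν F hF hb).eval s ω - f s ω) 2 P ≤ δ + ε := by
  obtain ⟨l, hl, hsl, he⟩ := stepProcess_eval (𝒢 := 𝒢) (hF := hF) (hb := hb) (hT := hT) hν hs
  have hs' := Ioc_subset_Icc_self hs
  have hu := gridPt_mem hT hl.le
  rw [he]
  refine (eLpNorm_sub_le_add (hFm l hl) (hf _ hu) (hf s hs') one_le_two).trans (add_le_add ?_ ?_)
  · have := hfF l hl
    rwa [eLpNorm_sub_comm] at this
  · have h1 := gridPt_sub T ν l (l + 1)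
    push_cast at h1
    simp only [add_sub_cancel_left, one_mul] at h1
    exact hfε s hs' _ hu (by rw [abs_le]; constructor <;> linarith [hsl.1, hsl.2, hs.1])

end StepProcess

/-! ### Convergence in distribution of the approximating sums -/

section Limit

open scoped BoundedContinuousFunction

lemma exists_mul_le_of_ne_zero {C ε : ℝ≥0∞} (hC : C ≠ ⊤) (hε : ε ≠ 0) :
    ∃ δ : ℝ≥0∞, δ ≠ 0 ∧ δ ≠ ⊤ ∧ C * δ ≤ ε := by
  refine ⟨min 1 (ε / (C + 1)), ?_, ((min_le_left _ _).trans_lt ENNReal.one_lt_top).ne, ?_⟩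
  · rw [← pos_iff_ne_zero, lt_min_iff]
    exact ⟨one_pos, ENNReal.div_pos hε (by finiteness)⟩
  · calc C * min 1 (ε / (C + 1)) ≤ (C + 1) * (ε / (C + 1)) :=
        mul_le_mul' le_self_add (min_le_right _ _)
      _ ≤ ε := ENNReal.mul_div_le

/-- The values of `f` at the coarse grid points are approximated by bounded continuous functions of
finitely many values of `B`. -/
lemma exists_cylinder_weights {Ω E V : Type*} [MeasurableSpace Ω] {P : Measure Ω}
    [IsProbabilityMeasure P] [NormedAddCommGroup E] [MeasurableSpace E] [BorelSpace E]
    [SecondCountableTopology E] [NormedAddCommGroup V] [NormedSpace ℝ V] [CompleteSpace V] {T : ℝ}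
    (hT : 0 < T) {B : ℝ → Ω → E} (hB : ∀ t ∈ Icc 0 T, Measurable (B t)) {f : ℝ → Ω → V}
    (hf : ∀ t ∈ Icc 0 T, AEStronglyMeasurable[pastSigma B T] (f t) P)
    (hf2 : ∀ t ∈ Icc 0 T, MemLp (f t) 2 P) (ν : ℕ) {δ : ℝ≥0∞} (hδ : δ ≠ 0) :
    ∃ (S : ℕ → Finset (Icc (0 : ℝ) T)) (G : ∀ l, (S l → E) →ᵇ V), ∀ l < ν,
      eLpNorm (f (gridPt T ν l) - fun ω => G l fun s => B s ω) 2 P ≤ δ := by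
  choose S G hSG using fun l : ℕ => exists_process_cylinder_eLpNorm_sub_le hB
    (hf _ (gridPt_mem hT (min_le_right l ν))) (hf2 _ (gridPt_mem hT (min_le_right l ν))) hδ
  refine ⟨S, G, fun l hl => ?_⟩
  have := hSG l
  rwa [min_eq_left hl.le] at this

lemma stronglyMeasurable_cylinder {Ω E V : Type*} [NormedAddCommGroup E] [MeasurableSpace E]
    [BorelSpace E] [SecondCountableTopology E] [NormedAddCommGroup V] {T : ℝ} (B : ℝ → Ω → E)
    (S : Finset (Icc (0 : ℝ) T)) (G : (S → E) →ᵇ V) :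
    StronglyMeasurable[pastSigma B T] fun ω => G fun s => B s ω := by
  have h : Measurable[pastSigma B T] fun ω (s : S) => B s ω :=
    @measurable_pi_lambda _ _ _ (pastSigma B T) _ _ fun s =>
      measurable_pastSigma s.1.2.1 s.1.2.2
  exact G.continuous.comp_stronglyMeasurable (Measurable.stronglyMeasurable h)

/-- Joint convergence in distribution of the approximating sums and of `B`: they are continuous
functions of finitely many values of `(h, B)`. -/
lemma TendstoFDD.tendstoInDistribution_sum_tmul {Ω Ω' E V V' : Type*} [MeasurableSpace Ω]
    [MeasurableSpace Ω'] {P : Measure Ω} [IsProbabilityMeasure P] {P' : Measure Ω'}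
    [IsProbabilityMeasure P'] [NormedAddCommGroup E] [MeasurableSpace E] [BorelSpace E]
    [SecondCountableTopology E]
    [NormedAddCommGroup V] [InnerProductSpace ℝ V] [FiniteDimensional ℝ V]
    [NormedAddCommGroup V'] [InnerProductSpace ℝ V'] [FiniteDimensional ℝ V']
    [MeasurableSpace V'] [BorelSpace V'] {T : ℝ} (hT : 0 < T) {A : ℕ → ℝ → Ω → V'} {B : ℝ → Ω → E}
    {W : ℝ → Ω' → V'} {B' : ℝ → Ω' → E}
    (hconv : TendstoFDD T (fun n t ω => (A n t ω, B t ω)) P (fun t ω => (W t ω, B' t ω)) P')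
    (ν : ℕ) (S : ℕ → Finset (Icc (0 : ℝ) T)) (G : ∀ l, (S l → E) →ᵇ V) {N : ℕ}
    (r : Fin N → Icc (0 : ℝ) T) :
    TendstoInDistribution
      (fun n ω i => (∑ l ∈ Finset.range ν, (G l fun s => B s ω) ⊗ₜ[ℝ]
        (A n (stoppedPt T ν (r i) (l + 1)) ω - A n (stoppedPt T ν (r i) l) ω), B (r i) ω)) atTop
      (fun ω i => (∑ l ∈ Finset.range ν, (G l fun s => B' s ω) ⊗ₜ[ℝ]
        (W (stoppedPt T ν (r i) (l + 1)) ω - W (stoppedPt T ν (r i) l) ω), B' (r i) ω))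
      (fun _ => P) P' := by
  let ρ : (Fin N × Fin (ν + 1)) ⊕ (Σ l : Fin ν, S l) ⊕ Fin N → Icc (0 : ℝ) T :=
    Sum.elim (fun p => ⟨stoppedPt T ν (r p.1) p.2, stoppedPt_mem hT (Nat.lt_succ_iff.1 p.2.2)
      (r p.1).2⟩) (Sum.elim (fun p => p.2.1) r)
  have h := (hconv.tendstoInDistribution ρ).continuous_comp
    (F := Fin N → (V ⊗[ℝ] V') × E)
    (g := fun x i => (∑ l : Fin ν, (G l fun s => (x (Sum.inr (Sum.inl ⟨l, s⟩))).2) ⊗ₜ[ℝ]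
        ((x (Sum.inl (i, l.succ))).1 - (x (Sum.inl (i, l.castSucc))).1),
        (x (Sum.inr (Sum.inr i))).2)) (by
      refine continuous_pi fun i => Continuous.prodMk ?_ (by fun_prop)
      refine continuous_finsetSum _ fun l _ => ?_
      have h1 : Continuous fun p : V × V' => p.1 ⊗ₜ[ℝ] p.2 := TensorProduct.continuous_tmul
      refine h1.comp (Continuous.prodMk ((G l).continuous.comp (by fun_prop)) (by fun_prop)))
  simp only [Finset.sum_range]
  exact h

/-- For families of pairs with the same second components, the `L¹` distance is at most the sum of
the `L¹` distances of the first components. -/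
lemma eLpNorm_one_pi_prod_sub_le {Ω A E ι : Type*} [Fintype ι] [MeasurableSpace Ω] {P : Measure Ω}
    [NormedAddCommGroup A] [NormedAddCommGroup E] {x y : ι → Ω → A} {b : ι → Ω → E}
    (hx : ∀ i, AEStronglyMeasurable (x i) P) (hy : ∀ i, AEStronglyMeasurable (y i) P) :
    eLpNorm (fun ω => (fun i => (x i ω, b i ω)) - fun i => (y i ω, b i ω)) 1 P
      ≤ ∑ i, eLpNorm (fun ω => x i ω - y i ω) 1 P := by
  have hm : ∀ i, AEStronglyMeasurable (fun ω => x i ω - y i ω) P := fun i => (hx i).sub (hy i)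
  simp_rw [eLpNorm_one_eq_lintegral_enorm]
  rw [← lintegral_finsetSum' _ fun i _ => (hm i).enorm]
  refine lintegral_mono fun ω => ?_
  rw [← ofReal_norm]
  simp_rw [← ofReal_norm]
  rw [← ENNReal.ofReal_sum_of_nonneg fun i _ => norm_nonneg _]
  refine ENNReal.ofReal_le_ofReal ((pi_norm_le_iff_of_nonneg
    (Finset.sum_nonneg fun i _ => norm_nonneg _)).2 fun i => ?_)
  simp only [Pi.sub_apply, Prod.mk_sub_mk, sub_self, Prod.norm_mk, norm_zero]
  rw [max_eq_left (norm_nonneg _)]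
  exact Finset.single_le_sum (f := fun i => ‖x i ω - y i ω‖) (fun i _ => norm_nonneg _)
    (Finset.mem_univ i)

lemma WeightBounds.aestronglyMeasurable_weightedSum {Ω V V' : Type*} [MeasurableSpace Ω]
    {P : Measure Ω} {m : ℕ} [NormedAddCommGroup V] [InnerProductSpace ℝ V]
    [NormedAddCommGroup V'] [InnerProductSpace ℝ V']
    {T γ α K : ℝ} {B : ℝ → Ω → EuclideanSpace ℝ (Fin m)} {f : ℝ → Ω → V}
    {g : ℝ → Ω → (EuclideanSpace ℝ (Fin m) →L[ℝ] V)} {h : ℕ → ℝ → ℝ → Ω → V'}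
    (hw : WeightBounds P T γ α K B f g h) (hT : 0 < T) (n : ℕ) (t : ℝ) :
    AEStronglyMeasurable (weightedSum T n f (h n) t) P :=
  Finset.aestronglyMeasurable_fun_sum _ fun k hk => by
    have hk : k < n := (lt_min_iff.1 (Finset.mem_range.1 hk)).2
    exact aestronglyMeasurable_tmul (hw.f_meas _ (gridPt_mem hT hk.le)) (hw.h_meas n k hk)

end Limit

/-! ### Convergence to the Itô integral -/

section Conclusion

open scoped BoundedContinuousFunction

variable {Ω Ω' E V V' : Type*} [MeasurableSpace Ω] [MeasurableSpace Ω']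
  {P : Measure Ω} [IsProbabilityMeasure P] {P' : Measure Ω'} [IsProbabilityMeasure P']
  [NormedAddCommGroup E] [MeasurableSpace E] [BorelSpace E] [SecondCountableTopology E]
  [NormedAddCommGroup V] [InnerProductSpace ℝ V] [FiniteDimensional ℝ V]
  [NormedAddCommGroup V'] [InnerProductSpace ℝ V'] [FiniteDimensional ℝ V']
  [MeasurableSpace V'] [BorelSpace V'] {T : ℝ} {B : ℝ → Ω → E} {f : ℝ → Ω → V} {π : Ω' → Ω}
  {W : ℝ → Ω' → V'}

omit [IsProbabilityMeasure P] [IsProbabilityMeasure P'] [FiniteDimensional ℝ V]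
  [FiniteDimensional ℝ V'] [BorelSpace V'] in
/-- Cylinder functions of `B` that are close to `f` at the grid points define, on the extended
probability space, a simple process that is close to `f`. -/
lemma exists_simpleProcess_of_cylinder (hT : 0 < T) (hB : ∀ t ∈ Icc 0 T, Measurable (B t))
    (hf : ∀ t ∈ Icc 0 T, AEStronglyMeasurable (f t) P) (hπ : MeasurePreserving π P' P)
    {ν : ℕ} (hν : ν ≠ 0) (S : ℕ → Finset (Icc (0 : ℝ) T)) (G : ∀ l, (S l → E) →ᵇ V) {δ ε : ℝ≥0∞}
    (hG : ∀ l < ν, eLpNorm (f (gridPt T ν l) - fun ω => G l fun s => B s ω) 2 P ≤ δ)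
    (hε : ∀ s ∈ Icc 0 T, ∀ t ∈ Icc 0 T, |t - s| ≤ T / ν → eLpNorm (incr f s t) 2 P ≤ ε) :
    ∃ ψ : SimpleProcess
        (fun t => pastSigma (fun t ω' => B t (π ω')) T ⊔ pastSigma W t) T V,
      (∀ t ω', ψ.integral W t ω' = ∑ l ∈ Finset.range ν, (G l fun s => B s (π ω')) ⊗ₜ[ℝ]
        (W (stoppedPt T ν t (l + 1)) ω' - W (stoppedPt T ν t l) ω')) ∧
      ∀ s ∈ Ioc 0 T, eLpNorm (fun ω' => ψ.eval s ω' - f s (π ω')) 2 P' ≤ δ + ε := by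
  have hF : ∀ (l : ℕ) (s : ℝ), StronglyMeasurable[pastSigma (fun t ω' => B t (π ω')) T ⊔
      pastSigma W s] fun ω' => G l fun s => B s (π ω') := fun l s =>
    (stronglyMeasurable_cylinder (fun t ω' => B t (π ω')) (S l) (G l)).mono le_sup_left
  have hb : ∀ l, ∃ C : ℝ, ∀ ω', ‖G l fun s => B s (π ω')‖ ≤ C := fun l =>
    ⟨‖G l‖, fun ω' => (G l).norm_coe_le_norm _⟩
  have hGm : ∀ l, AEStronglyMeasurable (fun ω => G l fun s => B s ω) P := fun l =>
    ((stronglyMeasurable_cylinder B (S l) (G l)).mono (pastSigma_le hB le_rfl)).aestronglyMeasurable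
  refine ⟨stepProcess hT ν _ hF hb, fun t ω' => stepProcess_integral W t ω', fun s hs => ?_⟩
  refine eLpNorm_stepProcess_eval_sub_le (f := fun t ω' => f t (π ω')) hν
    (fun s hs => (hf s hs).comp_measurePreserving hπ)
    (fun l _ => (hGm l).comp_measurePreserving hπ) (fun l hl => ?_) (fun s hs t ht hst => ?_) hs
  · exact (eLpNorm_comp_measurePreserving ((hf _ (gridPt_mem hT hl.le)).sub (hGm l)) hπ).le.trans
      (hG l hl)
  · exact (eLpNorm_comp_measurePreserving ((hf t ht).sub (hf s hs)) hπ).le.trans (hε s hs t ht hst)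

/-- The Itô integral of `f` exists. -/
lemma exists_isItoIntegral_of_continuous (hT : 0 < T) (hB : ∀ t ∈ Icc 0 T, Measurable (B t))
    (hf : ∀ t ∈ Icc 0 T, AEStronglyMeasurable[pastSigma B T] (f t) P)
    (hf2 : ∀ t ∈ Icc 0 T, MemLp (f t) 2 P)
    (hfc : ∀ ε : ℝ≥0∞, ε ≠ 0 → ∃ δ > 0, ∀ s ∈ Icc 0 T, ∀ t ∈ Icc 0 T, |t - s| ≤ δ →
      eLpNorm (incr f s t) 2 P ≤ ε)
    (hπ : MeasurePreserving π P' P) (hW : IsBM T W P')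
    (hWB : Indep (pastSigma W T) (pastSigma (fun t ω' => B t (π ω')) T) P') :
    ∃ Θ : ℝ → Ω' → V ⊗[ℝ] V', IsItoIntegral
      (fun t => pastSigma (fun t ω' => B t (π ω')) T ⊔ pastSigma W t) T
      (fun t ω' => f t (π ω')) W Θ P' := by
  refine hW.exists_isItoIntegral
    (pastSigma_le (fun t ht => (hB t ht).comp hπ.measurable) le_rfl) hWB
    (fun s hs => (hf2 s hs).1.comp_measurePreserving hπ) fun ε hε => ?_
  have hε2 : ε / 2 ≠ 0 := (ENNReal.half_pos hε).ne'
  obtain ⟨d, hd, hfd⟩ := hfc _ hε2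
  obtain ⟨ν, hν, hν0⟩ := (((tendsto_const_div_atTop_nhds_zero_nat T).eventually_le_const hd).and
    (eventually_ne_atTop 0)).exists
  obtain ⟨S, G, hG⟩ := exists_cylinder_weights hT hB hf hf2 ν hε2
  obtain ⟨ψ, -, hψ⟩ := exists_simpleProcess_of_cylinder (W := W) hT hB (fun t ht => (hf2 t ht).1)
    hπ hν0 S G hG fun s hs t ht hst => hfd s hs t ht (hst.trans hν)
  exact ⟨ψ, fun s hs => (hψ s hs).trans (ENNReal.add_halves ε).le⟩

/-- If the sums `Y n t` are approximated by sums with weights frozen on a coarse grid, then they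
converge, jointly with `B`, to the Itô integral. -/
theorem tendstoFDD_of_frozen_approx (hT : 0 < T) (hB : ∀ t ∈ Icc 0 T, Measurable (B t))
    (hf : ∀ t ∈ Icc 0 T, AEStronglyMeasurable[pastSigma B T] (f t) P)
    (hf2 : ∀ t ∈ Icc 0 T, MemLp (f t) 2 P)
    (hfc : ∀ ε : ℝ≥0∞, ε ≠ 0 → ∃ δ > 0, ∀ s ∈ Icc 0 T, ∀ t ∈ Icc 0 T, |t - s| ≤ δ →
      eLpNorm (incr f s t) 2 P ≤ ε)
    (hπ : MeasurePreserving π P' P) (hW : IsBM T W P')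
    (hWB : Indep (pastSigma W T) (pastSigma (fun t ω' => B t (π ω')) T) P')
    {A : ℕ → ℝ → Ω → V'}
    (hconv : TendstoFDD T (fun n t ω => (A n t ω, B t ω)) P (fun t ω' => (W t ω', B t (π ω'))) P')
    {Y : ℕ → ℝ → Ω → V ⊗[ℝ] V'} (hY : ∀ n, ∀ t ∈ Icc 0 T, AEStronglyMeasurable (Y n t) P)
    (happ : ∀ t ∈ Icc 0 T, ∃ (e : ℕ → ℝ≥0∞) (C : ℝ≥0∞), Tendsto e atTop (𝓝 0) ∧ C ≠ ⊤ ∧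
      ∀ ν, 2 ≤ ν → ∀ δ : ℝ≥0∞, δ ≠ 0 → δ ≠ ⊤ → ∀ F : ℕ → Ω → V,
        (∀ l < ν, AEStronglyMeasurable (F l) P) →
        (∀ l < ν, eLpNorm (f (gridPt T ν l) - F l) 2 P ≤ δ) →
        ∀ᶠ n in atTop, eLpNorm (fun ω => Y n t ω - ∑ l ∈ Finset.range ν, F l ω ⊗ₜ[ℝ]
          (A n (stoppedPt T ν t (l + 1)) ω - A n (stoppedPt T ν t l) ω)) 1 P
            ≤ e ν + ν * (C * δ))
    {Θ : ℝ → Ω' → V ⊗[ℝ] V'}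
    (hΘ : IsItoIntegral (fun t => pastSigma (fun t ω' => B t (π ω')) T ⊔ pastSigma W t) T
      (fun t ω' => f t (π ω')) W Θ P') :
    TendstoFDD T (fun n t ω => (Y n t ω, B t ω)) P (fun t ω' => (Θ t ω', B t (π ω'))) P' := by
  intro N r
  obtain ⟨c, hc0, hc⟩ := hW.exists_integral_norm_sq
  have h𝓑 : pastSigma (fun t ω' => B t (π ω')) T ≤ ‹MeasurableSpace Ω'› :=
    pastSigma_le (fun t ht => (hB t ht).comp hπ.measurable) le_rfl
  choose e C he hC hYe using fun i : Fin N => happ (r i) (r i).2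
  refine tendstoInDistribution_of_approx
    (fun n => aemeasurable_pi_lambda _ fun i => (hY n _ (r i).2).aemeasurable.prodMk
      (hB _ (r i).2).aemeasurable)
    (aemeasurable_pi_lambda _ fun i => (hΘ.1 _ (r i).2).aemeasurable.prodMk
      ((hB _ (r i).2).comp hπ.measurable).aemeasurable) fun ε hε => ?_
  obtain ⟨ε', hε'0, -, hε'⟩ := exists_mul_le_of_ne_zero (C := (N : ℝ≥0∞))
    (ENNReal.natCast_ne_top N) (ENNReal.ofReal_pos.2 hε).ne'
  have hε'2 : ε' / 2 ≠ 0 := (ENNReal.half_pos hε'0).ne'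
  -- first `ε₁`, which controls the Itô integrals through the isometry, then the coarse grid with
  -- mesh so small that `f` varies by at most `ε₁`, and last `δ`, which may depend on the grid
  set L : ℝ≥0∞ := (ENNReal.ofReal c * (4 * ENNReal.ofReal T)) ^ (1 / 2 : ℝ) with hL
  obtain ⟨ε₁, hε₁0, hε₁t, hε₁⟩ := exists_mul_le_of_ne_zero (C := L * 2) (ε := ε')
    (by simp only [hL]; finiteness) hε'0
  obtain ⟨d, hd, hfd⟩ := hfc _ hε₁0
  obtain ⟨ν, hνd, hν2, hνe⟩ := (((tendsto_const_div_atTop_nhds_zero_nat T).eventually_le_const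
    hd).and ((eventually_ge_atTop 2).and (eventually_all.2 fun i =>
      (he i).eventually_le_const (pos_iff_ne_zero.2 hε'2)))).exists
  obtain ⟨δ₀, hδ₀0, -, hδ₀⟩ := exists_mul_le_of_ne_zero (C := (ν : ℝ≥0∞) * ∑ i, C i)
    (ENNReal.mul_ne_top (ENNReal.natCast_ne_top ν) (ENNReal.sum_ne_top.2 fun i _ => hC i)) hε'2
  set δ := min δ₀ ε₁ with hδ
  have hδ0 : δ ≠ 0 := (lt_min (pos_iff_ne_zero.2 hδ₀0) (pos_iff_ne_zero.2 hε₁0)).ne'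
  have hδt : δ ≠ ⊤ := ((min_le_right _ _).trans_lt hε₁t.lt_top).ne
  obtain ⟨S, G, hG⟩ := exists_cylinder_weights hT hB hf hf2 ν hδ0
  obtain ⟨ψ, hψi, hψ⟩ := exists_simpleProcess_of_cylinder (W := W) hT hB
    (fun t ht => (hf2 t ht).1) hπ (by omega) S G hG
    fun s hs t ht hst => hfd s hs t ht (hst.trans hνd)
  have hGm : ∀ l, AEStronglyMeasurable (fun ω => G l fun s => B s ω) P := fun l =>
    ((stronglyMeasurable_cylinder B (S l) (G l)).mono (pastSigma_le hB le_rfl)).aestronglyMeasurable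
  have hdist := hconv.tendstoInDistribution_sum_tmul hT ν S G r
  refine ⟨_, _, hdist, ?_, ?_⟩
  · have hAm : ∀ n (i : Fin N), AEStronglyMeasurable (fun ω => ∑ l ∈ Finset.range ν,
        (G l fun s => B s ω) ⊗ₜ[ℝ] (A n (stoppedPt T ν (r i) (l + 1)) ω -
          A n (stoppedPt T ν (r i) l) ω)) P := fun n i =>
      (aemeasurable_pi_iff.1 (hdist.forall_aemeasurable n) i).fst.aestronglyMeasurable
    filter_upwards [eventually_all.2 fun i => hYe i ν hν2 δ hδ0 hδt
      (fun l ω => G l fun s => B s ω) (fun l _ => hGm l) hG] with n hn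
    refine (eLpNorm_one_pi_prod_sub_le (fun i => hY n _ (r i).2) (hAm n)).trans
      ((Finset.sum_le_sum (g := fun _ => ε') fun i _ => (hn i).trans ?_).trans
        (by simpa using hε'))
    rw [← ENNReal.add_halves ε']
    refine add_le_add (hνe i) (le_trans ?_ hδ₀)
    rw [← mul_assoc]
    gcongr
    · exact Finset.single_le_sum (f := C) (fun _ _ => zero_le) (Finset.mem_univ i)
    · exact min_le_left _ _
  · have hψm : ∀ i : Fin N, AEStronglyMeasurable (fun ω' => ∑ l ∈ Finset.range ν,
        (G l fun s => B s (π ω')) ⊗ₜ[ℝ] (W (stoppedPt T ν (r i) (l + 1)) ω' -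
          W (stoppedPt T ν (r i) l) ω')) P' := fun i => by
      simp_rw [← hψi]
      exact (hW.memLp_integral h𝓑 ψ (r i).2).1
    refine (eLpNorm_one_pi_prod_sub_le (fun i => hΘ.1 _ (r i).2) hψm).trans
      ((Finset.sum_le_sum (g := fun _ => ε') fun i _ => ?_).trans (by simpa using hε'))
    refine (eLpNorm_le_eLpNorm_of_exponent_le one_le_two
      ((hΘ.1 _ (r i).2).sub (hψm i))).trans ?_
    have h1 := hΘ.eLpNorm_integral_sub_le hW h𝓑 hWB hc0 hc
      (fun s hs => (hf2 s hs).1.comp_measurePreserving hπ) hψ (r i).2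
    simp_rw [hψi] at h1
    refine (eLpNorm_sub_comm (Θ (r i)) _ 2 P').le.trans (h1.trans (le_trans ?_ hε₁))
    rw [mul_assoc, two_mul]
    gcongr
    exact min_le_right _ _

end Conclusion

end WeightedSums

open WeightedSums

theorem theorem4p9
    {Ω Ω' : Type*} [MeasurableSpace Ω] [MeasurableSpace Ω']
    (P : Measure Ω) [IsProbabilityMeasure P] (P' : Measure Ω') [IsProbabilityMeasure P']
    {m : ℕ} {V V' : Type*}
    [NormedAddCommGroup V] [InnerProductSpace ℝ V] [FiniteDimensional ℝ V]
    [NormedAddCommGroup V'] [InnerProductSpace ℝ V'] [FiniteDimensional ℝ V']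
    [MeasurableSpace V'] [BorelSpace V']
    (T H γ α κ : ℝ) (hT : 0 < T) (hH0 : 0 < H) (hH1 : H < 1)
    (hγ : 0 < γ) (hα : 0 < α) (hαγ : 1 < α + 2 * γ) (hκ : 0 < κ)
    -- the fractional Brownian motion
    (B : ℝ → Ω → EuclideanSpace ℝ (Fin m)) (hB : WeightedSums.IsFBM T H B P)
    -- the weight `f`, a functional of `B`, and its derivative `g`
    (f : ℝ → Ω → V) (g : ℝ → Ω → (EuclideanSpace ℝ (Fin m) →L[ℝ] V))
    (hf_meas : ∀ t ∈ Icc (0 : ℝ) T, AEStronglyMeasurable[WeightedSums.pastSigma B T] (f t) P)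
    (hg_meas : ∀ t ∈ Icc (0 : ℝ) T, AEStronglyMeasurable (g t) P)
    -- `f` is controlled by `B`
    (h_bdd : ∀ p : ℝ≥0, 1 ≤ p → ∃ K : ℝ, ∀ t ∈ Icc (0 : ℝ) T,
      eLpNorm (f t) p P + eLpNorm (g t) p P ≤ ENNReal.ofReal K)
    (h_ctrl : ∀ p : ℝ≥0, 1 ≤ p → ∃ K : ℝ, ∀ s t : ℝ, 0 ≤ s → s ≤ t → t ≤ T →
      eLpNorm (fun ω => WeightedSums.incr f s t ω - g s ω (WeightedSums.incr B s t ω)) p P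
        ≤ ENNReal.ofReal (K * (t - s) ^ (2 * γ)))
    (h_deriv : ∀ p : ℝ≥0, 1 ≤ p → ∃ K : ℝ, ∀ s t : ℝ, 0 ≤ s → s ≤ t → t ≤ T →
      eLpNorm (WeightedSums.incr g s t) p P ≤ ENNReal.ofReal (K * (t - s) ^ γ))
    -- the increments `h = hⁿ`, additive on the `n`-grid
    (h : ℕ → ℝ → ℝ → Ω → V')
    (hh_meas : ∀ n i j : ℕ, i ≤ j → j ≤ n →
      AEStronglyMeasurable (h n (WeightedSums.gridPt T n i) (WeightedSums.gridPt T n j)) P)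
    (hh_add : ∀ n i j k : ℕ, i ≤ j → j ≤ k → k ≤ n →
      ∀ᵐ ω ∂P, h n (WeightedSums.gridPt T n i) (WeightedSums.gridPt T n k) ω =
        h n (WeightedSums.gridPt T n i) (WeightedSums.gridPt T n j) ω +
        h n (WeightedSums.gridPt T n j) (WeightedSums.gridPt T n k) ω)
    (hh_bdd : ∀ p : ℝ≥0, 1 ≤ p → ∃ K : ℝ, ∀ n i j : ℕ, i < j → j ≤ n →
      eLpNorm (h n (WeightedSums.gridPt T n i) (WeightedSums.gridPt T n j)) p P
        ≤ ENNReal.ofReal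
            (K * (WeightedSums.gridPt T n j - WeightedSums.gridPt T n i) ^ α))
    (hh_int : ∀ p : ℝ≥0, 1 ≤ p → ∃ K : ℝ, ∀ n i j : ℕ, i < j → j ≤ n →
      eLpNorm (WeightedSums.discreteIntegral T n B (h n) i j) p P
        ≤ ENNReal.ofReal
            (K * (WeightedSums.gridPt T n j - WeightedSums.gridPt T n i) ^ (γ + α)))
    -- the Brownian motion `W`, independent of `B`, on an extension `π : Ω' → Ω` of `Ω`
    (π : Ω' → Ω) (hπ : MeasurePreserving π P' P)
    (W : ℝ → Ω' → V') (hW : WeightedSums.IsBM T W P')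
    (hWB : Indep (WeightedSums.pastSigma W T)
      (WeightedSums.pastSigma (fun t ω' => B t (π ω')) T) P')
    -- the convergence of `(h, B)` to `(W, B)`
    (h_conv : WeightedSums.TendstoFDD T
      (fun n t ω => (h n 0 (WeightedSums.gridFloor T n t) ω, B t ω)) P
      (fun t ω' => (W t ω', B t (π ω'))) P')
    -- the coarse-grained condition
    (h_coarse : ∀ t ∈ Icc (0 : ℝ) T, ∀ p : ℝ≥0, 1 ≤ p → ∃ K : ℝ,
      ∀ n ν a b : ℕ, 1 ≤ n → 1 ≤ a → a < b → b ≤ ν →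
        eLpNorm (fun ω => ∑ l ∈ Finset.Ico a b, WeightedSums.blockSum T n ν l B (h n) t ω) p P
          ≤ ENNReal.ofReal (K * (ν : ℝ) ^ (-κ) *
              (WeightedSums.gridPt T ν b - WeightedSums.gridPt T ν a) ^ (α + γ - κ))) :
    (∃ Θ : ℝ → Ω' → V ⊗[ℝ] V', WeightedSums.IsItoIntegral
      (fun t => WeightedSums.pastSigma (fun t ω' => B t (π ω')) T ⊔ WeightedSums.pastSigma W t) T
      (fun t ω' => f t (π ω')) W Θ P') ∧
    ∀ Θ : ℝ → Ω' → V ⊗[ℝ] V', WeightedSums.IsItoIntegral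
      (fun t => WeightedSums.pastSigma (fun t ω' => B t (π ω')) T ⊔ WeightedSums.pastSigma W t) T
      (fun t ω' => f t (π ω')) W Θ P' →
      WeightedSums.TendstoFDD T
        (fun n t ω => (WeightedSums.weightedSum T n f (h n) t ω, B t ω)) P
        (fun t ω' => (Θ t ω', B t (π ω'))) P' := by
  have hBm := hB.measurable
  have hpast := pastSigma_le hBm (le_refl T)
  have hfm : ∀ t ∈ Icc 0 T, AEStronglyMeasurable (f t) P := fun t ht => (hf_meas t ht).mono hpast
  have hB2 : ∀ t ∈ Icc 0 T, AEStronglyMeasurable (B t) P := fun t ht => (hB.memLp ht).1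
  obtain ⟨K, hw⟩ := exists_weightBounds (P := P) (γ := γ) (α := α) (B := B) (f := f) (g := g)
    (h := h) hT hB2 hfm hg_meas hh_meas hh_add (h_bdd 2 one_le_two) (h_ctrl 2 one_le_two)
    (h_deriv 2 one_le_two) (hh_bdd 2 one_le_two) (hh_int 2 one_le_two)
  have hf2 : ∀ t ∈ Icc 0 T, MemLp (f t) 2 P := fun t ht =>
    ⟨hfm t ht, (hw.f_le t ht).trans_lt ENNReal.ofReal_lt_top⟩
  have hfc : ∀ ε : ℝ≥0∞, ε ≠ 0 → ∃ δ > 0, ∀ s ∈ Icc 0 T, ∀ t ∈ Icc 0 T, |t - s| ≤ δ →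
      eLpNorm (incr f s t) 2 P ≤ ε := by
    intro ε hε
    obtain ⟨K₁, h1⟩ := h_bdd 3 (by norm_num)
    obtain ⟨K₂, h2⟩ := h_ctrl 1 le_rfl
    refine hB.exists_eLpNorm_incr_le (K := max K (max K₁ K₂)) hH0 hγ hfm hg_meas
      (fun t ht => (le_self_add.trans (h1 t ht)).trans (ENNReal.ofReal_le_ofReal ?_))
      (fun t ht => (hw.g_le t ht).trans (ENNReal.ofReal_le_ofReal (le_max_left _ _)))
      (fun s t hs hst ht => (h2 s t hs hst ht).trans (ENNReal.ofReal_le_ofReal ?_)) hε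
    · exact (le_max_left _ _).trans (le_max_right _ _)
    · exact mul_le_mul_of_nonneg_right ((le_max_right _ _).trans (le_max_right _ _))
        (Real.rpow_nonneg (sub_nonneg.2 hst) _)
  refine ⟨exists_isItoIntegral_of_continuous hT hBm hf_meas hf2 hfc hπ hW hWB, fun Θ hΘ =>
    tendstoFDD_of_frozen_approx hT hBm hf_meas hf2 hfc hπ hW hWB h_conv
      (fun n t _ => hw.aestronglyMeasurable_weightedSum hT n t) (fun t ht => ?_) hΘ⟩
  obtain ⟨e, he, hν⟩ := exists_eLpNorm_weightedSum_sub_le hw hT hγ hα hαγ hκ ht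
    (h_coarse t ht 2 one_le_two)
  refine ⟨fun ν => ENNReal.ofReal (e ν), 2 * ENNReal.ofReal (K * T ^ α) + 1, ?_, by finiteness,
    fun ν hν2 δ hδ0 hδ F hF hFδ => ?_⟩
  · simpa using ENNReal.tendsto_ofReal he
  · filter_upwards [hw.eventually_eLpNorm_weightedSum_sub_le hT hα hh_add hfc ht
      (fun n hn => hν n ν hν2 hn) hδ0 hδ hF hFδ] with n hn
    refine hn.trans (le_of_eq ?_)
    ring
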